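/- Let $\Lambda=\mathbb Z^3$ with its determinant form, $\Lambda^\vee=\mathrm{Hom}(\Lambda,\mathbb Z)$, and let $\Lambda_{prim}$ be the set of primitive vectors of $\Lambda$. For $\delta\in\Lambda^\vee$ extend $\delta$ linearly to $x\in\mathbb C^3$. For linearly independent $a,b\in\Lambda_{prim}$ the direction vector of the wedge $(a,b)$ is the unique primitive $\gamma=\gamma_{a,b}\in\Lambda^\vee$ such that $\det(a,b,\cdot)=s\gamma$ for a positive integer $s$. Put $$C_{+-}(a,b)=\{\delta\in\Lambda^\vee:\delta(a)>0,\ \delta(b)\le 0\},\qquad C_{-+}(a,b)=\{\delta\in\Lambda^\vee:\delta(a)\le 0,\ \delta(b)>0\},$$ $$\Gamma_{a,b}(w,x)=\frac{\prod_{\delta\in C_{+-}(a,b)/\mathbb Z\gamma}\bigl(1-e^{-2\pi i(\delta(x)-w)/\gamma(x)}\bigr)}{\prod_{\delta\in C_{-+}(a,b)/\mathbb Z\gamma}\bigl(1-e^{2\pi i(\delta(x)-w)/\gamma(x)}\bigr)},$$ and $\Gamma_{a,a}=1$ (for $a=-b$ no definition is needed, the domain below being empty). For $a\in\Lambda_{prim}$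 let $H(a)=\{\alpha\in(\mathbb Q^3)^*:\alpha(a)=0\}$, a basis $(\alpha,\beta)$ of $H(a)$ being oriented if $\det(\alpha,\beta,\delta)>0$ whenever $\delta(a)>0$, and let $U_a^+$ be the set of $x\in\mathbb C^3$ with $\mathrm{Im}(\alpha(x)\overline{\beta(x)})>0$ for some oriented basis $(\alpha,\beta)$ of $H(a)$. Let $$P_3(w,x_1,x_2,x_3)=\frac{w^3}{x_1x_2x_3}-\frac{3(x_1+x_2+x_3)}{2x_1x_2x_3}w^2+\frac{x_1^2+x_2^2+x_3^2+3x_1x_2+3x_2x_3+3x_1x_3}{2x_1x_2x_3}w-\frac14(x_1+x_2+x_3)\Bigl(\frac1{x_1}+\frac1{x_2}+\frac1{x_3}\Bigr).$$ **Theorem.** The two products defining $\Gamma_{a,b}$ converge for all linearly independent $a,b\in\Lambda_{prim}$, $x\in U_a^+\cap U_b^+$ and $w\in\mathbb C$. The polynomial $P_3$ is the multiple Bernoulli polynomial $B_{3,3}$, where $B_{r,n}$ is defined by $e^{wt}\prod_{j=1}^r\frac{t}{e^{x_jt}-1}=\sum_{n\ge0}B_{r,n}(w,x_1,\dots,x_r)\frac{t^n}{n!}$.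 There is a family of polynomials $P_{a,b,c}(w,x)\in\mathbb Q(x_1,x_2,x_3)[w]$, $a,b,c\in\Lambda_{prim}$, of degree at most $3$ in $w$, with coefficients regular on $U_a^+\cap U_b^+\cap U_c^+$, such that for all $a,b,c\in\Lambda_{prim}$, $x\in U_a^+\cap U_b^+\cap U_c^+$ and all $w\in\mathbb C$ that are not a pole of one of the factors (the poles of $\Gamma_{a,b}(\cdot,x)$ lie in $\{\delta(x):\delta\in C_{-+}(a,b)\}$) $$\Gamma_{a,b}(w,x)\,\Gamma_{b,c}(w,x)\,\Gamma_{c,a}(w,x)=\exp\Bigl(-\frac{\pi i}{3}P_{a,b,c}(w,x)\Bigr),$$ and such that the following hold. (i) If $a,b,c$ are linearly dependent then $P_{a,b,c}=0$. (ii) If $\det(a,b,c)>0$, let $\alpha,\beta,\gamma$ be the direction vectors of the wedges $(b,c)$, $(c,a)$, $(a,b)$, and let $F(a,b,c)$ be the set of $\delta\in\Lambda^\vee$ with $0\le\delta(a)<\alpha(a)$, $0\le\delta(b)<\beta(b)$, $0\le\delta(c)<\gamma(c)$. Then $F(a,b,c)$ is finite and $$P_{a,b,c}(w,x)=\sum_{\delta\in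 F(a,b,c)}P_3\bigl(w+\delta(x),\alpha(x),\beta(x),\gamma(x)\bigr)=\frac{\det(\alpha,\beta,\gamma)}{\alpha(x)\beta(x)\gamma(x)}\,w^3+(\text{terms of degree}\le 2\text{ in }w).$$ (iii) $P_{a_1,a_2,a_3}=\mathrm{sign}(\sigma)\,P_{a_{\sigma(1)},a_{\sigma(2)},a_{\sigma(3)}}$ for all $a_1,a_2,a_3\in\Lambda_{prim}$ and $\sigma\in S_3$. Moreover $P_{ga,gb,gc}(w,x)=P_{a,b,c}(w,g^{-1}x)$ for all $g\in SL_3(\mathbb Z)$ and $a,b,c\in\Lambda_{prim}$. -/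

import Mathlib

open scoped Matrix Polynomial

noncomputable section

namespace EllGamma

/-- The lattice `Λ = ℤ³`. The dual lattice `Λ^∨ = Hom(Λ, ℤ)` is identified with the same type by
means of the dual basis; the pairing is `pair`. -/
abbrev Lattice3 : Type := Fin 3 → ℤ

/-- `pair δ x = δ(x) = ∑ δᵢ xᵢ`: the value of the linear form with coefficients `δ` at a point `x`
of `M³`. -/
def pair {R M : Type*} [SMul R M] [AddCommMonoid M] (δ : Fin 3 → R) (x : Fin 3 → M) : M :=
  ∑ i, δ i • x i

/-- Primitive vectors of the lattice; in particular `0` is not primitive. -/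
def IsPrim (v : Lattice3) : Prop :=
  ∀ (l : ℤ) (u : Lattice3), v = l • u → l = 1 ∨ l = -1

/-- The modulus of the wedge `(a, b)`: the largest integer dividing the form `det(a, b, ·)`, whose
coefficient vector is the cross product of `a` and `b`. -/
def modulus (a b : Lattice3) : ℤ := Finset.univ.gcd (crossProduct a b)

/-- The direction vector of the wedge `(a, b)`: the primitive form `γ` with
`det(a, b, ·) = s γ`, `s > 0`. -/
def dirVec (a b : Lattice3) : Lattice3 := fun i => crossProduct a b i / modulus a b

theorem det_eq_modulus_mul_pair_dirVec (a b x : Lattice3) :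
    (Matrix.of ![a, b, x]).det = modulus a b * pair (dirVec a b) x := by
  have h : ∀ i, modulus a b * dirVec a b i = crossProduct a b i := fun i =>
    Int.mul_ediv_cancel' (Finset.gcd_dvd (Finset.mem_univ i))
  have h' : modulus a b * pair (dirVec a b) x = ∑ i, crossProduct a b i * x i := by
    rw [pair, Finset.mul_sum]
    exact Finset.sum_congr rfl fun i _ => by rw [smul_eq_mul, ← mul_assoc, h]
  rw [h', Fin.sum_univ_three, Matrix.det_fin_three]
  simp [cross_apply]
  ring

theorem modulus_pos {a b : Lattice3} (hab : LinearIndependent ℤ ![a, b]) : 0 < modulus a b := by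
  have h0 : 0 ≤ modulus a b := by
    have h : normalize (modulus a b) = modulus a b := Finset.normalize_gcd
    rw [← Int.abs_eq_normalize] at h
    exact abs_eq_self.mp h
  refine lt_of_le_of_ne h0 fun h => ?_
  have h1 : ∀ i, crossProduct a b i = 0 := fun i =>
    Finset.gcd_eq_zero_iff.mp h.symm i (Finset.mem_univ i)
  have c0 := h1 0
  have c1 := h1 1
  have c2 := h1 2
  simp only [cross_apply, Matrix.cons_val] at c0 c1 c2
  rw [LinearIndependent.pair_iff] at hab
  have h2 : ∀ i, a i = 0 := by
    intro i
    refine neg_eq_zero.mp (hab (b i) (-a i) ?_).2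
    funext j
    simp only [Pi.add_apply, Pi.smul_apply, smul_eq_mul, Pi.zero_apply]
    fin_cases i <;> fin_cases j <;> simp <;> linarith
  have h3 := (hab 1 0 (by funext i; simp [h2 i])).1
  exact one_ne_zero h3

theorem isPrim_dirVec {a b : Lattice3} (hab : LinearIndependent ℤ ![a, b]) :
    IsPrim (dirVec a b) := by
  intro l u h
  have hs := modulus_pos hab
  have h1 : ∀ i, modulus a b * l ∣ crossProduct a b i := by
    intro i
    refine ⟨u i, ?_⟩
    have h2 : dirVec a b i = l * u i := by rw [h]; rfl
    rw [mul_assoc, ← h2]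
    exact (Int.mul_ediv_cancel' (Finset.gcd_dvd (Finset.mem_univ i))).symm
  have h3 : modulus a b * l ∣ modulus a b := Finset.dvd_gcd fun i _ => h1 i
  have h4 : l ∣ 1 := by
    refine Int.dvd_of_mul_dvd_mul_left (a := modulus a b) hs.ne' ?_
    simpa using h3
  exact Int.isUnit_iff.mp (isUnit_of_dvd_one h4)

/-- The cone `C_{+-}(a, b)` of forms `δ` with `δ(a) > 0` and `δ(b) ≤ 0`. -/
def conePM (a b : Lattice3) : Set Lattice3 := {δ | 0 < pair δ a ∧ pair δ b ≤ 0}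

/-- The cone `C_{-+}(a, b)` of forms `δ` with `δ(a) ≤ 0` and `δ(b) > 0`. -/
def coneMP (a b : Lattice3) : Set Lattice3 := {δ | pair δ a ≤ 0 ∧ 0 < pair δ b}

/-- The set `C / ℤγ` of classes modulo `γ` of the elements of a `γ`-invariant set `C` of forms. -/
def classes (C : Set Lattice3) (γ : Lattice3) : Set (Lattice3 ⧸ AddSubgroup.zmultiples γ) :=
  QuotientAddGroup.mk '' C

/-- The factor `1 - exp(-2πi (δ(x) - w) / γ(x))`, `γ` the direction vector of `(a, b)`, of the
numerator of `Γ_{a,b}`; it depends only on the class of `δ` modulo `γ`. -/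
def numFactor (a b : Lattice3) (w : ℂ) (x : Fin 3 → ℂ)
    (q : classes (conePM a b) (dirVec a b)) : ℂ :=
  1 - Complex.exp (-2 * Real.pi * Complex.I * (pair (Quotient.out q.1) x - w) /
    pair (dirVec a b) x)

/-- The factor `1 - exp(2πi (δ(x) - w) / γ(x))`, `γ` the direction vector of `(a, b)`, of the
denominator of `Γ_{a,b}`; it depends only on the class of `δ` modulo `γ`. -/
def denFactor (a b : Lattice3) (w : ℂ) (x : Fin 3 → ℂ)
    (q : classes (coneMP a b) (dirVec a b)) : ℂ :=
  1 - Complex.exp (2 * Real.pi * Complex.I * (pair (Quotient.out q.1) x - w) /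
    pair (dirVec a b) x)

open Classical in
/-- The gamma function `Γ_{a,b}(w, x)` of a wedge. It is `1` for `a = b`; the value for `a = -b`
plays no role, since the domain is then empty. -/
def wedgeGamma (a b : Lattice3) (w : ℂ) (x : Fin 3 → ℂ) : ℂ :=
  if LinearIndependent ℤ ![a, b] then
    (∏' q, numFactor a b w x q) / (∏' q, denFactor a b w x q)
  else 1

/-- The set `U⁺_a` of `x ∈ ℂ³` with `Im(α(x) * conj β(x)) > 0` for some oriented basis `(α, β)` of
the plane `H(a) = {α | α(a) = 0}` in the dual of `ℚ³`; the basis is oriented if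
`det(α, β, δ) > 0` whenever `δ(a) > 0`. -/
def U (a : Lattice3) : Set (Fin 3 → ℂ) :=
  {x | ∃ α β : Fin 3 → ℚ,
    pair α (fun i => (a i : ℚ)) = 0 ∧ pair β (fun i => (a i : ℚ)) = 0 ∧
    LinearIndependent ℚ ![α, β] ∧
    (∀ δ : Fin 3 → ℚ, 0 < pair δ (fun i => (a i : ℚ)) → 0 < (Matrix.of ![α, β, δ]).det) ∧
    0 < (pair α x * (starRingEnd ℂ) (pair β x)).im}

/-- `w` is not a pole of `Γ_{a,b}(·, x)`: the poles are the numbers `δ(x)` with `δ ∈ C_{-+}(a, b)`,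
a set that is invariant under translation by the direction vector. -/
def NotPole (a b : Lattice3) (w : ℂ) (x : Fin 3 → ℂ) : Prop :=
  ∀ δ ∈ coneMP a b, w ≠ pair δ x

/-- The field `ℚ(x) = ℚ(x₁, x₂, x₃)`. -/
abbrev RatFun : Type := FractionRing (MvPolynomial (Fin 3) ℚ)

/-- The generic point `x = (x₁, x₂, x₃)` with coordinates in `ℚ(x)`; so `pair δ coord` is the
linear form `δ(x)` as an element of `ℚ(x)`. -/
def coord : Fin 3 → RatFun :=
  fun i => algebraMap (MvPolynomial (Fin 3) ℚ) RatFun (MvPolynomial.X i)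

/-- The denominator of `f`, written in lowest terms, does not vanish at `x`. -/
def RegularAt (f : RatFun) (x : Fin 3 → ℂ) : Prop :=
  MvPolynomial.aeval x
    (IsFractionRing.den (MvPolynomial (Fin 3) ℚ) f : MvPolynomial (Fin 3) ℚ) ≠ 0

/-- The value at `x` of a rational function that is regular at `x`. -/
def ratEval (f : RatFun) (x : Fin 3 → ℂ) : ℂ :=
  MvPolynomial.aeval x (IsFractionRing.num (MvPolynomial (Fin 3) ℚ) f) /
    MvPolynomial.aeval x
      (IsFractionRing.den (MvPolynomial (Fin 3) ℚ) f : MvPolynomial (Fin 3) ℚ)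

/-- The value `p(w, x)` of `p ∈ ℚ(x)[w]`. -/
def polyEval (p : RatFun[X]) (w : ℂ) (x : Fin 3 → ℂ) : ℂ :=
  p.sum fun k c => ratEval c x * w ^ k

/-- The substitution `f(x) ↦ f(g x)` on polynomials, for `g ∈ SL₃(ℤ)`. -/
def polySubst (g : Matrix.SpecialLinearGroup (Fin 3) ℤ) :
    MvPolynomial (Fin 3) ℚ →ₐ[ℚ] MvPolynomial (Fin 3) ℚ :=
  MvPolynomial.aeval fun i => pair (fun j => g.1 i j) MvPolynomial.X

theorem polySubst_comp (g h : Matrix.SpecialLinearGroup (Fin 3) ℤ) (hgh : h * g = 1) :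
    (polySubst g).comp (polySubst h) = AlgHom.id ℚ _ := by
  refine MvPolynomial.algHom_ext fun i => ?_
  have hm : ∀ k, ∑ j, h.1 i j * g.1 j k = (1 : Matrix (Fin 3) (Fin 3) ℤ) i k := by
    intro k
    have h1 : h.1 * g.1 = 1 := by
      rw [← Matrix.SpecialLinearGroup.coe_one, ← hgh]; rfl
    rw [← h1, Matrix.mul_apply]
  simp only [AlgHom.comp_apply, polySubst, MvPolynomial.aeval_X, pair, map_sum, map_zsmul,
    Finset.smul_sum, smul_smul, AlgHom.id_apply]
  rw [Finset.sum_comm]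
  simp only [← Finset.sum_smul, hm]
  simp [Matrix.one_apply]

/-- The substitution `f(x) ↦ f(g x)` on rational functions, for `g ∈ SL₃(ℤ)`. -/
def ratSubst (g : Matrix.SpecialLinearGroup (Fin 3) ℤ) : RatFun ≃+* RatFun :=
  IsFractionRing.ringEquivOfRingEquiv
    (AlgEquiv.ofAlgHom (polySubst g) (polySubst g⁻¹)
      (polySubst_comp g g⁻¹ (inv_mul_cancel g))
      (polySubst_comp g⁻¹ g (mul_inv_cancel g))).toRingEquiv

/-- The multiple Bernoulli polynomial `B_{r,n}(w, x₁, …, x_r)`, a polynomial in `w` (for nonzero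
`xⱼ`), given by `e^{wt} ∏ⱼ t / (e^{xⱼ t} - 1) = ∑ₙ B_{r,n}(w, x) tⁿ / n!`. The series
`(e^{xt} - 1) / t` is `∑ₖ x^{k+1} tᵏ / (k+1)!`. -/
def multiBernoulli {F : Type*} [Field F] (r n : ℕ) (x : Fin r → F) : F[X] :=
  (n.factorial : F[X]) * PowerSeries.coeff n
    ((PowerSeries.mk fun k => Polynomial.C (1 / (k.factorial : F)) * Polynomial.X ^ k) *
      PowerSeries.map Polynomial.C
        (∏ j, (PowerSeries.mk fun k => x j ^ (k + 1) / ((k + 1).factorial : F))⁻¹))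

/-- The polynomial `P₃(w, x₁, x₂, x₃)` in `w`. -/
def P₃ {F : Type*} [Field F] (x₁ x₂ x₃ : F) : F[X] :=
  Polynomial.C (1 / (x₁ * x₂ * x₃)) * Polynomial.X ^ 3
  - Polynomial.C (3 * ((x₁ + x₂ + x₃) / (2 * x₁ * x₂ * x₃))) * Polynomial.X ^ 2
  + Polynomial.C ((x₁ ^ 2 + x₂ ^ 2 + x₃ ^ 2 + 3 * x₁ * x₂ + 3 * x₂ * x₃ + 3 * x₁ * x₃)
      / (2 * x₁ * x₂ * x₃)) * Polynomial.X
  - Polynomial.C (1 / 4 * (x₁ + x₂ + x₃) * (1 / x₁ + 1 / x₂ + 1 / x₃))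

/-- The lattice points `F(a, b, c)` of the half-open parallelepiped spanned by the direction
vectors of `(b, c)`, `(c, a)`, `(a, b)`. -/
def parallelepiped (a b c : Lattice3) : Set Lattice3 :=
  {δ | (0 ≤ pair δ a ∧ pair δ a < pair (dirVec b c) a) ∧
    (0 ≤ pair δ b ∧ pair δ b < pair (dirVec c a) b) ∧
    (0 ≤ pair δ c ∧ pair δ c < pair (dirVec a b) c)}

end EllGamma

end

open scoped Matrix Polynomial

noncomputable section

namespace EllGamma

section


open Filter Topology Metric Set

/-! ### A residue theorem on discs -/

/-! Put N(x) = Im x × Re x (`imCross`). If x lies in U_a^+ then ⟨a, N(x)⟩ > 0, and for a wedge (a,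
b) of modulus s with direction vector γ, s · Im(δ(x) conj γ(x)) = δ(b)⟨a, N⟩ − δ(a)⟨b, N⟩
(`modulus_mul_im`). On the cones this is geometric decay of the exponentials, hence convergence.
Since γ_{b,a} = −γ_{a,b}, the denominator of Γ_{a,b} is the numerator of Γ_{b,a}, so only one kind
of product, `numProd`, has to be studied.

If a, b, c are dependent, they lie in an open half-space. Either two of them coincide, or one lies
strictly between the other two; the sign of δ on the middle vector then splits the cone of the outer
wedge into the cones of the inner ones (`numProd_mul_of_between`), and everything cancels.

If det(a, b, c) > 0, the direction vectors α, β, γ are dual to a, b, c up to scaling. Division with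
remainder writes every class of C_{+-}(a, b) modulo γ uniquely as −δ + (m + 1)α − nβ with δ in F(a,
b, c) and m, n ≥ 0 (`IsDualFamily.classEquiv`). So all six numerators are finite products over the
same set F of double products `gammaProd` at w + δ(x), and the relation can be proved for one δ at a
time, for the three numbers y = (α(x), β(x), γ(x)) (`gammaProd_three_term`).

That relation is a residue theorem. Let w = (y₀ + y₁ + y₂)/2 + ω with ω small. The kernel e^{ωt} /
(t ∏ 2 sinh(yⱼt/2)) has simple poles at 2πik/yⱼ, k ≠ 0. Up to the factor 2πi, the residues with k >
0 are the Lambert terms of the logarithm of the j-th numerator, and those with k < 0 the negatives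
of the terms for the j-th denominator. The residue at 0 is P₃(w, y)/6. The kernel decays
exponentially on suitable large circles, so all residues add up to zero (`hasSum_kernRes_eq`). With
denominators cleared both sides are entire in w, and the identity theorem removes the restriction on
ω.

A negative determinant is reduced to a positive one by exchanging a and b. The leading coefficient
in (ii) counts F, whose cardinality is the index det(α, β, γ) of a sublattice. -/

theorem exists_differentiableOn_eqOn_sdiff (S : Finset ℂ) :
    ∀ {U : Set ℂ} {g : ℂ → ℂ}, IsOpen U → DifferentiableOn ℂ g (U \ S) →
      (∀ p ∈ S, Tendsto (fun t => (t - p) * g t) (𝓝[≠] p) (𝓝 0)) →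
      ∃ h : ℂ → ℂ, DifferentiableOn ℂ h U ∧ EqOn g h (U \ S) := by
  induction S using Finset.induction_on with
  | empty =>
    intro U g _ hg _
    exact ⟨g, by simpa using hg, fun _ _ => rfl⟩
  | insert p S hp ih =>
    intro U g hU hg hlim
    have hU' : IsOpen (U \ (S : Set ℂ)) := hU.sdiff S.finite_toSet.isClosed
    by_cases hpU : p ∈ U
    · have hnhds : U \ (S : Set ℂ) ∈ 𝓝 p := hU'.mem_nhds ⟨hpU, by simpa using hp⟩
      -- The singularity at p is removed first, by Riemann's theorem for functions that are o(1/(t −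
      -- p)); the modified function has one exceptional point fewer.
      have hset : (U \ (S : Set ℂ)) \ {p} = U \ ((insert p S : Finset ℂ) : Set ℂ) := by
        ext z; simp; tauto
      have hd := Complex.differentiableOn_update_limUnder_of_isLittleO hnhds
        (by rw [hset]; exact hg) (by
          rw [Asymptotics.isLittleO_iff_tendsto']
          · have h1 := hlim p (Finset.mem_insert_self _ _)
            have h2 : Tendsto (fun t => (t - p) * g p) (𝓝[≠] p) (𝓝 0) := by
              have : Tendsto (fun t => (t - p) * g p) (𝓝 p) (𝓝 ((p - p) * g p)) :=
                Continuous.tendsto (by fun_prop) p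
              rw [sub_self, zero_mul] at this
              exact this.mono_left nhdsWithin_le_nhds
            have h3 := h1.sub h2
            rw [sub_zero] at h3
            refine h3.congr fun t => ?_
            rw [div_inv_eq_mul]; ring
          · filter_upwards [self_mem_nhdsWithin] with t ht h0
            exact absurd (sub_eq_zero.mp (inv_eq_zero.mp h0)) ht)
      obtain ⟨h, hh1, hh2⟩ := ih hU hd fun q hq => by
        have hqp : q ≠ p := fun h => hp (h ▸ hq)
        refine (hlim q (Finset.mem_insert_of_mem hq)).congr' ?_
        have : ∀ᶠ t in 𝓝[≠] q, t ≠ p :=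
          nhdsWithin_le_nhds (isOpen_ne.mem_nhds hqp)
        filter_upwards [this] with t ht
        rw [Function.update_of_ne ht]
      refine ⟨h, hh1, fun z hz => ?_⟩
      rw [← hset] at hz
      rw [← hh2 hz.1, Function.update_of_ne (by simpa using hz.2)]
    · have hset : U \ ((insert p S : Finset ℂ) : Set ℂ) = U \ S := by
        ext z
        simp only [Finset.coe_insert, Set.mem_sdiff, mem_insert_iff, Finset.mem_coe, not_or]
        refine ⟨fun h => ⟨h.1, h.2.2⟩, fun h => ⟨h.1, fun h' => hpU (h' ▸ h.1), h.2⟩⟩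
      rw [hset] at hg ⊢
      exact ih hU hg fun q hq => hlim q (Finset.mem_insert_of_mem hq)

/-- Every point of S is a removable singularity, and none lies on the circle, so Cauchy's theorem
applies to the holomorphic extension. -/
theorem circleIntegral_eq_zero_of_tendsto {g : ℂ → ℂ} {S : Finset ℂ} {R : ℝ} (hR : 0 < R)
    (hS : ∀ p ∈ S, ‖p‖ < R) {U : Set ℂ} (hU : IsOpen U) (hRU : closedBall 0 R ⊆ U)
    (hg : DifferentiableOn ℂ g (U \ S))
    (hlim : ∀ p ∈ S, Tendsto (fun t => (t - p) * g t) (𝓝[≠] p) (𝓝 0)) :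
    (∮ t in C(0, R), g t) = 0 := by
  obtain ⟨h, h1, h2⟩ := exists_differentiableOn_eqOn_sdiff S hU hg hlim
  rw [circleIntegral.integral_congr hR.le (g := h)]
  · refine DiffContOnCl.circleIntegral_eq_zero hR.le ?_
    refine DifferentiableOn.diffContOnCl ?_
    rw [closure_ball _ hR.ne']
    exact h1.mono hRU
  · intro z hz
    refine h2 ⟨hRU (sphere_subset_closedBall hz), fun hzS => ?_⟩
    have := hS z hzS
    simp at hz
    linarith

theorem tendsto_sub_mul_of_differentiableAt {h : ℂ → ℂ} {p : ℂ} (hh : ContinuousAt h p) :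
    Tendsto (fun t => (t - p) * h t) (𝓝[≠] p) (𝓝 0) := by
  have : ContinuousAt (fun t => (t - p) * h t) p := by fun_prop
  have h2 := this.tendsto
  rw [sub_self, zero_mul] at h2
  exact h2.mono_left nhdsWithin_le_nhds

/-- The residue theorem on a disc for a function with simple poles away from the centre, and a pole
of order at most `4` at the centre. -/
theorem circleIntegral_eq_sum_residues {ι : Type*} {f : ℂ → ℂ} {T : Finset ι} {p r : ι → ℂ} {R : ℝ}
    (hR : 0 < R) (hinj : InjOn p T) (hp0 : ∀ i ∈ T, p i ≠ 0) (hpR : ∀ i ∈ T, ‖p i‖ < R)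
    {U : Set ℂ} (hU : IsOpen U) (hRU : closedBall 0 R ⊆ U)
    (hf : ∀ t ∈ U, t ≠ 0 → (∀ i ∈ T, t ≠ p i) → DifferentiableAt ℂ f t)
    (hlim : ∀ i ∈ T, Tendsto (fun t => (t - p i) * f t) (𝓝[≠] (p i)) (𝓝 (r i)))
    {a b c d : ℂ}
    (hlim0 : Tendsto (fun t => t * f t - (a / t ^ 3 + b / t ^ 2 + c / t)) (𝓝[≠] 0) (𝓝 d)) :
    (∮ t in C(0, R), f t) = 2 * Real.pi * Complex.I * (d + ∑ i ∈ T, r i) := by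
  classical
  set A : ℂ → ℂ := fun t => a / t ^ 4 + b / t ^ 3 + c / t ^ 2 + d / t with hA
  set B : ℂ → ℂ := fun t => ∑ i ∈ T, r i / (t - p i) with hB
  set S : Finset ℂ := insert 0 (T.image p)
  have hAd : ∀ t, t ≠ 0 → DifferentiableAt ℂ A t := fun t ht => by
    simp only [hA]; fun_prop (disch := simpa using ht)
  have hBd : ∀ t, ∀ T' : Finset ι, (∀ i ∈ T', t ≠ p i) →
      DifferentiableAt ℂ (fun t => ∑ i ∈ T', r i / (t - p i)) t := fun t T' ht => by
    refine DifferentiableAt.fun_sum fun i hi => ?_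
    have := sub_ne_zero.mpr (ht i hi)
    fun_prop (disch := assumption)
  have hSR : ∀ q ∈ S, ‖q‖ < R := by
    intro q hq
    rcases Finset.mem_insert.mp hq with rfl | hq
    · simpa using hR
    · obtain ⟨i, hi, rfl⟩ := Finset.mem_image.mp hq
      exact hpR i hi
  have hsph : ∀ t ∈ sphere (0 : ℂ) R, t ≠ 0 ∧ ∀ i ∈ T, t ≠ p i := by
    intro t ht
    have ht' : ‖t‖ = R := by simpa using ht
    refine ⟨fun h => ?_, fun i hi h => ?_⟩
    · rw [h, norm_zero] at ht'; exact hR.ne ht'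
    · have := hpR i hi
      rw [← h, ht'] at this
      exact lt_irrefl _ this
  -- A is the principal part at the centre and B the sum of the principal parts at the simple poles,
  -- so only removable singularities are left after subtraction.
  have hzero : (∮ t in C(0, R), (f t - (A t + B t))) = 0 := by
    refine circleIntegral_eq_zero_of_tendsto hR hSR hU hRU ?_ ?_
    · intro t ht
      have h0 : t ≠ 0 := fun h => ht.2 (by simp [S, h])
      have h1 : ∀ i ∈ T, t ≠ p i := fun i hi h => ht.2 (by
        simp only [S, Finset.coe_insert, Finset.coe_image]
        exact Or.inr ⟨i, hi, h.symm⟩)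
      exact ((hf t ht.1 h0 h1).sub ((hAd t h0).add (hBd t T h1))).differentiableWithinAt
    · intro q hq
      rcases Finset.mem_insert.mp hq with rfl | hq
      · have h1 : Tendsto (fun t => (t - 0) * B t) (𝓝[≠] 0) (𝓝 0) :=
          tendsto_sub_mul_of_differentiableAt
            (hBd 0 T fun i hi h => hp0 i hi h.symm).continuousAt
        have h2 := (hlim0.sub_const d).sub h1
        simp only [sub_self, sub_zero] at h2
        refine h2.congr' ?_
        filter_upwards [self_mem_nhdsWithin] with t ht
        have ht : t ≠ 0 := ht
        simp only [hA, sub_zero]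
        field_simp
        ring
      · obtain ⟨i, hi, rfl⟩ := Finset.mem_image.mp hq
        have h1 : Tendsto (fun t => (t - p i) * (A t + ∑ k ∈ T.erase i, r k / (t - p k)))
            (𝓝[≠] (p i)) (𝓝 0) := by
          refine tendsto_sub_mul_of_differentiableAt (ContinuousAt.add ?_ ?_)
          · exact (hAd _ (hp0 i hi)).continuousAt
          · refine (hBd _ _ fun k hk h => ?_).continuousAt
            exact (Finset.mem_erase.mp hk).1
              (hinj (Finset.mem_erase.mp hk).2 hi h.symm)
        have h2 := ((hlim i hi).sub_const (r i)).sub h1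
        simp only [sub_self] at h2
        refine h2.congr' ?_
        filter_upwards [self_mem_nhdsWithin] with t ht
        have ht : t - p i ≠ 0 := sub_ne_zero.mpr ht
        simp only [hB]
        rw [← Finset.add_sum_erase T _ hi]
        field_simp
        ring
  have hfi : CircleIntegrable f 0 R := ContinuousOn.circleIntegrable hR.le fun t ht =>
    (hf t (hRU (sphere_subset_closedBall ht)) (hsph t ht).1
      (hsph t ht).2).continuousAt.continuousWithinAt
  have hAi : CircleIntegrable A 0 R := ContinuousOn.circleIntegrable hR.le fun t ht =>
    (hAd t (hsph t ht).1).continuousAt.continuousWithinAt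
  have hBi : CircleIntegrable B 0 R := ContinuousOn.circleIntegrable hR.le fun t ht =>
    (hBd t T (hsph t ht).2).continuousAt.continuousWithinAt
  have hpow : ∀ (x : ℂ) (n : ℕ), (∮ t in C(0, R), x / t ^ (n + 2)) = 0 := by
    intro x n
    have h := circleIntegral.integral_sub_zpow_of_ne (n := -((n : ℤ) + 2)) (by omega)
      (0 : ℂ) 0 R
    have h2 := circleIntegral.integral_const_mul x (fun t => (t - 0) ^ (-((n : ℤ) + 2))) 0 R
    rw [h, mul_zero] at h2
    refine Eq.trans (congrArg (fun F : ℂ → ℂ => circleIntegral F 0 R) (funext fun t => ?_)) h2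
    rw [sub_zero, zpow_neg, div_eq_mul_inv]
    norm_cast
  have hinv : ∀ (x q : ℂ), ‖q‖ < R →
      (∮ t in C(0, R), x / (t - q)) = 2 * Real.pi * Complex.I * x := by
    intro x q hq
    have h := circleIntegral.integral_sub_inv_of_mem_ball (c := 0) (w := q) (R := R)
      (by simpa using hq)
    have h2 := circleIntegral.integral_const_mul x (fun t => (t - q)⁻¹) 0 R
    rw [h] at h2
    rw [mul_comm _ x, ← h2]
    rfl
  have hci : ∀ (x : ℂ) (n : ℕ), CircleIntegrable (fun t => x / t ^ n) 0 R := fun x n =>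
    ContinuousOn.circleIntegrable hR.le fun t ht => by
      have := (hsph t ht).1
      have h2 : DifferentiableAt ℂ (fun t => x / t ^ n) t := by
        fun_prop (disch := simp [this])
      exact h2.continuousAt.continuousWithinAt
  have hIA : (∮ t in C(0, R), A t) = 2 * Real.pi * Complex.I * d := by
    have h1 := hci a 4
    have h2 := hci b 3
    have h3 := hci c 2
    have h4 : CircleIntegrable (fun t => d / t) 0 R := by simpa using hci d 1
    have e1 := circleIntegral.integral_add ((h1.add h2).add h3) h4
    have e2 := circleIntegral.integral_add (h1.add h2) h3
    have e3 := circleIntegral.integral_add h1 h2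
    have e4 := hinv d 0 (by simpa using hR)
    simp only [sub_zero] at e4
    simp only [Pi.add_apply] at e1 e2 e3
    rw [e2, e3, e4, hpow a 2, hpow b 1, hpow c 0] at e1
    simpa [hA] using e1
  have hIB : (∮ t in C(0, R), B t) = 2 * Real.pi * Complex.I * ∑ i ∈ T, r i := by
    rw [hB, circleIntegral.integral_fun_sum, Finset.mul_sum]
    · exact Finset.sum_congr rfl fun i hi => hinv _ _ (hpR i hi)
    · intro i hi
      refine ContinuousOn.circleIntegrable hR.le fun t ht => ?_
      have := sub_ne_zero.mpr ((hsph t ht).2 i hi)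
      have h2 : DifferentiableAt ℂ (fun t => r i / (t - p i)) t := by
        fun_prop (disch := assumption)
      exact h2.continuousAt.continuousWithinAt
  have e1 := circleIntegral.integral_sub hfi (hAi.add hBi)
  have e2 := circleIntegral.integral_add hAi hBi
  simp only [Pi.add_apply] at e1
  rw [e2, hIA, hIB, hzero] at e1
  rw [sub_eq_zero.mp e1.symm]
  ring

/-! ### Hyperbolic sine away from its zeros -/

theorem normSq_sinh (z : ℂ) :
    Complex.normSq (Complex.sinh z) = Real.sinh z.re ^ 2 + Real.sin z.im ^ 2 := by
  have h : Complex.sinh z = Complex.sinh z.re * Complex.cos z.im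
      + Complex.cosh z.re * Complex.sin z.im * Complex.I := by
    conv_lhs => rw [← Complex.re_add_im z]
    rw [Complex.sinh_add, Complex.cosh_mul_I, Complex.sinh_mul_I, mul_assoc]
  rw [h, ← Complex.ofReal_sinh, ← Complex.ofReal_cos, ← Complex.ofReal_cosh, ← Complex.ofReal_sin,
    ← Complex.ofReal_mul, ← Complex.ofReal_mul, Complex.normSq_add_mul_I]
  have h1 := Real.cosh_sq z.re
  have h2 := Real.sin_sq_add_cos_sq z.im
  rw [mul_pow, mul_pow, h1]
  linear_combination (Real.sinh z.re ^ 2) * h2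

/-- For large |Re z| the real hyperbolic sine dominates. For small |Re z|, |sinh(z/2)| is comparable
to the distance from z to the nearest zero, by |sinh r| ≥ |r| and Jordan's inequality for the sine.
-/
theorem exists_mul_exp_le_norm_two_mul_sinh {η : ℝ} (hη : 0 < η) :
    ∃ c : ℝ, 0 < c ∧ ∀ z : ℂ, (∀ k : ℤ, η ≤ ‖z - 2 * Real.pi * Complex.I * k‖) →
      c * Real.exp (|z.re| / 2) ≤ ‖2 * Complex.sinh (z / 2)‖ := by
  -- The entry 1/2 serves |Re z| ≥ 1, where e^{-r/2} ≤ e^{r/2}/2 because e^r ≥ 2. The other entry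
  -- serves |Re z| < 1, where the norm is at least 2η/π and e^{-1/2} absorbs the exponential.
  refine ⟨min (1 / 2) (2 * η / Real.pi * Real.exp (-1 / 2)), by positivity, fun z hz => ?_⟩
  set k : ℤ := round (z.im / (2 * Real.pi))
  set d : ℝ := z.im - 2 * Real.pi * k
  have hpi := Real.pi_pos
  have hd : |d| ≤ Real.pi := by
    have h1 := abs_sub_round (z.im / (2 * Real.pi))
    have h2 : d = 2 * Real.pi * (z.im / (2 * Real.pi) - k) := by
      simp only [d]; field_simp
    rw [h2, abs_mul, abs_of_pos (by positivity : (0 : ℝ) < 2 * Real.pi)]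
    nlinarith
  have hsin : Real.sin (z.im / 2) ^ 2 = Real.sin (d / 2) ^ 2 := by
    have h1 : d / 2 = z.im / 2 - k * Real.pi := by simp only [d]; ring
    rw [h1, Real.sin_sub_int_mul_pi, mul_pow]
    rcases Int.even_or_odd k with h | h <;> simp [h.neg_one_zpow]
  have hnorm : ‖2 * Complex.sinh (z / 2)‖ ^ 2
      = (2 * Real.sinh (z.re / 2)) ^ 2 + (2 * Real.sin (d / 2)) ^ 2 := by
    rw [norm_mul, mul_pow, ← Complex.normSq_eq_norm_sq (Complex.sinh _), normSq_sinh]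
    have h1 : (z / 2).re = z.re / 2 := by simp
    have h2 : (z / 2).im = z.im / 2 := by simp
    rw [h1, h2, hsin]
    simp
    ring
  have hsinh : |z.re| ≤ |2 * Real.sinh (z.re / 2)| := by
    rw [abs_mul, Real.abs_sinh, abs_div]
    have := Real.self_le_sinh_iff.mpr (by positivity : 0 ≤ |z.re| / |(2 : ℝ)|)
    simp only [Nat.abs_ofNat] at this ⊢
    linarith
  have hN : 0 ≤ ‖2 * Complex.sinh (z / 2)‖ := norm_nonneg _
  rcases le_or_gt 1 |z.re| with h1 | h1
  · have h2 : |2 * Real.sinh (z.re / 2)| ≤ ‖2 * Complex.sinh (z / 2)‖ := by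
      refine abs_le_of_sq_le_sq' ?_ hN |> abs_le.mpr
      rw [hnorm]; nlinarith [sq_nonneg (2 * Real.sin (d / 2))]
    refine le_trans ?_ h2
    rw [abs_mul, Real.abs_sinh, abs_div, Real.sinh_eq]
    simp only [Nat.abs_ofNat]
    have h3 : Real.exp (-(|z.re| / 2)) ≤ 1 / 2 * Real.exp (|z.re| / 2) := by
      have h4 : Real.exp (|z.re| / 2) * Real.exp (|z.re| / 2) = Real.exp |z.re| := by
        rw [← Real.exp_add]; ring_nf
      have h5 : 2 ≤ Real.exp |z.re| := by
        have := Real.add_one_le_exp |z.re|; linarith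
      rw [Real.exp_neg, inv_le_iff_one_le_mul₀ (Real.exp_pos _)]
      nlinarith
    have h6 : min (1 / 2) (2 * η / Real.pi * Real.exp (-1 / 2)) * Real.exp (|z.re| / 2)
        ≤ 1 / 2 * Real.exp (|z.re| / 2) :=
      mul_le_mul_of_nonneg_right (min_le_left _ _) (Real.exp_pos _).le
    linarith
  · have h2 : (2 * η / Real.pi) ≤ ‖2 * Complex.sinh (z / 2)‖ := by
      refine le_of_sq_le_sq ?_ hN
      rw [hnorm]
      have hs : |d| * (2 / Real.pi) ≤ |2 * Real.sin (d / 2)| := by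
        have h3 := Real.mul_abs_le_abs_sin (x := d / 2) (by
          rw [abs_div]; simp only [Nat.abs_ofNat]; linarith)
        rw [abs_div] at h3
        rw [abs_mul]
        simp only [Nat.abs_ofNat] at h3 ⊢
        have : 2 / Real.pi * (|d| / 2) * 2 = |d| * (2 / Real.pi) := by ring
        linarith
      have hz' : η ^ 2 ≤ z.re ^ 2 + d ^ 2 := by
        have h3 := hz k
        have h4 : ‖z - 2 * Real.pi * Complex.I * k‖ ^ 2 = z.re ^ 2 + d ^ 2 := by
          rw [← Complex.normSq_eq_norm_sq, Complex.normSq_apply]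
          simp [d]
          ring
        rw [← h4]
        gcongr
      have h5 : |z.re| ^ 2 ≤ (2 * Real.sinh (z.re / 2)) ^ 2 := by
        rw [← sq_abs (2 * _)]; gcongr
      have h6 : (|d| * (2 / Real.pi)) ^ 2 ≤ (2 * Real.sin (d / 2)) ^ 2 := by
        rw [← sq_abs (2 * _)]; gcongr
      have h7 : (2 / Real.pi) ^ 2 ≤ 1 := by
        rw [sq_le_one_iff₀ (by positivity), div_le_one hpi]
        linarith [Real.two_le_pi]
      rw [sq_abs] at h5
      rw [mul_pow, sq_abs] at h6
      have h8 : (2 * η / Real.pi) ^ 2 = η ^ 2 * (2 / Real.pi) ^ 2 := by ring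
      rw [h8]
      nlinarith [sq_nonneg (2 / Real.pi), sq_nonneg z.re]
    refine le_trans ?_ h2
    calc min (1 / 2) (2 * η / Real.pi * Real.exp (-1 / 2)) * Real.exp (|z.re| / 2)
        ≤ (2 * η / Real.pi * Real.exp (-1 / 2)) * Real.exp (1 / 2) := by
          gcongr
          exact min_le_right _ _
      _ = 2 * η / Real.pi := by
          rw [mul_assoc, ← Real.exp_add]; norm_num

/-- Arbitrarily large radii that stay away from the multiples of three given positive numbers. -/
theorem exists_radius_away (c : Fin 3 → ℝ) (hc : ∀ j, 0 < c j) :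
    ∃ d : ℝ, 0 < d ∧ ∀ R₀ : ℝ, ∃ R ≥ R₀, ∀ j, ∀ k : ℤ, d ≤ |R - c j * k| := by
  obtain ⟨m, hm0, hm⟩ : ∃ m : ℝ, 0 < m ∧ ∀ j, m ≤ c j :=
    ⟨min (c 0) (min (c 1) (c 2)), by simp [hc], fun j => by
      fin_cases j <;> simp⟩
  -- Pigeonhole: of the four candidates R₀ + i·m/4, two would be within m/8 of multiples of the same
  -- cⱼ. Those multiples would differ by a number strictly between 0 and m ≤ cⱼ, which is
  -- impossible.
  refine ⟨m / 8, by positivity, fun R₀ => ?_⟩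
  by_contra! hcon
  have h1 : ∀ i : Fin 4, ∃ j, ∃ k : ℤ, |R₀ + i * (m / 4) - c j * k| < m / 8 := fun i =>
    hcon (R₀ + i * (m / 4)) (by simp only [ge_iff_le, le_add_iff_nonneg_right]; positivity)
  choose J K hJK using h1
  obtain ⟨i, i', hne, hJ⟩ := Fintype.exists_ne_map_eq_of_card_lt J (by simp)
  wlog hlt : i < i' generalizing i i'
  · exact this i' i hne.symm hJ.symm (lt_of_le_of_ne (not_lt.mp hlt) hne.symm)
  have a1 := abs_lt.mp (hJK i)
  have a2 := abs_lt.mp (hJK i')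
  rw [hJ] at a1
  have b1 : (i : ℝ) + 1 ≤ (i' : ℝ) := by exact_mod_cast hlt
  have b2 : (i' : ℝ) ≤ 3 := by
    have : (i' : ℕ) ≤ 3 := by omega
    exact_mod_cast this
  have b3 : (0 : ℝ) ≤ (i : ℝ) := by positivity
  have hcm := hm (J i')
  have e1 : 0 < c (J i') * ((K i' - K i : ℤ) : ℝ) := by
    push_cast; nlinarith
  have e2 : c (J i') * ((K i' - K i : ℤ) : ℝ) < m := by
    push_cast; nlinarith
  have e3 : (0 : ℝ) < ((K i' - K i : ℤ) : ℝ) := by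
    by_contra! h
    nlinarith [hc (J i')]
  have e4 : (1 : ℝ) ≤ ((K i' - K i : ℤ) : ℝ) := by
    have : (0 : ℤ) < K i' - K i := by exact_mod_cast e3
    exact_mod_cast this
  nlinarith [hc (J i')]

end

section


open Filter Topology Metric Set

/-! ### The kernel whose residues are the terms of the logarithms of the gamma functions -/

/-- The function `t ↦ e^{ωt} / (t ∏ⱼ 2 sinh(yⱼ t / 2))`. -/
def kern (y : Fin 3 → ℂ) (ω t : ℂ) : ℂ :=
  Complex.exp (ω * t) / (t * ∏ j, (2 * Complex.sinh (y j * t / 2)))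

/-- The zero `2πik / y` of `t ↦ sinh(y t / 2)`. -/
def kernPole (y : ℂ) (k : ℤ) : ℂ := 2 * Real.pi * Complex.I * k / y

/-- The residue of `kern y ω` at the pole `2πik / yⱼ` for `k ≠ 0`; it is `0` for `k = 0`. -/
def kernRes (y : Fin 3 → ℂ) (ω : ℂ) (i : Fin 3 × ℤ) : ℂ :=
  (-1) ^ i.2 * Complex.exp (ω * kernPole (y i.1) i.2) / (kernPole (y i.1) i.2 * y i.1 *
    ∏ j ∈ Finset.univ.erase i.1, (2 * Complex.sinh (y j * kernPole (y i.1) i.2 / 2)))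

theorem two_mul_sinh_half_eq_zero_iff {y t : ℂ} (hy : y ≠ 0) :
    2 * Complex.sinh (y * t / 2) = 0 ↔ ∃ k : ℤ, t = kernPole y k := by
  have h1 : 2 * Complex.sinh (y * t / 2) = 0 ↔ Complex.exp (y * t) = 1 := by
    have h : 2 * Complex.sinh (y * t / 2) * Complex.exp (y * t / 2) = Complex.exp (y * t) - 1 := by
      rw [Complex.two_sinh, sub_mul, ← Complex.exp_add, ← Complex.exp_add]
      ring_nf
      simp
      ring
    rw [← sub_eq_zero (a := Complex.exp (y * t)), ← h, mul_eq_zero]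
    simp [Complex.exp_ne_zero]
  rw [h1, Complex.exp_eq_one_iff]
  refine exists_congr fun k => ?_
  rw [kernPole, eq_div_iff hy]
  constructor <;> intro h <;> linear_combination h

theorem ne_zero_of_im_mul_conj_ne {u v : ℂ} (h : (u * (starRingEnd ℂ) v).im ≠ 0) :
    u ≠ 0 ∧ v ≠ 0 :=
  ⟨fun h0 => h (by simp [h0]), fun h0 => h (by simp [h0])⟩

/-- No real linear dependence between the entries of `y`. -/
def PairwiseNonreal (y : Fin 3 → ℂ) : Prop :=
  ∀ i j, i ≠ j → (y i * (starRingEnd ℂ) (y j)).im ≠ 0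

theorem PairwiseNonreal.ne_zero {y : Fin 3 → ℂ} (hy : PairwiseNonreal y) (j : Fin 3) : y j ≠ 0 := by
  have h : ∃ i, i ≠ j := exists_ne j
  obtain ⟨i, hi⟩ := h
  exact (ne_zero_of_im_mul_conj_ne (hy i j hi)).2

theorem kernPole_ne_zero {y : ℂ} (hy : y ≠ 0) {k : ℤ} (hk : k ≠ 0) : kernPole y k ≠ 0 := by
  have := Real.pi_ne_zero
  have h : (k : ℂ) ≠ 0 := by exact_mod_cast hk
  simp [kernPole, *]

/-- A coincidence of poles for different indices would make the quotient of two entries of y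
rational. Hence the poles of the kernel away from the origin are simple. -/
theorem PairwiseNonreal.kernPole_inj {y : Fin 3 → ℂ} (hy : PairwiseNonreal y) {i j : Fin 3}
    {k l : ℤ} (hk : k ≠ 0) (h : kernPole (y i) k = kernPole (y j) l) : i = j ∧ k = l := by
  have hi := hy.ne_zero i
  have hj := hy.ne_zero j
  have hpi : (2 * Real.pi * Complex.I : ℂ) ≠ 0 := Complex.two_pi_I_ne_zero
  rw [kernPole, kernPole, div_eq_div_iff hi hj] at h
  have h' : (k : ℂ) * y j = l * y i := by
    apply mul_left_cancel₀ hpi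
    linear_combination h
  by_cases hij : i = j
  · subst hij
    exact ⟨rfl, by exact_mod_cast mul_right_cancel₀ hi h'⟩
  · exfalso
    have h2 := congrArg (fun z => (z * (starRingEnd ℂ) (y i)).im) h'
    have h3 : ((l : ℂ) * y i * (starRingEnd ℂ) (y i)).im = 0 := by
      rw [mul_assoc, Complex.mul_conj]; simp
    have h4 : ((k : ℂ) * y j * (starRingEnd ℂ) (y i)).im
        = k * (y j * (starRingEnd ℂ) (y i)).im := by
      rw [mul_assoc, ← Complex.ofReal_intCast, Complex.im_ofReal_mul]
    rw [h3, h4] at h2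
    rcases mul_eq_zero.mp h2 with h5 | h5
    · exact hk (by exact_mod_cast h5)
    · exact hy j i (Ne.symm hij) h5

theorem differentiableAt_kern {y : Fin 3 → ℂ} (hy : ∀ j, y j ≠ 0) (ω : ℂ) {t : ℂ} (ht : t ≠ 0)
    (ht' : ∀ j, ∀ k : ℤ, t ≠ kernPole (y j) k) : DifferentiableAt ℂ (kern y ω) t := by
  have h : t * ∏ j, (2 * Complex.sinh (y j * t / 2)) ≠ 0 := by
    refine mul_ne_zero ht (Finset.prod_ne_zero_iff.mpr fun j _ h => ?_)
    obtain ⟨k, hk⟩ := (two_mul_sinh_half_eq_zero_iff (hy j)).mp h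
    exact ht' j k hk
  simp only [Fin.prod_univ_three] at h
  unfold kern
  simp only [Fin.prod_univ_three]
  fun_prop (disch := assumption)

/-- Only the j-th hyperbolic sine vanishes at this pole, with derivative yⱼ cosh(πik) = (−1)^k yⱼ;
the remaining factor `G` is continuous there. -/
theorem tendsto_kern_pole {y : Fin 3 → ℂ} (hy : PairwiseNonreal y) (ω : ℂ) (j : Fin 3) {k : ℤ}
    (hk : k ≠ 0) :
    Tendsto (fun t => (t - kernPole (y j) k) * kern y ω t) (𝓝[≠] (kernPole (y j) k))
      (𝓝 (kernRes y ω (j, k))) := by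
  set p := kernPole (y j) k with hp
  have hyj := hy.ne_zero j
  have hp0 : p ≠ 0 := kernPole_ne_zero hyj hk
  have hzero : 2 * Complex.sinh (y j * p / 2) = 0 :=
    (two_mul_sinh_half_eq_zero_iff hyj).mpr ⟨k, rfl⟩
  have hcosh : Complex.cosh (y j * p / 2) = (-1) ^ k := by
    have : y j * p / 2 = (k * Real.pi : ℂ) * Complex.I := by
      simp only [hp, kernPole]; field_simp
    rw [this, Complex.cosh_mul_I]
    have h2 := congrArg (fun r : ℝ => (r : ℂ)) (Real.cos_int_mul_pi k)
    push_cast at h2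
    exact h2
  have hneg : ((-1 : ℂ) ^ k) ≠ 0 := zpow_ne_zero _ (by norm_num)
  have hd : HasDerivAt (fun t => 2 * Complex.sinh (y j * t / 2)) (y j * (-1) ^ k) p := by
    have h1 : HasDerivAt (fun t => y j * t / 2) (y j / 2) p := by
      simpa using ((hasDerivAt_id p).const_mul (y j)).div_const 2
    have h2 := (h1.csinh).const_mul 2
    rw [hcosh] at h2
    exact h2.congr_deriv (by ring)
  have hs := hd.tendsto_slope
  have hs' : Tendsto (fun t => (t - p) / (2 * Complex.sinh (y j * t / 2))) (𝓝[≠] p)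
      (𝓝 (y j * (-1) ^ k)⁻¹) := by
    refine (hs.inv₀ (mul_ne_zero hyj hneg)).congr fun t => ?_
    rw [slope_def_field, hzero, sub_zero, inv_div]
  set G : ℂ → ℂ := fun t => Complex.exp (ω * t) /
    (t * ∏ i ∈ Finset.univ.erase j, (2 * Complex.sinh (y i * t / 2))) with hG
  have hGne : p * ∏ i ∈ Finset.univ.erase j, (2 * Complex.sinh (y i * p / 2)) ≠ 0 := by
    refine mul_ne_zero hp0 (Finset.prod_ne_zero_iff.mpr fun i hi h => ?_)
    obtain ⟨l, hl⟩ := (two_mul_sinh_half_eq_zero_iff (hy.ne_zero i)).mp h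
    exact (Finset.mem_erase.mp hi).1 (hy.kernPole_inj hk hl).1.symm
  have hGc : ContinuousAt G p := by
    refine ContinuousAt.div (by fun_prop) ?_ hGne
    exact Continuous.continuousAt (by fun_prop)
  have hlim := hs'.mul (hGc.tendsto.mono_left nhdsWithin_le_nhds)
  have hval : (y j * (-1) ^ k)⁻¹ * G p = kernRes y ω (j, k) := by
    simp only [hG, kernRes, ← hp]
    have hsq : ((-1 : ℂ) ^ k) * (-1) ^ k = 1 := by
      rw [← mul_zpow]; simp
    have : ((-1 : ℂ) ^ k)⁻¹ = (-1) ^ k := inv_eq_of_mul_eq_one_left hsq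
    rw [mul_inv, this]
    ring
  rw [hval] at hlim
  refine hlim.congr fun t => ?_
  simp only [hG, kern]
  rw [← Finset.mul_prod_erase Finset.univ _ (Finset.mem_univ j)]
  ring

/-! ### The residue at the origin -/

open Asymptotics in
-- Truncated expansions may be multiplied, because fg − pq = (f − p)g + p(g − q) with g and p
-- bounded.
theorem mul_sub_mul_isBigO_pow {f g p q : ℂ → ℂ} {n : ℕ}
    (hf : (fun t => f t - p t) =O[𝓝[≠] 0] fun t => t ^ n)
    (hg : (fun t => g t - q t) =O[𝓝[≠] 0] fun t => t ^ n)
    (hp : p =O[𝓝[≠] 0] fun _ => (1 : ℂ)) (hq : q =O[𝓝[≠] 0] fun _ => (1 : ℂ)) :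
    (fun t => f t * g t - p t * q t) =O[𝓝[≠] 0] fun t => t ^ n := by
  have htn : (fun t : ℂ => t ^ n) =O[𝓝[≠] 0] fun _ => (1 : ℂ) := by
    exact ((continuous_pow n).continuousAt (x := (0 : ℂ))).tendsto.isBigO_one ℂ |>.mono
      nhdsWithin_le_nhds
  have hgb : g =O[𝓝[≠] 0] fun _ => (1 : ℂ) := by
    simpa using (hg.trans htn).add hq
  have a1 := hf.mul hgb
  have a2 := hp.mul hg
  simp only [mul_one, one_mul] at a1 a2
  have h1 := a1.add a2
  refine h1.congr_left fun t => ?_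
  ring

open Asymptotics in
theorem mul_div_sinh_half_isBigO {y : ℂ} (hy : y ≠ 0) :
    (fun t => y * t / (2 * Complex.sinh (y * t / 2)) - (1 - (y * t) ^ 2 / 24))
      =O[𝓝[≠] 0] fun t => t ^ 4 := by
  have hexp := Complex.exp_sub_sum_range_isBigO_pow 5
  have hyt : Tendsto (fun t : ℂ => y * t / 2) (𝓝[≠] 0) (𝓝 0) := by
    have : ContinuousAt (fun t : ℂ => y * t / 2) 0 := by fun_prop
    simpa using this.tendsto.mono_left nhdsWithin_le_nhds
  have hyt' : Tendsto (fun t : ℂ => -(y * t / 2)) (𝓝[≠] 0) (𝓝 0) := by simpa using hyt.neg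
  have hO : ∀ c : ℂ, (fun t : ℂ => (c * t) ^ 5) =O[𝓝[≠] 0] fun t => t ^ 5 := fun c => by
    simp only [mul_pow]
    exact isBigO_const_mul_self _ _ _
  have h1 : (fun t => 2 * Complex.sinh (y * t / 2) - (y * t + (y * t) ^ 3 / 24))
      =O[𝓝[≠] 0] fun t => t ^ 5 := by
    have a1 := (hexp.comp_tendsto hyt).trans ((hO (y / 2)).congr_left fun t => by
      simp only [Function.comp]; ring)
    have a2 := (hexp.comp_tendsto hyt').trans ((hO (-(y / 2))).congr_left fun t => by
      simp only [Function.comp]; ring)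
    refine (a1.sub a2).congr_left fun t => ?_
    simp only [Function.comp, Complex.two_sinh, Finset.sum_range_succ, Finset.sum_range_zero,
      Nat.factorial]
    push_cast
    ring
  have hd : HasDerivAt (fun t => 2 * Complex.sinh (y * t / 2)) y 0 := by
    have h1 : HasDerivAt (fun t => y * t / 2) (y / 2) 0 := by
      simpa using ((hasDerivAt_id (0 : ℂ)).const_mul y).div_const 2
    have h2 := (h1.csinh).const_mul 2
    exact h2.congr_deriv (by simp; ring)
  have hs : Tendsto (fun t => t / (2 * Complex.sinh (y * t / 2))) (𝓝[≠] 0) (𝓝 y⁻¹) := by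
    refine (hd.tendsto_slope.inv₀ hy).congr fun t => ?_
    rw [slope_def_field]
    simp
  have hs1 := hs.isBigO_one ℂ
  have hne : ∀ᶠ t in 𝓝[≠] (0 : ℂ), 2 * Complex.sinh (y * t / 2) ≠ 0 :=
    hd.eventually_ne hy
  have h2 : (fun t => ((y * t - (1 - (y * t) ^ 2 / 24) * (2 * Complex.sinh (y * t / 2))) / t))
      =O[𝓝[≠] 0] fun t => t ^ 4 := by
    have b1 : (fun t : ℂ => -(1 - (y * t) ^ 2 / 24)) =O[𝓝[≠] 0] fun _ => (1 : ℂ) := by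
      have hc : ContinuousAt (fun t : ℂ => -(1 - (y * t) ^ 2 / 24)) 0 := by fun_prop
      exact (hc.tendsto.isBigO_one ℂ).mono nhdsWithin_le_nhds
    have b2 := b1.mul h1
    simp only [one_mul] at b2
    -- With z = yt, (1 − z²/24)(z + z³/24) = z − z⁵/576: the truncation of the reciprocal is correct
    -- up to this term.
    have b3 : (fun t : ℂ => (y ^ 5 / 576) * t ^ 5) =O[𝓝[≠] 0] fun t => t ^ 5 :=
      isBigO_const_mul_self _ _ _
    have b4 := (b2.add b3).mul (isBigO_refl (fun t : ℂ => t⁻¹) (𝓝[≠] 0))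
    refine (b4.congr_left (f₂ := fun t =>
      (y * t - (1 - (y * t) ^ 2 / 24) * (2 * Complex.sinh (y * t / 2))) / t) fun t => ?_).congr'
      EventuallyEq.rfl ?_
    · ring
    · filter_upwards [self_mem_nhdsWithin] with t ht
      have ht : t ≠ 0 := ht
      field_simp
  have h3 := h2.mul hs1
  simp only [mul_one] at h3
  refine h3.congr' ?_ EventuallyEq.rfl
  filter_upwards [hne, self_mem_nhdsWithin] with t ht ht0
  have ht0 : t ≠ 0 := ht0
  rw [div_mul_div_cancel₀ ht0, sub_div, mul_div_cancel_right₀ _ ht]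

open Asymptotics in
-- The limit is the residue of the kernel at the origin, obtained as the t³ coefficient of e^{ωt} ∏
-- (1 − (yⱼt)²/24) divided by y₀y₁y₂.
theorem tendsto_kern_zero {y : Fin 3 → ℂ} (hy : ∀ j, y j ≠ 0) (ω : ℂ) :
    ∃ a b c : ℂ, Tendsto (fun t => t * kern y ω t - (a / t ^ 3 + b / t ^ 2 + c / t)) (𝓝[≠] 0)
      (𝓝 ((ω ^ 3 / 6 - ω * (y 0 ^ 2 + y 1 ^ 2 + y 2 ^ 2) / 24) / (y 0 * y 1 * y 2))) := by
  set s := y 0 ^ 2 + y 1 ^ 2 + y 2 ^ 2 with hs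
  set Y := y 0 * y 1 * y 2 with hY
  have hY0 : Y ≠ 0 := by simp [hY, hy]
  refine ⟨1 / Y, ω / Y, (ω ^ 2 / 2 - s / 24) / Y, ?_⟩
  have hbd : ∀ f : ℂ → ℂ, Continuous f → f =O[𝓝[≠] 0] fun _ => (1 : ℂ) := fun f hf =>
    (hf.continuousAt.tendsto.isBigO_one ℂ : _ =O[𝓝 (0 : ℂ)] _).mono nhdsWithin_le_nhds
  have he : (fun t => Complex.exp (ω * t) - (1 + ω * t + (ω * t) ^ 2 / 2 + (ω * t) ^ 3 / 6))
      =O[𝓝[≠] 0] fun t => t ^ 4 := by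
    have hwt : Tendsto (fun t : ℂ => ω * t) (𝓝[≠] 0) (𝓝 0) := by
      have : ContinuousAt (fun t : ℂ => ω * t) 0 := by fun_prop
      simpa using this.tendsto.mono_left nhdsWithin_le_nhds
    have a1 := (Complex.exp_sub_sum_range_isBigO_pow 4).comp_tendsto hwt
    have a2 : (fun t : ℂ => (ω * t) ^ 4) =O[𝓝[≠] 0] fun t => t ^ 4 := by
      simp only [mul_pow]
      exact isBigO_const_mul_self _ _ _
    refine (a1.trans a2).congr_left fun t => ?_
    simp only [Function.comp, Finset.sum_range_succ, Finset.sum_range_zero, Nat.factorial]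
    push_cast
    ring
  have h := mul_sub_mul_isBigO_pow (mul_sub_mul_isBigO_pow (mul_sub_mul_isBigO_pow he
    (mul_div_sinh_half_isBigO (hy 0)) (hbd _ (by fun_prop)) (hbd _ (by fun_prop)))
    (mul_div_sinh_half_isBigO (hy 1)) (hbd _ (by fun_prop)) (hbd _ (by fun_prop)))
    (mul_div_sinh_half_isBigO (hy 2)) (hbd _ (by fun_prop)) (hbd _ (by fun_prop))
  have hO : (fun t => (t * kern y ω t - (1 / Y / t ^ 3 + ω / Y / t ^ 2
      + (ω ^ 2 / 2 - s / 24) / Y / t)) - (ω ^ 3 / 6 - ω * s / 24) / Y) =O[𝓝[≠] 0] fun t => t := by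
    -- `Q` collects the terms of order at least 4 in the product of the four truncations, divided by
    -- t⁴.
    set Q : ℂ → ℂ := fun t => (1 + ω * t + (ω * t) ^ 2 / 2 + (ω * t) ^ 3 / 6) *
      ((y 0 ^ 2 * y 1 ^ 2 + y 0 ^ 2 * y 2 ^ 2 + y 1 ^ 2 * y 2 ^ 2) / 24 ^ 2
        - y 0 ^ 2 * y 1 ^ 2 * y 2 ^ 2 * t ^ 2 / 24 ^ 3) - s / 24 * (ω ^ 2 / 2 + ω ^ 3 / 6 * t)
      with hQ
    have h2 : (fun t => Q t * t ^ 4) =O[𝓝[≠] 0] fun t => t ^ 4 := by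
      have := (hbd Q (by simp only [hQ]; fun_prop)).mul
        (isBigO_refl (fun t : ℂ => t ^ 4) (𝓝[≠] 0))
      simpa using this
    have h3 := (h.add h2).mul (isBigO_refl (fun t : ℂ => (Y * t ^ 3)⁻¹) (𝓝[≠] 0))
    have h4 : (fun t : ℂ => t ^ 4 * (Y * t ^ 3)⁻¹) =O[𝓝[≠] 0] fun t => t := by
      refine (isBigO_const_mul_self Y⁻¹ (fun t : ℂ => t) (𝓝[≠] 0)).congr' ?_ EventuallyEq.rfl
      filter_upwards [self_mem_nhdsWithin] with t ht
      have ht : t ≠ 0 := ht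
      field_simp
    refine (h3.trans h4).congr' ?_ EventuallyEq.rfl
    filter_upwards [self_mem_nhdsWithin] with t ht
    have ht : t ≠ 0 := ht
    have hk : t * kern y ω t = (Complex.exp (ω * t) * (y 0 * t / (2 * Complex.sinh (y 0 * t / 2)))
        * (y 1 * t / (2 * Complex.sinh (y 1 * t / 2)))
        * (y 2 * t / (2 * Complex.sinh (y 2 * t / 2)))) * (Y * t ^ 3)⁻¹ := by
      simp only [kern, Fin.prod_univ_three, hY]
      have h0 := hy 0
      have h1 := hy 1
      have h2 := hy 2
      field_simp
    rw [hk]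
    generalize Complex.exp (ω * t) * (y 0 * t / (2 * Complex.sinh (y 0 * t / 2)))
        * (y 1 * t / (2 * Complex.sinh (y 1 * t / 2)))
        * (y 2 * t / (2 * Complex.sinh (y 2 * t / 2))) = X
    have hpoly : (1 + ω * t + (ω * t) ^ 2 / 2 + (ω * t) ^ 3 / 6) * (1 - (y 0 * t) ^ 2 / 24) *
        (1 - (y 1 * t) ^ 2 / 24) * (1 - (y 2 * t) ^ 2 / 24) = 1 + ω * t + (ω ^ 2 / 2 - s / 24) * t ^ 2
        + (ω ^ 3 / 6 - ω * s / 24) * t ^ 3 + Q t * t ^ 4 := by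
      simp only [hQ, hs]; ring
    rw [hpoly]
    field_simp
    ring
  have h5 : Tendsto (fun t : ℂ => t) (𝓝[≠] 0) (𝓝 0) := tendsto_id.mono_left nhdsWithin_le_nhds
  have h6 := (hO.trans_tendsto h5).add_const ((ω ^ 3 / 6 - ω * s / 24) / Y)
  simpa using h6

end

section


open Filter Topology Metric Set

/-! ### The sum of all residues of the kernel -/

/-- Two of the periods are already independent over ℝ, so Re(y₀t) and Re(y₁t) determine t; solving
for t explicitly gives the constant. The sum is the exponential growth rate of the product of
hyperbolic sines. -/
theorem PairwiseNonreal.exists_coercive {y : Fin 3 → ℂ} (hy : PairwiseNonreal y) :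
    ∃ κ : ℝ, 0 < κ ∧ ∀ t : ℂ, κ * ‖t‖ ≤ ∑ j, |(y j * t).re| / 2 := by
  set Δ := (y 0 * (starRingEnd ℂ) (y 1)).im with hΔ
  have hΔ0 : 0 < |Δ| := abs_pos.mpr (hy 0 1 (by decide))
  set M := ‖y 0‖ + ‖y 1‖ with hM
  have hM0 : 0 < M := add_pos (norm_pos_iff.mpr (hy.ne_zero 0)) (norm_pos_iff.mpr (hy.ne_zero 1))
  refine ⟨|Δ| / (2 * M), by positivity, fun t => ?_⟩
  have hid : (Complex.I * Δ * t : ℂ) = (starRingEnd ℂ) (y 1) * ((y 0 * t).re : ℂ)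
      - (starRingEnd ℂ) (y 0) * ((y 1 * t).re : ℂ) := by
    apply Complex.ext <;> simp [hΔ] <;> ring
  have hle : |Δ| * ‖t‖ ≤ ‖y 1‖ * |(y 0 * t).re| + ‖y 0‖ * |(y 1 * t).re| := by
    have h1 : ‖(Complex.I * Δ * t : ℂ)‖ = |Δ| * ‖t‖ := by simp
    rw [← h1, hid]
    refine (norm_sub_le _ _).trans (le_of_eq ?_)
    rw [norm_mul, norm_mul, Complex.norm_conj, Complex.norm_conj, Complex.norm_real,
      Complex.norm_real, Real.norm_eq_abs, Real.norm_eq_abs]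
  rw [Fin.sum_univ_three, div_mul_eq_mul_div, div_le_iff₀ (by positivity)]
  have n0 := norm_nonneg (y 0)
  have n1 := norm_nonneg (y 1)
  have a0 := abs_nonneg (y 0 * t).re
  have a1 := abs_nonneg (y 1 * t).re
  have a2 := abs_nonneg (y 2 * t).re
  nlinarith [mul_nonneg n0 a0, mul_nonneg n1 a1, mul_nonneg n0 a2, mul_nonneg n1 a2]

theorem norm_kernPole (y : ℂ) (k : ℤ) : ‖kernPole y k‖ = 2 * Real.pi / ‖y‖ * |(k : ℝ)| := by
  rw [kernPole, norm_div, norm_mul, norm_mul, norm_mul]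
  simp [abs_of_pos Real.pi_pos]
  ring

theorem finite_norm_kernPole_lt {y : Fin 3 → ℂ} (hy : ∀ j, y j ≠ 0) (R : ℝ) :
    {i : Fin 3 × ℤ | ‖kernPole (y i.1) i.2‖ < R}.Finite := by
  have h : ∀ j, {k : ℤ | ‖kernPole (y j) k‖ < R}.Finite := by
    intro j
    have hpos : 0 < 2 * Real.pi / ‖y j‖ := by
      have := norm_pos_iff.mpr (hy j); have := Real.pi_pos; positivity
    set B := R / (2 * Real.pi / ‖y j‖)
    refine (Set.finite_Icc (-⌈B⌉) ⌈B⌉).subset fun k hk => ?_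
    have h1 : |(k : ℝ)| < B := by
      rw [lt_div_iff₀ hpos, mul_comm, ← norm_kernPole]
      exact hk
    have h2 := abs_lt.mp (h1.trans_le (Int.le_ceil B))
    constructor
    · exact_mod_cast h2.1.le
    · exact_mod_cast h2.2.le
  refine (Set.Finite.biUnion (Set.finite_univ (α := Fin 3))
    fun j _ => (h j).image fun k => (j, k)).subset ?_
  rintro ⟨j, k⟩ hk
  simp only [mem_univ, iUnion_true, mem_iUnion]
  exact ⟨j, k, hk, rfl⟩

theorem hasSum_kernRes_eq {y : Fin 3 → ℂ} (hy : PairwiseNonreal y) :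
    ∃ ε : ℝ, 0 < ε ∧ ∀ ω : ℂ, ‖ω‖ < ε → ∀ s : ℂ, HasSum (kernRes y ω) s →
      s = -((ω ^ 3 / 6 - ω * (y 0 ^ 2 + y 1 ^ 2 + y 2 ^ 2) / 24) / (y 0 * y 1 * y 2)) := by
  obtain ⟨κ, hκ, hcoer⟩ := hy.exists_coercive
  have hy0 := hy.ne_zero
  have hpi := Real.pi_pos
  have hny : ∀ j, 0 < ‖y j‖ := fun j => norm_pos_iff.mpr (hy0 j)
  -- The poles 2πik/yⱼ have modulus |k| · 2π/‖yⱼ‖, so circles of these radii stay at distance at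
  -- least d from all of them.
  obtain ⟨d, hd, hrad⟩ := exists_radius_away (fun j => 2 * Real.pi / ‖y j‖)
    fun j => by have := hny j; positivity
  choose R hRn hRd using fun n : ℕ => hrad (n + 1)
  obtain ⟨m, hm0, hm⟩ : ∃ m : ℝ, 0 < m ∧ ∀ j, m ≤ ‖y j‖ :=
    ⟨min ‖y 0‖ (min ‖y 1‖ ‖y 2‖), by simp [hy0], fun j => by
      fin_cases j <;> simp⟩
  obtain ⟨c, hc, hsinh⟩ := exists_mul_exp_le_norm_two_mul_sinh (mul_pos hm0 hd)
  -- The denominator grows like e^{κ|t|} on the circles; |ω| < κ/2 leaves a decay e^{-κ|t|/2} of the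
  -- kernel.
  refine ⟨κ / 2, by positivity, fun ω hω s hs => ?_⟩
  have hRpos : ∀ n, 0 < R n := fun n => lt_of_lt_of_le (by positivity) (hRn n)
  have hRtop : Tendsto R atTop atTop :=
    tendsto_atTop_mono (fun n => (le_trans (by linarith) (hRn n) : (n : ℝ) ≤ R n))
      tendsto_natCast_atTop_atTop
  set D : ℂ := (ω ^ 3 / 6 - ω * (y 0 ^ 2 + y 1 ^ 2 + y 2 ^ 2) / 24) / (y 0 * y 1 * y 2) with hD
  have hbound : ∀ n, ∀ t ∈ sphere (0 : ℂ) (R n),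
      ‖kern y ω t‖ ≤ Real.exp (-(κ / 2) * R n) / (c ^ 3 * R n) := by
    intro n t ht
    have htR : ‖t‖ = R n := by simpa using ht
    have h1 : ∀ j, c * Real.exp (|(y j * t).re| / 2) ≤ ‖2 * Complex.sinh (y j * t / 2)‖ := by
      intro j
      refine hsinh _ fun k => ?_
      have h2 := hRd n j |k|
      have h3 : |‖y j * t‖ - ‖2 * Real.pi * Complex.I * k‖| ≤
          ‖y j * t - 2 * Real.pi * Complex.I * k‖ := abs_norm_sub_norm_le _ _
      refine le_trans ?_ h3
      have h4 : ‖y j * t‖ - ‖2 * Real.pi * Complex.I * k‖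
          = ‖y j‖ * (R n - 2 * Real.pi / ‖y j‖ * ((|k| : ℤ) : ℝ)) := by
        rw [norm_mul, htR]
        have := (hny j).ne'
        simp [abs_of_pos hpi]
        field_simp
      rw [h4, abs_mul, abs_of_pos (hny j)]
      exact mul_le_mul (hm j) h2 hd.le (hny j).le
    have hE : ‖Complex.exp (ω * t)‖ ≤ Real.exp (κ / 2 * R n) := by
      rw [Complex.norm_exp]
      refine Real.exp_le_exp.mpr ((Complex.re_le_norm _).trans ?_)
      rw [norm_mul, htR]
      exact mul_le_mul_of_nonneg_right hω.le (hRpos n).le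
    have hP : c ^ 3 * Real.exp (κ * R n) ≤ ∏ j, ‖2 * Complex.sinh (y j * t / 2)‖ := by
      calc c ^ 3 * Real.exp (κ * R n) ≤ c ^ 3 * Real.exp (∑ j, |(y j * t).re| / 2) := by
            gcongr
            rw [← htR]; exact hcoer t
        _ = ∏ j, (c * Real.exp (|(y j * t).re| / 2)) := by
            rw [Finset.prod_mul_distrib, Real.exp_sum]; simp
        _ ≤ _ := Finset.prod_le_prod (fun j _ => by positivity) fun j _ => h1 j
    rw [kern, norm_div, norm_mul, norm_prod, htR]
    have hR0 := hRpos n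
    calc ‖Complex.exp (ω * t)‖ / (R n * ∏ j, ‖2 * Complex.sinh (y j * t / 2)‖)
        ≤ Real.exp (κ / 2 * R n) / (R n * (c ^ 3 * Real.exp (κ * R n))) := by gcongr
      _ = _ := by
          have : Real.exp (-(κ / 2) * R n) = Real.exp (κ / 2 * R n) / Real.exp (κ * R n) := by
            rw [← Real.exp_sub]; ring_nf
          rw [this]
          field_simp
  have hint : Tendsto (fun n => ∮ t in C(0, R n), kern y ω t) atTop (𝓝 0) := by
    have hle : ∀ n, ‖∮ t in C(0, R n), kern y ω t‖
        ≤ 2 * Real.pi / c ^ 3 * Real.exp (-(κ / 2) * R n) := by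
      intro n
      refine (circleIntegral.norm_integral_le_of_norm_le_const (hRpos n).le (hbound n)).trans
        (le_of_eq ?_)
      have := (hRpos n).ne'
      field_simp
    refine squeeze_zero_norm hle ?_
    have h1 : Tendsto (fun n => -(κ / 2) * R n) atTop atBot :=
      hRtop.const_mul_atTop_of_neg (by linarith)
    simpa using (Real.tendsto_exp_atBot.comp h1).const_mul (2 * Real.pi / c ^ 3)
  -- The finite sets of poles inside the circles exhaust the index set, so the unconditional sum s
  -- is the limit of the partial sums over them.
  set T : ℕ → Finset (Fin 3 × ℤ) := fun n => (finite_norm_kernPole_lt hy0 (R n)).toFinset with hT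
  have hTtop : Tendsto T atTop atTop := by
    refine tendsto_atTop.mpr fun F => ?_
    have h1 : ∀ᶠ n in atTop, ∀ i ∈ F, ‖kernPole (y i.1) i.2‖ < R n :=
      (Finset.eventually_all F).mpr fun i _ => hRtop.eventually_gt_atTop _
    filter_upwards [h1] with n hn i hi
    simpa [hT] using hn i hi
  obtain ⟨a, b, c', hzero⟩ := tendsto_kern_zero hy0 ω
  have hres : ∀ n, (∮ t in C(0, R n), kern y ω t)
      = 2 * Real.pi * Complex.I * (D + ∑ i ∈ T n, kernRes y ω i) := by
    intro n
    -- The indices with k = 0 all stand for the origin, which is treated separately; there `kernRes`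
    -- is 0 through division by zero.
    have hsum : ∑ i ∈ T n, kernRes y ω i = ∑ i ∈ T n with i.2 ≠ 0, kernRes y ω i := by
      refine (Finset.sum_filter_of_ne (p := fun i : Fin 3 × ℤ => i.2 ≠ 0)
        fun i _ h h0 => h ?_).symm
      simp [kernRes, kernPole, h0]
    rw [hsum]
    have hmem : ∀ i, i ∈ (T n).filter (fun i => i.2 ≠ 0) ↔
        ‖kernPole (y i.1) i.2‖ < R n ∧ i.2 ≠ 0 := fun i => by simp [hT]
    refine circleIntegral_eq_sum_residues (p := fun i => kernPole (y i.1) i.2) (hRpos n) ?_ ?_ ?_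
      isOpen_ball (closedBall_subset_ball (by linarith : R n < R n + d)) ?_ ?_ hzero
    · intro i hi i' hi' h
      have h1 := hy.kernPole_inj ((hmem i).mp hi).2 h
      exact Prod.ext h1.1 h1.2
    · exact fun i hi => kernPole_ne_zero (hy0 _) ((hmem i).mp hi).2
    · exact fun i hi => ((hmem i).mp hi).1
    · intro t htU ht0 htp
      refine differentiableAt_kern hy0 ω ht0 fun j k hk => ?_
      have hk0 : k ≠ 0 := by
        rintro rfl
        exact ht0 (by simp [hk, kernPole])
      refine htp (j, k) ((hmem _).mpr ⟨?_, hk0⟩) hk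
      have h1 : ‖kernPole (y j) k‖ < R n + d := by
        rw [← hk]; simpa using htU
      -- No pole has modulus between R n and R n + d, so the slightly larger disc on which
      -- differentiability is needed contains no further pole.
      have h2 := hRd n j |k|
      rw [norm_kernPole] at h1 ⊢
      push_cast at h2
      by_contra! h3
      rw [abs_of_nonpos (by linarith)] at h2
      linarith
    · exact fun i hi => tendsto_kern_pole hy ω i.1 ((hmem i).mp hi).2
  have hlim : Tendsto (fun n => 2 * Real.pi * Complex.I * (D + ∑ i ∈ T n, kernRes y ω i)) atTop
      (𝓝 (2 * Real.pi * Complex.I * (D + s))) :=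
    ((hs.comp hTtop).const_add D).const_mul _
  have hu := tendsto_nhds_unique (hint.congr hres) hlim
  have h0 := (mul_eq_zero.mp hu.symm).resolve_left Complex.two_pi_I_ne_zero
  linear_combination h0

end

section


open Filter Topology Metric Set

/-! ### Double products -/

theorem summable_mul_pow_mul_pow {r s : ℝ} (hr0 : 0 ≤ r) (hr : r < 1) (hs0 : 0 ≤ s) (hs : s < 1) :
    Summable fun p : ℕ × ℕ => r ^ p.1 * s ^ p.2 :=
  (summable_geometric_of_lt_one hr0 hr).mul_of_nonneg (summable_geometric_of_lt_one hs0 hs)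
    (fun _ => pow_nonneg hr0 _) fun _ => pow_nonneg hs0 _

theorem one_sub_ne_zero_of_norm_lt_one {z : ℂ} (hz : ‖z‖ < 1) : 1 - z ≠ 0 := by
  intro h
  rw [← sub_eq_zero.mp h, norm_one] at hz
  exact lt_irrefl _ hz

theorem hasSum_geometric_mul_geometric {q r : ℂ} (hq : ‖q‖ < 1) (hr : ‖r‖ < 1) :
    HasSum (fun p : ℕ × ℕ => q ^ p.1 * r ^ p.2) ((1 - q)⁻¹ * (1 - r)⁻¹) := by
  refine (hasSum_geometric_of_norm_lt_one hq).mul (hasSum_geometric_of_norm_lt_one hr) ?_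
  refine (summable_mul_pow_mul_pow (norm_nonneg q) hq (norm_nonneg r) hr).of_norm_bounded fun p => ?_
  rw [norm_mul, norm_pow, norm_pow]

/-- The logarithm of a double product `∏ (1 - z qᵐ rⁿ)` as a Lambert series. -/
theorem exists_hasSum_tprod_one_sub {z q r : ℂ} (hz : ‖z‖ < 1) (hq : ‖q‖ < 1) (hr : ‖r‖ < 1) :
    ∃ s : ℂ, HasSum (fun k : ℕ =>
        -(z ^ (k + 1) / ((k + 1) * (1 - q ^ (k + 1)) * (1 - r ^ (k + 1))))) s ∧
      ∏' p : ℕ × ℕ, (1 - z * q ^ p.1 * r ^ p.2) = Complex.exp s := by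
  -- An absolutely convergent triple series: summed over the exponent first it gives the logarithms
  -- of the factors, summed over (m, n) first it gives the Lambert series.
  obtain ⟨G, hG⟩ : ∃ G : (ℕ × ℕ) × ℕ → ℂ, ∀ x, G x =
    -((z * q ^ x.1.1 * r ^ x.1.2) ^ (x.2 + 1) / (x.2 + 1)) := ⟨_, fun _ => rfl⟩
  have hle : ∀ a b : ℕ, ‖z * q ^ a * r ^ b‖ ≤ ‖z‖ * (‖q‖ ^ a * ‖r‖ ^ b) := fun a b => by
    rw [norm_mul, norm_mul, norm_pow, norm_pow, mul_assoc]
  have hq1 : ∀ a : ℕ, ‖q‖ ^ a ≤ 1 := fun a => pow_le_one₀ (norm_nonneg _) hq.le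
  have hr1 : ∀ a : ℕ, ‖r‖ ^ a ≤ 1 := fun a => pow_le_one₀ (norm_nonneg _) hr.le
  have hterm : ∀ a b : ℕ, ‖z * q ^ a * r ^ b‖ < 1 := fun a b =>
    (hle a b).trans_lt (lt_of_le_of_lt (mul_le_of_le_one_right (norm_nonneg _)
      (mul_le_one₀ (hq1 a) (by positivity) (hr1 b))) hz)
  have hGs : Summable G := by
    have h1 := (summable_mul_pow_mul_pow (norm_nonneg q) hq (norm_nonneg r) hr).mul_of_nonneg
      (summable_geometric_of_lt_one (norm_nonneg z) hz) (fun _ => by positivity)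
      (fun _ => by positivity)
    refine h1.of_norm_bounded fun x => ?_
    rw [hG, norm_neg, norm_div, norm_pow]
    have h2 : (1 : ℝ) ≤ ‖((x.2 : ℂ) + 1)‖ := by
      have : ((x.2 : ℂ) + 1) = ((x.2 + 1 : ℕ) : ℂ) := by push_cast; rfl
      rw [this, Complex.norm_natCast]
      exact_mod_cast Nat.le_add_left 1 _
    refine (div_le_self (by positivity) h2).trans ?_
    calc ‖z * q ^ x.1.1 * r ^ x.1.2‖ ^ (x.2 + 1)
        ≤ (‖z‖ * (‖q‖ ^ x.1.1 * ‖r‖ ^ x.1.2)) ^ (x.2 + 1) := by gcongr; exact hle _ _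
      _ = ‖z‖ ^ (x.2 + 1) * (‖q‖ ^ x.1.1 * ‖r‖ ^ x.1.2) ^ (x.2 + 1) := mul_pow _ _ _
      _ ≤ ‖z‖ ^ x.2 * (‖q‖ ^ x.1.1 * ‖r‖ ^ x.1.2) := by
          refine mul_le_mul (pow_le_pow_of_le_one (norm_nonneg _) hz.le (Nat.le_succ _)) ?_
            (by positivity) (by positivity)
          exact pow_le_of_le_one (by positivity)
            (mul_le_one₀ (hq1 _) (by positivity) (hr1 _)) (Nat.succ_ne_zero _)
      _ = _ := mul_comm _ _
  have hlog : ∀ x : ℕ × ℕ, HasSum (fun k => G (x, k)) (Complex.log (1 - z * q ^ x.1 * r ^ x.2)) := by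
    intro x
    have h := (Complex.hasSum_taylorSeries_neg_log' (hterm x.1 x.2)).neg
    rw [neg_neg] at h
    simpa only [hG] using h
  have hcol : ∀ k : ℕ, HasSum (fun x : ℕ × ℕ => G (x, k))
      (-(z ^ (k + 1) / ((k + 1) * (1 - q ^ (k + 1)) * (1 - r ^ (k + 1))))) := by
    intro k
    have hqk : ‖q ^ (k + 1)‖ < 1 := by
      rw [norm_pow]; exact pow_lt_one₀ (norm_nonneg _) hq (Nat.succ_ne_zero _)
    have hrk : ‖r ^ (k + 1)‖ < 1 := by
      rw [norm_pow]; exact pow_lt_one₀ (norm_nonneg _) hr (Nat.succ_ne_zero _)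
    have h4 := (hasSum_geometric_mul_geometric hqk hrk).mul_left (-(z ^ (k + 1) / (k + 1)))
    have hval : -(z ^ (k + 1) / (k + 1)) * ((1 - q ^ (k + 1))⁻¹ * (1 - r ^ (k + 1))⁻¹)
        = -(z ^ (k + 1) / ((k + 1) * (1 - q ^ (k + 1)) * (1 - r ^ (k + 1)))) := by
      simp only [div_eq_mul_inv, mul_inv]
      ring
    rw [← hval]
    have hfun : (fun x : ℕ × ℕ => G (x, k)) = fun x : ℕ × ℕ =>
        -(z ^ (k + 1) / (k + 1)) * ((q ^ (k + 1)) ^ x.1 * (r ^ (k + 1)) ^ x.2) := by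
      funext x
      simp only [hG]
      rw [mul_pow, mul_pow, pow_right_comm q, pow_right_comm r]
      ring
    rw [hfun]
    exact h4
  have hG' : HasSum (fun y : ℕ × (ℕ × ℕ) => G (y.2, y.1)) (∑' x, G x) :=
    (Equiv.prodComm ℕ (ℕ × ℕ)).hasSum_iff.mpr hGs.hasSum
  have h1 : HasSum (fun x : ℕ × ℕ => Complex.log (1 - z * q ^ x.1 * r ^ x.2)) (∑' x, G x) :=
    hGs.hasSum.prod_fiberwise hlog
  have h2 : HasProd (fun x : ℕ × ℕ => 1 - z * q ^ x.1 * r ^ x.2) (Complex.exp (∑' x, G x)) :=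
    Complex.hasProd_of_hasSum_log
      (fun x => one_sub_ne_zero_of_norm_lt_one (hterm x.1 x.2)) h1
  generalize ∑' x, G x = S at hG' h2
  exact ⟨S, hG'.prod_fiberwise hcol, h2.tprod_eq⟩

/-- The double product `∏_{m,n ≥ 0} (1 - exp(2πi (w - (m + 1) u + n v) / x))`. -/
def gammaProd (u v x w : ℂ) : ℂ :=
  ∏' p : ℕ × ℕ, (1 - Complex.exp (2 * Real.pi * Complex.I * (w - (p.1 + 1) * u + p.2 * v) / x))

theorem exp_gammaProd (u v x w : ℂ) (m n : ℕ) :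
    Complex.exp (2 * Real.pi * Complex.I * (w - (m + 1) * u + n * v) / x) =
      Complex.exp (2 * Real.pi * Complex.I * ((w - u) / x)) *
        Complex.exp (2 * Real.pi * Complex.I * -(u / x)) ^ m *
        Complex.exp (2 * Real.pi * Complex.I * (v / x)) ^ n := by
  rw [← Complex.exp_nat_mul, ← Complex.exp_nat_mul, ← Complex.exp_add, ← Complex.exp_add]
  ring_nf

theorem norm_exp_two_pi_I_mul (z : ℂ) :
    ‖Complex.exp (2 * Real.pi * Complex.I * z)‖ = Real.exp (-(2 * Real.pi * z.im)) := by
  rw [Complex.norm_exp]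
  congr 1
  simp

theorem norm_exp_two_pi_I_mul_lt_one {z : ℂ} (hz : 0 < z.im) :
    ‖Complex.exp (2 * Real.pi * Complex.I * z)‖ < 1 := by
  rw [norm_exp_two_pi_I_mul, Real.exp_lt_one_iff]
  have := Real.pi_pos
  simp only [Left.neg_neg_iff]
  positivity

/-- The exponential in each factor is e^{2πi(w−u)/x} times a geometric term independent of w, and
the first is bounded for bounded w; hence convergence is locally uniform. -/
theorem differentiable_gammaProd {u v x : ℂ} (hu : (u / x).im < 0) (hv : 0 < (v / x).im) :
    Differentiable ℂ (gammaProd u v x) := by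
  have hq := norm_exp_two_pi_I_mul_lt_one (z := -(u / x)) (by simpa using hu)
  have hr := norm_exp_two_pi_I_mul_lt_one hv
  intro w₀
  set B : ℝ := Real.exp (2 * Real.pi * ((‖w₀‖ + 1 + ‖u‖) / ‖x‖))
  have hsum := (summable_mul_pow_mul_pow (norm_nonneg _) hq (norm_nonneg _) hr).mul_left B
  have hw : ∀ w ∈ ball (0 : ℂ) (‖w₀‖ + 1),
      ‖Complex.exp (2 * Real.pi * Complex.I * ((w - u) / x))‖ ≤ B := by
    intro w hw
    rw [norm_exp_two_pi_I_mul]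
    refine Real.exp_le_exp.mpr ?_
    have h1 : -((w - u) / x).im ≤ ‖(w - u) / x‖ :=
      (neg_le_abs _).trans (Complex.abs_im_le_norm _)
    have h2 : ‖(w - u) / x‖ ≤ (‖w₀‖ + 1 + ‖u‖) / ‖x‖ := by
      rw [norm_div]
      gcongr
      refine (norm_sub_le _ _).trans ?_
      have : ‖w‖ < ‖w₀‖ + 1 := by simpa using hw
      linarith
    have := Real.pi_pos
    nlinarith
  have hprod := Summable.hasProdLocallyUniformlyOn_one_add (K := ball (0 : ℂ) (‖w₀‖ + 1))
    (f := fun (p : ℕ × ℕ) (w : ℂ) =>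
      -Complex.exp (2 * Real.pi * Complex.I * (w - (p.1 + 1) * u + p.2 * v) / x))
    isOpen_ball hsum (Eventually.of_forall fun p w hwb => by
      rw [norm_neg, exp_gammaProd, norm_mul, norm_mul, norm_pow, norm_pow, mul_assoc]
      exact mul_le_mul_of_nonneg_right (hw w hwb) (by positivity))
    (fun p => Continuous.continuousOn (by fun_prop))
  rw [hasProdLocallyUniformlyOn_iff_tendstoLocallyUniformlyOn] at hprod
  have hd := hprod.differentiableOn (Eventually.of_forall fun s =>
    Differentiable.differentiableOn (by fun_prop)) isOpen_ball
  have hw₀ : w₀ ∈ ball (0 : ℂ) (‖w₀‖ + 1) := by simp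
  exact hd.differentiableAt (isOpen_ball.mem_nhds hw₀)

theorem gammaProd_add_period (u v : ℂ) {x : ℂ} (hx : x ≠ 0) (w : ℂ) :
    gammaProd u v x (w + x) = gammaProd u v x w := by
  unfold gammaProd
  refine tprod_congr fun p => ?_
  rw [show 2 * Real.pi * Complex.I * (w + x - (p.1 + 1) * u + p.2 * v) / x
    = 2 * Real.pi * Complex.I * (w - (p.1 + 1) * u + p.2 * v) / x + 2 * Real.pi * Complex.I by
      field_simp; ring, Complex.exp_periodic]

/-- The residue of the kernel with periods `u, v, x` at `2πik / x`. -/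
def simpleRes (u v x ω : ℂ) (k : ℤ) : ℂ :=
  (-1) ^ k * Complex.exp (ω * kernPole x k) / (kernPole x k * x *
    ((2 * Complex.sinh (u * kernPole x k / 2)) * (2 * Complex.sinh (v * kernPole x k / 2))))

/-- Reversing x and exchanging u and v reflects the line of poles. This carries the half k < 0,
which belongs to the denominators, to the half k > 0. -/
theorem simpleRes_neg (u v x ω : ℂ) (k : ℤ) : simpleRes v u (-x) ω k = -simpleRes u v x ω (-k) := by
  have h1 : kernPole (-x) k = kernPole x (-k) := by
    simp [kernPole, neg_div, div_neg]
  have h2 : ((-1 : ℂ)) ^ (-k) = (-1) ^ k := by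
    rw [zpow_neg, ← inv_zpow, inv_neg_one]
  rw [simpleRes, simpleRes, h1, h2, mul_neg, neg_mul, div_neg,
    mul_comm (2 * Complex.sinh (v * _ / 2))]

/-- Centring w at half the sum of the periods turns the factors 1 − q^k and 1 − r^k of the Lambert
terms into the symmetric factors 2 sinh of the residues. The condition `hω` puts the leading
exponential inside the unit disc, as the logarithmic series requires. -/
theorem exists_hasSum_gammaProd {u v x : ℂ} (hu : (u / x).im < 0) (hv : 0 < (v / x).im) {ω : ℂ}
    (hω : 0 < (((u + v + x) / 2 + ω - u) / x).im) :
    ∃ s, HasSum (fun n : ℕ => 2 * Real.pi * Complex.I * simpleRes u v x ω (n + 1)) s ∧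
      gammaProd u v x ((u + v + x) / 2 + ω) = Complex.exp s := by
  have hx : x ≠ 0 := by rintro rfl; simp at hu
  obtain ⟨s, hs, hp⟩ := exists_hasSum_tprod_one_sub (norm_exp_two_pi_I_mul_lt_one hω)
    (norm_exp_two_pi_I_mul_lt_one (z := -(u / x)) (by simpa using hu))
    (norm_exp_two_pi_I_mul_lt_one hv)
  refine ⟨s, ?_, ?_⟩
  · convert hs using 1
    funext n
    set p := kernPole x (n + 1) with hpdef
    have hn : ((n : ℂ) + 1) ≠ 0 := by exact_mod_cast Nat.succ_ne_zero n
    have hpx : p * x = 2 * Real.pi * Complex.I * (n + 1) := by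
      simp only [hpdef, kernPole]; push_cast; field_simp
    have hp' : 2 * Real.pi * Complex.I * (n + 1) / x = p := by
      rw [← hpx]; field_simp
    have hsign : (-1 : ℂ) ^ ((n : ℤ) + 1) = Complex.exp (p * x / 2) := by
      rw [hpx, show 2 * Real.pi * Complex.I * ((n : ℂ) + 1) / 2 = ((n + 1 : ℕ) : ℂ) *
        (Real.pi * Complex.I) by push_cast; ring, Complex.exp_nat_mul, Complex.exp_pi_mul_I]
      norm_cast
    rw [simpleRes, ← hpdef, hpx, hsign, ← Complex.exp_nat_mul, ← Complex.exp_nat_mul,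
      ← Complex.exp_nat_mul]
    have e1 : ((n + 1 : ℕ) : ℂ) * (2 * Real.pi * Complex.I * (((u + v + x) / 2 + ω - u) / x))
        = p * x / 2 + ω * p + (v * p / 2 - u * p / 2) := by
      rw [← hp']; push_cast; field_simp; ring
    have e2 : ((n + 1 : ℕ) : ℂ) * (2 * Real.pi * Complex.I * -(u / x)) = -(u * p / 2) - u * p / 2 := by
      rw [← hp']; push_cast; field_simp; ring
    have e3 : ((n + 1 : ℕ) : ℂ) * (2 * Real.pi * Complex.I * (v / x)) = v * p / 2 + v * p / 2 := by
      rw [← hp']; push_cast; field_simp; ring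
    rw [e1, e2, e3, Complex.exp_add, Complex.exp_add (p * x / 2), Complex.exp_sub (v * p / 2),
      Complex.exp_sub (-(u * p / 2)), Complex.exp_add (v * p / 2), Complex.exp_neg,
      Complex.two_sinh, Complex.two_sinh, Complex.exp_neg, Complex.exp_neg]
    have hU := Complex.exp_ne_zero (u * p / 2)
    have hV := Complex.exp_ne_zero (v * p / 2)
    have hpi := Complex.two_pi_I_ne_zero
    set X := Complex.exp (u * p / 2)
    set Y := Complex.exp (v * p / 2)
    have k1 : X - X⁻¹ = X * (1 - X⁻¹ / X) := by field_simp
    have k2 : Y - Y⁻¹ = -Y⁻¹ * (1 - Y * Y) := by field_simp; ring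
    rw [k1, k2]
    generalize 1 - X⁻¹ / X = A
    generalize 1 - Y * Y = B
    rw [show 2 * Real.pi * Complex.I * (n + 1) * (X * A * (-Y⁻¹ * B))
      = 2 * Real.pi * Complex.I * (-(X * Y⁻¹)) * ((n + 1) * A * B) by ring,
      mul_assoc (2 * Real.pi * Complex.I), ← mul_div_assoc, mul_div_mul_left _ _ hpi]
    rw [← div_div, div_neg, div_eq_mul_inv _ (X * Y⁻¹), mul_inv, inv_inv]
    ring
  · rw [← hp]
    exact tprod_congr fun p => by rw [exp_gammaProd]

theorem exists_hasSum_gammaProd_neg {u v x : ℂ} (hu : (u / x).im < 0) (hv : 0 < (v / x).im) {ω : ℂ}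
    (hω : (((u + v + x) / 2 + ω - v) / x).im < 0) :
    ∃ s, HasSum (fun n : ℕ => 2 * Real.pi * Complex.I * simpleRes u v x ω (-(n + 1))) (-s) ∧
      gammaProd v u (-x) ((u + v + x) / 2 + ω) = Complex.exp s := by
  have hx : x ≠ 0 := by rintro rfl; simp at hu
  have h1 : (((v + u + -x) / 2 + ω - v) / -x).im = -(((u + v + x) / 2 + ω - v) / x).im := by
    rw [← Complex.neg_im, show ((v + u + -x) / 2 + ω - v) / -x
      = -(((u + v + x) / 2 + ω - v) / x) + 1 by field_simp; ring]
    simp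
  obtain ⟨s, hs, hp⟩ := exists_hasSum_gammaProd (u := v) (v := u) (x := -x) (ω := ω)
    (by rw [div_neg]; simpa using hv) (by rw [div_neg]; simpa using hu) (by linarith)
  refine ⟨s, ?_, ?_⟩
  · have hfun : (fun n : ℕ => 2 * Real.pi * Complex.I * simpleRes u v x ω (-(n + 1))) =
        fun n : ℕ => -(2 * Real.pi * Complex.I * simpleRes v u (-x) ω (n + 1)) := by
      funext n
      rw [simpleRes_neg, mul_neg, neg_neg]
    rw [hfun]
    exact hs.neg
  -- The half sums of (u, v, x) and (v, u, −x) differ by x, a period of the product.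
  · rw [← hp, ← gammaProd_add_period _ _ (neg_ne_zero.mpr hx)]
    congr 1
    ring

end

section


open Filter Topology Metric Set

/-! ### The three-term relation for standard periods -/

theorem kernRes_eq_simpleRes (y : Fin 3 → ℂ) (ω : ℂ) (j : Fin 3) (k : ℤ) :
    kernRes y ω (j, k) = simpleRes (y (j + 1)) (y (j + 2)) (y j) ω k := by
  have h : (Finset.univ.erase j) = {j + 1, j + 2} := by revert j; decide
  have h' : j + 1 ≠ j + 2 := by revert j; decide
  simp only [kernRes, simpleRes, h]
  rw [Finset.prod_pair h']

theorem hasSum_prod_int_of_forall {f : Fin 3 × ℤ → ℂ} {s : Fin 3 → ℂ}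
    (h : ∀ j, HasSum (fun k => f (j, k)) (s j)) : HasSum f (∑ j, s j) := by
  have h1 : ∀ j, HasSum (fun i : Fin 3 × ℤ => if i.1 = j then f i else 0) (s j) := by
    intro j
    have hinj : Function.Injective fun k : ℤ => (j, k) := fun a b h => (Prod.ext_iff.mp h).2
    rw [← hinj.hasSum_iff]
    · simpa [Function.comp_def] using h j
    · rintro ⟨a, b⟩ hab
      have : a ≠ j := fun h => hab ⟨b, by rw [h]⟩
      simp [this]
  have h2 := hasSum_sum fun j (_ : j ∈ Finset.univ) => h1 j
  simpa using h2

theorem im_div_eq (u v : ℂ) : (u / v).im = (u * (starRingEnd ℂ) v).im / Complex.normSq v := by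
  rw [Complex.div_im]
  simp
  ring

theorem im_mul_conj_swap (u v : ℂ) : (v * (starRingEnd ℂ) u).im = -(u * (starRingEnd ℂ) v).im := by
  simp; ring

theorem im_div_pos {u v : ℂ} (h : 0 < (u * (starRingEnd ℂ) v).im) : 0 < (u / v).im := by
  rw [im_div_eq]
  exact div_pos h (Complex.normSq_pos.mpr (ne_zero_of_im_mul_conj_ne h.ne').2)

theorem im_div_neg {u v : ℂ} (h : 0 < (v * (starRingEnd ℂ) u).im) : (u / v).im < 0 := by
  rw [im_div_eq]
  refine div_neg_of_neg_of_pos ?_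
    (Complex.normSq_pos.mpr (ne_zero_of_im_mul_conj_ne h.ne').1)
  rw [im_mul_conj_swap]
  linarith

/-- In the centred variable P₃ is odd, and it is six times the residue of the kernel at the origin.
With the factor −2πi this produces −πi/3 in the exponent. -/
theorem eval_P₃_center_add {x₁ x₂ x₃ : ℂ} (h₁ : x₁ ≠ 0) (h₂ : x₂ ≠ 0) (h₃ : x₃ ≠ 0) (ω : ℂ) :
    (P₃ x₁ x₂ x₃).eval ((x₁ + x₂ + x₃) / 2 + ω) =
      (ω ^ 3 - ω * (x₁ ^ 2 + x₂ ^ 2 + x₃ ^ 2) / 4) / (x₁ * x₂ * x₃) := by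
  simp only [P₃, Polynomial.eval_add, Polynomial.eval_sub, Polynomial.eval_mul, Polynomial.eval_C,
    Polynomial.eval_pow, Polynomial.eval_X]
  field_simp
  ring

theorem eventually_gammaProd_eq {y : Fin 3 → ℂ}
    (h : ∀ j, 0 < (y j * (starRingEnd ℂ) (y (j + 1))).im) :
    ∀ᶠ ω in 𝓝 (0 : ℂ), ∏ j, gammaProd (y (j + 1)) (y (j + 2)) (y j) ((y 0 + y 1 + y 2) / 2 + ω) =
      (∏ j, gammaProd (y (j + 2)) (y (j + 1)) (-y j) ((y 0 + y 1 + y 2) / 2 + ω)) *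
        Complex.exp (-(Real.pi * Complex.I / 3) *
          (P₃ (y 0) (y 1) (y 2)).eval ((y 0 + y 1 + y 2) / 2 + ω)) := by
  have hsucc : ∀ j : Fin 3, j + 2 + 1 = j := by decide
  have hu : ∀ j, (y (j + 1) / y j).im < 0 := fun j => im_div_neg (h j)
  have hv : ∀ j, 0 < (y (j + 2) / y j).im := fun j => im_div_pos (by
    have := h (j + 2)
    rwa [hsucc] at this)
  have hy : PairwiseNonreal y := by
    have h' : ∀ j, (y (j + 1) * (starRingEnd ℂ) (y j)).im ≠ 0 := fun j => by
      rw [im_mul_conj_swap]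
      exact (neg_lt_zero.mpr (h j)).ne
    intro i j hij
    have : j = i + 1 ∨ i = j + 1 := by revert i j; decide
    rcases this with rfl | rfl
    · exact (h i).ne'
    · exact h' j
  have hy0 := hy.ne_zero
  have hcyc : ∀ j, y (j + 1) + y (j + 2) + y j = y 0 + y 1 + y 2 := by
    intro j
    fin_cases j <;> simp <;> ring
  obtain ⟨ε, hε, hsum⟩ := hasSum_kernRes_eq hy
  have hev1 : ∀ᶠ ω in 𝓝 (0 : ℂ), ‖ω‖ < ε := by
    filter_upwards [ball_mem_nhds (0 : ℂ) hε] with ω hω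
    simpa using hω
  have hmid : ∀ j, ∀ a, (y j ≠ 0) → ((a + y j) / 2 / y j).im = (a / y j).im / 2 := by
    intro j a hj
    have : (a + y j) / 2 / y j = ((1 / 2 : ℝ) : ℂ) * (a / y j) + ((1 / 2 : ℝ) : ℂ) := by
      push_cast; field_simp
    rw [this, Complex.add_im, Complex.im_ofReal_mul, Complex.ofReal_im]
    ring
  -- At ω = 0 the imaginary part is half of Im((y_{j+2} − y_{j+1})/yⱼ), which is positive by the
  -- cyclic hypothesis; the condition is open in ω. The next condition is its mirror image.
  have hev2 : ∀ᶠ ω in 𝓝 (0 : ℂ), ∀ j,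
      0 < (((y (j + 1) + y (j + 2) + y j) / 2 + ω - y (j + 1)) / y j).im := by
    rw [eventually_all]
    intro j
    have hc : ContinuousAt (fun ω : ℂ =>
        (((y (j + 1) + y (j + 2) + y j) / 2 + ω - y (j + 1)) / y j).im) 0 := by
      have : Continuous fun ω : ℂ => ((y (j + 1) + y (j + 2) + y j) / 2 + ω - y (j + 1)) / y j := by
        fun_prop
      exact (Complex.continuous_im.comp this).continuousAt
    refine hc.eventually_const_lt ?_
    beta_reduce
    have : (y (j + 1) + y (j + 2) + y j) / 2 + 0 - y (j + 1)
        = ((y (j + 2) - y (j + 1)) + y j) / 2 := by ring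
    rw [this, hmid j _ (hy0 j), sub_div, Complex.sub_im]
    linarith [hu j, hv j]
  have hev3 : ∀ᶠ ω in 𝓝 (0 : ℂ), ∀ j,
      (((y (j + 1) + y (j + 2) + y j) / 2 + ω - y (j + 2)) / y j).im < 0 := by
    rw [eventually_all]
    intro j
    have hc : ContinuousAt (fun ω : ℂ =>
        (((y (j + 1) + y (j + 2) + y j) / 2 + ω - y (j + 2)) / y j).im) 0 := by
      have : Continuous fun ω : ℂ => ((y (j + 1) + y (j + 2) + y j) / 2 + ω - y (j + 2)) / y j := by
        fun_prop
      exact (Complex.continuous_im.comp this).continuousAt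
    refine hc.eventually_lt_const ?_
    beta_reduce
    have : (y (j + 1) + y (j + 2) + y j) / 2 + 0 - y (j + 2)
        = ((y (j + 1) - y (j + 2)) + y j) / 2 := by ring
    rw [this, hmid j _ (hy0 j), sub_div, Complex.sub_im]
    linarith [hu j, hv j]
  filter_upwards [hev1, hev2, hev3] with ω h1 h2 h3
  choose s hs hgs using fun j => exists_hasSum_gammaProd (hu j) (hv j) (h2 j)
  choose s' hs' hgs' using fun j => exists_hasSum_gammaProd_neg (hu j) (hv j) (h3 j)
  simp only [hcyc] at hgs hgs'
  have hpi := Complex.two_pi_I_ne_zero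
  -- The half k > 0 contributes the logarithm of the j-th numerator, the half k < 0 minus that of
  -- the denominator, and k = 0 contributes nothing.
  have hj : ∀ j, HasSum (fun k : ℤ => 2 * Real.pi * Complex.I * kernRes y ω (j, k))
      (s j - s' j) := by
    intro j
    simp only [kernRes_eq_simpleRes]
    have h4 := HasSum.of_add_one_of_neg_add_one
      (f := fun k : ℤ => 2 * Real.pi * Complex.I * simpleRes (y (j + 1)) (y (j + 2)) (y j) ω k)
      (hs j) (hs' j)
    have h5 : simpleRes (y (j + 1)) (y (j + 2)) (y j) ω 0 = 0 := by
      simp [simpleRes, kernPole]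
    rw [h5, mul_zero, add_zero, ← sub_eq_add_neg] at h4
    exact h4
  have hall := (hasSum_prod_int_of_forall
    (f := fun i => 2 * Real.pi * Complex.I * kernRes y ω i) hj).mul_left (2 * Real.pi * Complex.I)⁻¹
  simp only [inv_mul_cancel_left₀ hpi] at hall
  have hval := hsum ω h1 _ hall
  rw [inv_mul_eq_iff_eq_mul₀ hpi, Finset.sum_sub_distrib, sub_eq_iff_eq_add'] at hval
  simp only [hgs, hgs']
  rw [← Complex.exp_sum, ← Complex.exp_sum, hval, Complex.exp_add,
    eval_P₃_center_add (hy0 0) (hy0 1) (hy0 2)]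
  congr 2
  have e0 := hy0 0
  have e1 := hy0 1
  have e2 := hy0 2
  field_simp
  ring

/-- The three-term relation for the products attached to three periods in cyclic position. -/
theorem gammaProd_three_term {y : Fin 3 → ℂ}
    (h : ∀ j, 0 < (y j * (starRingEnd ℂ) (y (j + 1))).im) (w : ℂ) :
    ∏ j, gammaProd (y (j + 1)) (y (j + 2)) (y j) w =
      (∏ j, gammaProd (y (j + 2)) (y (j + 1)) (-y j) w) *
        Complex.exp (-(Real.pi * Complex.I / 3) * (P₃ (y 0) (y 1) (y 2)).eval w) := by
  have hsucc : ∀ j : Fin 3, j + 2 + 1 = j := by decide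
  have hu : ∀ j, (y (j + 1) / y j).im < 0 := fun j => im_div_neg (h j)
  have hv : ∀ j, 0 < (y (j + 2) / y j).im := fun j => im_div_pos (by
    have := h (j + 2)
    rwa [hsucc] at this)
  have hd1 : ∀ j, Differentiable ℂ (gammaProd (y (j + 1)) (y (j + 2)) (y j)) := fun j =>
    differentiable_gammaProd (hu j) (hv j)
  have hd2 : ∀ j, Differentiable ℂ (gammaProd (y (j + 2)) (y (j + 1)) (-y j)) := fun j =>
    differentiable_gammaProd (by rw [div_neg]; simpa using hv j) (by rw [div_neg]; simpa using hu j)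
  have hP : Differentiable ℂ fun w => (P₃ (y 0) (y 1) (y 2)).eval w := Polynomial.differentiable _
  have hL : Differentiable ℂ fun w => ∏ j, gammaProd (y (j + 1)) (y (j + 2)) (y j) w := by
    simp only [Fin.prod_univ_three]
    exact ((hd1 0).mul (hd1 1)).mul (hd1 2)
  have hR : Differentiable ℂ fun w => (∏ j, gammaProd (y (j + 2)) (y (j + 1)) (-y j) w) *
      Complex.exp (-(Real.pi * Complex.I / 3) * (P₃ (y 0) (y 1) (y 2)).eval w) := by
    simp only [Fin.prod_univ_three]
    exact (((hd2 0).mul (hd2 1)).mul (hd2 2)).mul (hP.const_mul _).cexp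
  have hev := eventually_gammaProd_eq h
  have ht : Tendsto (fun w : ℂ => w - (y 0 + y 1 + y 2) / 2) (𝓝 ((y 0 + y 1 + y 2) / 2)) (𝓝 0) := by
    have : ContinuousAt (fun w : ℂ => w - (y 0 + y 1 + y 2) / 2) ((y 0 + y 1 + y 2) / 2) := by
      fun_prop
    simpa [ContinuousAt] using this
  have hev' := ht.eventually hev
  simp only [add_sub_cancel] at hev'
  -- Both sides are entire in w and agree near half the sum of the periods.
  exact congrFun (AnalyticOnNhd.eq_of_eventuallyEq
    (Complex.analyticOnNhd_univ_iff_differentiable.mpr hL)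
    (Complex.analyticOnNhd_univ_iff_differentiable.mpr hR) hev') w

end

section


/-! ### The multiple Bernoulli polynomial `B₃₃` -/

/-- The equation A · A⁻¹ = 1 is triangular in the coefficients of the inverse and is solved degree
by degree; the values are scaled Bernoulli numbers. -/
theorem coeff_inv_exp_sub_one_div {F : Type*} [Field F] [CharZero F] {x : F} (hx : x ≠ 0) :
    PowerSeries.coeff 0 (PowerSeries.mk fun k => x ^ (k + 1) / ((k + 1).factorial : F))⁻¹ = 1 / x ∧
    PowerSeries.coeff 1 (PowerSeries.mk fun k => x ^ (k + 1) / ((k + 1).factorial : F))⁻¹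
      = -1 / 2 ∧
    PowerSeries.coeff 2 (PowerSeries.mk fun k => x ^ (k + 1) / ((k + 1).factorial : F))⁻¹
      = x / 12 ∧
    PowerSeries.coeff 3 (PowerSeries.mk fun k => x ^ (k + 1) / ((k + 1).factorial : F))⁻¹ = 0 := by
  generalize hA : (PowerSeries.mk fun k => x ^ (k + 1) / ((k + 1).factorial : F)) = A
  have hAk : ∀ k, PowerSeries.coeff k A = x ^ (k + 1) / ((k + 1).factorial : F) := fun k => by
    rw [← hA, PowerSeries.coeff_mk]
  have hc : PowerSeries.constantCoeff A ≠ 0 := by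
    rw [← PowerSeries.coeff_zero_eq_constantCoeff_apply, hAk]
    simpa using hx
  have hmul := PowerSeries.mul_inv_cancel A hc
  generalize A⁻¹ = B at *
  have e : ∀ n, PowerSeries.coeff n (A * B) = PowerSeries.coeff n 1 := fun n => by rw [hmul]
  have e0 := e 0
  have e1 := e 1
  have e2 := e 2
  have e3 := e 3
  rw [PowerSeries.coeff_mul, Finset.Nat.sum_antidiagonal_eq_sum_range_succ_mk] at e0 e1 e2 e3
  simp only [Finset.sum_range_succ, Finset.sum_range_zero, hAk, PowerSeries.coeff_one,
    Nat.factorial, Nat.sub_self, Nat.sub_zero, show 2 - 1 = 1 from rfl, show 3 - 1 = 2 from rfl] at e0 e1 e2 e3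
  generalize PowerSeries.coeff 3 B = b3 at *
  generalize PowerSeries.coeff 2 B = b2 at *
  generalize PowerSeries.coeff 1 B = b1 at *
  generalize PowerSeries.coeff 0 B = b0 at *
  norm_num at e0 e1 e2 e3
  have h0 : b0 = 1 / x := by
    rw [eq_div_iff hx]; linear_combination e0
  have h1 : b1 = -1 / 2 := by
    apply mul_left_cancel₀ hx
    linear_combination e1 - x / 2 * e0
  have h2 : b2 = x / 12 := by
    rw [h1] at e2
    apply mul_left_cancel₀ hx
    linear_combination e2 - x ^ 2 / 6 * e0
  have h3 : b3 = 0 := by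
    rw [h1, h2] at e3
    apply mul_left_cancel₀ hx
    linear_combination e3 - x ^ 3 / 24 * e0
  exact ⟨h0, h1, h2, h3⟩

theorem P₃_eq_multiBernoulli {F : Type*} [Field F] [CharZero F] (y : Fin 3 → F)
    (hy : ∀ i, y i ≠ 0) : P₃ (y 0) (y 1) (y 2) = multiBernoulli 3 3 y := by
  have hx0 := hy 0
  have hx1 := hy 1
  have hx2 := hy 2
  obtain ⟨a0, a1, a2, a3⟩ := coeff_inv_exp_sub_one_div hx0
  obtain ⟨b0, b1, b2, b3⟩ := coeff_inv_exp_sub_one_div hx1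
  obtain ⟨c0, c1, c2, c3⟩ := coeff_inv_exp_sub_one_div hx2
  rw [multiBernoulli, Fin.prod_univ_three]
  generalize (PowerSeries.mk fun k => y 0 ^ (k + 1) / ((k + 1).factorial : F))⁻¹ = A at *
  generalize (PowerSeries.mk fun k => y 1 ^ (k + 1) / ((k + 1).factorial : F))⁻¹ = B at *
  generalize (PowerSeries.mk fun k => y 2 ^ (k + 1) / ((k + 1).factorial : F))⁻¹ = C at *
  have hcoef : ∀ (f g : PowerSeries F) n, PowerSeries.coeff n (f * g) =
      ∑ k ∈ Finset.range n.succ, PowerSeries.coeff k f * PowerSeries.coeff (n - k) g :=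
    fun f g n => by
      rw [PowerSeries.coeff_mul, Finset.Nat.sum_antidiagonal_eq_sum_range_succ_mk]
  have p0 : PowerSeries.coeff 0 (A * B * C) = 1 / (y 0 * y 1 * y 2) := by
    simp only [hcoef, Finset.sum_range_succ, Finset.sum_range_zero, Nat.sub_self, a0, b0, c0]
    field_simp
    ring
  have p1 : PowerSeries.coeff 1 (A * B * C) = -(y 0 + y 1 + y 2) / (2 * y 0 * y 1 * y 2) := by
    simp only [hcoef, Finset.sum_range_succ, Finset.sum_range_zero, Nat.sub_self, Nat.sub_zero,
      a0, b0, c0, a1, b1, c1]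
    field_simp
    ring
  have p2 : PowerSeries.coeff 2 (A * B * C) = (y 0 ^ 2 + y 1 ^ 2 + y 2 ^ 2 + 3 * y 0 * y 1
      + 3 * y 1 * y 2 + 3 * y 0 * y 2) / (12 * y 0 * y 1 * y 2) := by
    simp only [hcoef, Finset.sum_range_succ, Finset.sum_range_zero, Nat.sub_self, Nat.sub_zero,
      a0, b0, c0, a1, b1, c1, a2, b2, c2, show 2 - 1 = 1 from rfl]
    field_simp
    ring
  have p3 : PowerSeries.coeff 3 (A * B * C)
      = -(1 / 24) * (y 0 + y 1 + y 2) * (1 / y 0 + 1 / y 1 + 1 / y 2) := by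
    simp only [hcoef, Finset.sum_range_succ, Finset.sum_range_zero, Nat.sub_self, Nat.sub_zero,
      a0, b0, c0, a1, b1, c1, a2, b2, c2, a3, b3, c3, show 2 - 1 = 1 from rfl,
      show 3 - 1 = 2 from rfl]
    field_simp
    ring
  rw [PowerSeries.coeff_mul, Finset.Nat.sum_antidiagonal_eq_sum_range_succ_mk]
  simp only [Finset.sum_range_succ, Finset.sum_range_zero, PowerSeries.coeff_mk,
    PowerSeries.coeff_map, Nat.sub_self, Nat.sub_zero, show 3 - 1 = 2 from rfl,
    show 3 - 2 = 1 from rfl, p0, p1, p2, p3, P₃, Nat.factorial]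
  have h6 : (((2 + 1) * ((1 + 1) * ((0 + 1) * 1)) : ℕ) : F[X]) = Polynomial.C 6 := by
    norm_num
    rfl
  rw [h6]
  have q3 : (1 / (y 0 * y 1 * y 2) : F) = 6 * (1 / 6 * (1 / (y 0 * y 1 * y 2))) := by ring
  have q2 : (3 * ((y 0 + y 1 + y 2) / (2 * y 0 * y 1 * y 2)) : F)
      = -(6 * (1 / 2 * (-(y 0 + y 1 + y 2) / (2 * y 0 * y 1 * y 2)))) := by ring
  have q1 : ((y 0 ^ 2 + y 1 ^ 2 + y 2 ^ 2 + 3 * y 0 * y 1 + 3 * y 1 * y 2 + 3 * y 0 * y 2)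
      / (2 * y 0 * y 1 * y 2) : F) = 6 * (1 * ((y 0 ^ 2 + y 1 ^ 2 + y 2 ^ 2 + 3 * y 0 * y 1
      + 3 * y 1 * y 2 + 3 * y 0 * y 2) / (12 * y 0 * y 1 * y 2))) := by
    field_simp; ring
  have q0 : (1 / 4 * (y 0 + y 1 + y 2) * (1 / y 0 + 1 / y 1 + 1 / y 2) : F)
      = -(6 * (1 * (-(1 / 24) * (y 0 + y 1 + y 2) * (1 / y 0 + 1 / y 1 + 1 / y 2)))) := by ring
  rw [q0, q1, q2]
  conv_lhs => rw [q3]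
  simp only [Polynomial.C_mul, Polynomial.C_neg]
  norm_num
  ring

/-! ### Evaluation of rational functions -/

/-- The reduced denominator is coprime to the reduced numerator, hence divides every other
denominator of f. So any fraction whose denominator is nonzero at x computes the value. -/
theorem ratEval_of_mul_eq {f : RatFun} {n d : MvPolynomial (Fin 3) ℚ} {x : Fin 3 → ℂ}
    (h : f * algebraMap _ RatFun d = algebraMap _ RatFun n) (hd : MvPolynomial.aeval x d ≠ 0) :
    RegularAt f x ∧ ratEval f x = MvPolynomial.aeval x n / MvPolynomial.aeval x d := by
  set N := IsFractionRing.num (MvPolynomial (Fin 3) ℚ) f with hN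
  set D := IsFractionRing.den (MvPolynomial (Fin 3) ℚ) f with hD
  have hrel := IsFractionRing.num_den_reduced (MvPolynomial (Fin 3) ℚ) f
  have hmk := IsFractionRing.mk'_num_den (MvPolynomial (Fin 3) ℚ) f
  have h1 : f * algebraMap _ RatFun (D : MvPolynomial (Fin 3) ℚ) = algebraMap _ RatFun N := by
    conv_lhs => rw [← hmk]
    exact IsLocalization.mk'_spec (M := nonZeroDivisors (MvPolynomial (Fin 3) ℚ)) RatFun N D
  have hinj := IsFractionRing.injective (MvPolynomial (Fin 3) ℚ) RatFun
  have h2 : N * d = n * D := by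
    apply hinj
    rw [map_mul, map_mul, ← h1, ← h]
    ring
  have hdvd : (D : MvPolynomial (Fin 3) ℚ) ∣ d := by
    refine hrel.symm.dvd_of_dvd_mul_left ?_
    rw [h2]
    exact dvd_mul_left _ _
  have hDx : MvPolynomial.aeval x (D : MvPolynomial (Fin 3) ℚ) ≠ 0 := by
    obtain ⟨e, he⟩ := hdvd
    intro h0
    rw [he, map_mul, h0, zero_mul] at hd
    exact hd rfl
  refine ⟨hDx, ?_⟩
  rw [ratEval, div_eq_div_iff hDx hd, ← map_mul, ← map_mul, h2]

/-- The rational function `f` is regular at `x` with value `v`. -/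
def EvalsTo (x : Fin 3 → ℂ) (f : RatFun) (v : ℂ) : Prop := RegularAt f x ∧ ratEval f x = v

/-- This form does not ask for lowest terms, so it passes through the field operations by the usual
formulas for fractions. -/
theorem evalsTo_iff {x : Fin 3 → ℂ} {f : RatFun} {v : ℂ} :
    EvalsTo x f v ↔ ∃ n d : MvPolynomial (Fin 3) ℚ, f * algebraMap _ RatFun d = algebraMap _ RatFun n ∧
      MvPolynomial.aeval x d ≠ 0 ∧ v = MvPolynomial.aeval x n / MvPolynomial.aeval x d := by
  constructor
  · rintro ⟨h1, h2⟩
    refine ⟨_, _, ?_, h1, h2.symm⟩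
    have h := IsLocalization.mk'_spec (M := nonZeroDivisors (MvPolynomial (Fin 3) ℚ)) RatFun
      (IsFractionRing.num _ f) (IsFractionRing.den _ f)
    rwa [IsFractionRing.mk'_num_den] at h
  · rintro ⟨n, d, h, hd, rfl⟩
    exact ratEval_of_mul_eq h hd

theorem evalsTo_algebraMap (x : Fin 3 → ℂ) (p : MvPolynomial (Fin 3) ℚ) :
    EvalsTo x (algebraMap _ RatFun p) (MvPolynomial.aeval x p) :=
  evalsTo_iff.mpr ⟨p, 1, by simp, by simp, by simp⟩

namespace EvalsTo

variable {x : Fin 3 → ℂ} {f g : RatFun} {u v : ℂ}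

theorem add (hf : EvalsTo x f u) (hg : EvalsTo x g v) : EvalsTo x (f + g) (u + v) := by
  obtain ⟨n, d, h, hd, rfl⟩ := evalsTo_iff.mp hf
  obtain ⟨n', d', h', hd', rfl⟩ := evalsTo_iff.mp hg
  refine evalsTo_iff.mpr ⟨n * d' + n' * d, d * d', ?_, ?_, ?_⟩
  · rw [map_mul, map_add, map_mul, map_mul, ← h, ← h']
    ring
  · rw [map_mul]; exact mul_ne_zero hd hd'
  · rw [map_add, map_mul, map_mul, map_mul]
    field_simp

theorem mul (hf : EvalsTo x f u) (hg : EvalsTo x g v) : EvalsTo x (f * g) (u * v) := by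
  obtain ⟨n, d, h, hd, rfl⟩ := evalsTo_iff.mp hf
  obtain ⟨n', d', h', hd', rfl⟩ := evalsTo_iff.mp hg
  refine evalsTo_iff.mpr ⟨n * n', d * d', ?_, ?_, ?_⟩
  · rw [map_mul, map_mul, ← h, ← h']
    ring
  · rw [map_mul]; exact mul_ne_zero hd hd'
  · rw [map_mul, map_mul]
    field_simp

theorem inv (hf : EvalsTo x f u) (hu : u ≠ 0) : EvalsTo x f⁻¹ u⁻¹ := by
  obtain ⟨n, d, h, hd, rfl⟩ := evalsTo_iff.mp hf
  have hn : MvPolynomial.aeval x n ≠ 0 := fun h0 => hu (by rw [h0, zero_div])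
  have hd0 : algebraMap _ RatFun d ≠ 0 := fun h0 => hd (by
    rw [(map_eq_zero_iff _ (IsFractionRing.injective (MvPolynomial (Fin 3) ℚ) RatFun)).mp h0,
      map_zero])
  have hf0 : f ≠ 0 := fun h0 => hn (by
    rw [h0, zero_mul] at h
    rw [(map_eq_zero_iff _ (IsFractionRing.injective (MvPolynomial (Fin 3) ℚ) RatFun)).mp h.symm,
      map_zero])
  refine evalsTo_iff.mpr ⟨d, n, ?_, hn, by rw [inv_div]⟩
  rw [← h]
  field_simp

theorem div (hf : EvalsTo x f u) (hg : EvalsTo x g v) (hv : v ≠ 0) :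
    EvalsTo x (f / g) (u / v) := by
  rw [div_eq_mul_inv, div_eq_mul_inv]
  exact hf.mul (hg.inv hv)

end EvalsTo

theorem evalsTo_ratCast (x : Fin 3 → ℂ) (q : ℚ) : EvalsTo x (q : RatFun) (q : ℂ) := by
  have h := evalsTo_algebraMap x (MvPolynomial.C q)
  rw [MvPolynomial.aeval_C] at h
  have h1 : algebraMap (MvPolynomial (Fin 3) ℚ) RatFun (MvPolynomial.C q) = (q : RatFun) := by
    exact map_ratCast ((algebraMap (MvPolynomial (Fin 3) ℚ) RatFun).comp MvPolynomial.C) q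
  rw [h1] at h
  simpa using h

theorem EvalsTo.sum {ι : Type*} {x : Fin 3 → ℂ} (s : Finset ι) {f : ι → RatFun} {u : ι → ℂ}
    (h : ∀ i ∈ s, EvalsTo x (f i) (u i)) : EvalsTo x (∑ i ∈ s, f i) (∑ i ∈ s, u i) := by
  classical
  induction s using Finset.induction_on with
  | empty => simpa using evalsTo_ratCast x 0
  | insert a s ha ih =>
    rw [Finset.sum_insert ha, Finset.sum_insert ha]
    exact (h a (Finset.mem_insert_self _ _)).add
      (ih fun i hi => h i (Finset.mem_insert_of_mem hi))

theorem evalsTo_pair_coord (x : Fin 3 → ℂ) (δ : Lattice3) :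
    EvalsTo x (pair δ coord) (pair δ x) := by
  unfold pair
  refine EvalsTo.sum _ fun i _ => ?_
  rw [zsmul_eq_mul, zsmul_eq_mul]
  have h1 := evalsTo_ratCast x (δ i)
  have h2 := evalsTo_algebraMap x (MvPolynomial.X i)
  rw [MvPolynomial.aeval_X] at h2
  push_cast at h1
  exact h1.mul h2

/-- Coefficientwise version of `EvalsTo`. -/
def PolyEvalsTo (x : Fin 3 → ℂ) (p : RatFun[X]) (q : ℂ[X]) : Prop :=
  ∀ k, EvalsTo x (p.coeff k) (q.coeff k)

/-! ### Evaluation of polynomials with rational function coefficients. -/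

namespace PolyEvalsTo

variable {x : Fin 3 → ℂ} {p p' : RatFun[X]} {q q' : ℂ[X]}

theorem polyEval_eq (h : PolyEvalsTo x p q) (w : ℂ) : polyEval p w x = q.eval w := by
  have h0 : ratEval (0 : RatFun) x = 0 := by
    have := (evalsTo_ratCast x 0).2
    simpa using this
  have h1 : ∀ k, ratEval (p.coeff k) x = q.coeff k := fun k => (h k).2
  -- The degrees may differ, since a nonzero coefficient of p can vanish at x.
  set n := max p.natDegree q.natDegree + 1
  rw [polyEval, Polynomial.sum_over_range' p (by simp [h0]) n (by omega),
    Polynomial.eval_eq_sum_range' (n := n) (by omega)]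
  exact Finset.sum_congr rfl fun k _ => by rw [h1]

theorem C {f : RatFun} {u : ℂ} (h : EvalsTo x f u) :
    PolyEvalsTo x (Polynomial.C f) (Polynomial.C u) := by
  intro k
  rw [Polynomial.coeff_C, Polynomial.coeff_C]
  split_ifs
  · exact h
  · simpa using evalsTo_ratCast x 0

theorem X : PolyEvalsTo x Polynomial.X Polynomial.X := by
  intro k
  rw [Polynomial.coeff_X, Polynomial.coeff_X]
  split_ifs
  · simpa using evalsTo_ratCast x 1
  · simpa using evalsTo_ratCast x 0

theorem add (h : PolyEvalsTo x p q) (h' : PolyEvalsTo x p' q') :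
    PolyEvalsTo x (p + p') (q + q') := by
  intro k
  rw [Polynomial.coeff_add, Polynomial.coeff_add]
  exact (h k).add (h' k)

theorem mul (h : PolyEvalsTo x p q) (h' : PolyEvalsTo x p' q') :
    PolyEvalsTo x (p * p') (q * q') := by
  intro k
  rw [Polynomial.coeff_mul, Polynomial.coeff_mul]
  exact EvalsTo.sum _ fun i _ => (h _).mul (h' _)

theorem neg (h : PolyEvalsTo x p q) : PolyEvalsTo x (-p) (-q) := by
  intro k
  rw [Polynomial.coeff_neg, Polynomial.coeff_neg, neg_eq_neg_one_mul, neg_eq_neg_one_mul (q.coeff k)]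
  have := evalsTo_ratCast x (-1)
  push_cast at this
  exact this.mul (h k)

theorem sub (h : PolyEvalsTo x p q) (h' : PolyEvalsTo x p' q') :
    PolyEvalsTo x (p - p') (q - q') := by
  rw [sub_eq_add_neg, sub_eq_add_neg]
  exact h.add h'.neg

theorem pow (h : PolyEvalsTo x p q) (n : ℕ) : PolyEvalsTo x (p ^ n) (q ^ n) := by
  induction n with
  | zero =>
    rw [pow_zero, pow_zero, ← Polynomial.C_1, ← Polynomial.C_1]
    exact C (by simpa using evalsTo_ratCast x 1)
  | succ n ih =>
    rw [pow_succ, pow_succ]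
    exact ih.mul h

theorem sum {ι : Type*} (s : Finset ι) {p : ι → RatFun[X]} {q : ι → ℂ[X]}
    (h : ∀ i ∈ s, PolyEvalsTo x (p i) (q i)) :
    PolyEvalsTo x (∑ i ∈ s, p i) (∑ i ∈ s, q i) := by
  intro k
  rw [Polynomial.finsetSum_coeff, Polynomial.finsetSum_coeff]
  exact EvalsTo.sum s fun i hi => h i hi k

end PolyEvalsTo

theorem polyEvalsTo_P₃_comp {x : Fin 3 → ℂ} {f₁ f₂ f₃ g : RatFun} {y₁ y₂ y₃ d : ℂ}
    (h₁ : EvalsTo x f₁ y₁) (h₂ : EvalsTo x f₂ y₂) (h₃ : EvalsTo x f₃ y₃) (hg : EvalsTo x g d)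
    (n₁ : y₁ ≠ 0) (n₂ : y₂ ≠ 0) (n₃ : y₃ ≠ 0) :
    PolyEvalsTo x ((P₃ f₁ f₂ f₃).comp (Polynomial.X + Polynomial.C g))
      ((P₃ y₁ y₂ y₃).comp (Polynomial.X + Polynomial.C d)) := by
  have e : ∀ q : ℚ, EvalsTo x (q : RatFun) (q : ℂ) := evalsTo_ratCast x
  have e1 : EvalsTo x (1 : RatFun) (1 : ℂ) := by simpa using e 1
  have e2 : EvalsTo x (2 : RatFun) (2 : ℂ) := by simpa using e 2
  have e3 : EvalsTo x (3 : RatFun) (3 : ℂ) := by simpa using e 3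
  have e4 : EvalsTo x (4 : RatFun) (4 : ℂ) := by simpa using e 4
  have hX : PolyEvalsTo x (Polynomial.X + Polynomial.C g) (Polynomial.X + Polynomial.C d) :=
    PolyEvalsTo.X.add (PolyEvalsTo.C hg)
  have hsq : ∀ {f : RatFun} {y : ℂ}, EvalsTo x f y → EvalsTo x (f ^ 2) (y ^ 2) := fun h => by
    rw [sq, sq]; exact h.mul h
  have hs := (h₁.add h₂).add h₃
  have hp := (h₁.mul h₂).mul h₃
  have hp2 := ((e2.mul h₁).mul h₂).mul h₃
  have np : y₁ * y₂ * y₃ ≠ 0 := mul_ne_zero (mul_ne_zero n₁ n₂) n₃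
  have np2 : 2 * y₁ * y₂ * y₃ ≠ 0 := mul_ne_zero (mul_ne_zero (mul_ne_zero two_ne_zero n₁) n₂) n₃
  simp only [P₃, Polynomial.add_comp, Polynomial.sub_comp, Polynomial.mul_comp, Polynomial.C_comp,
    Polynomial.pow_comp, Polynomial.X_comp]
  refine PolyEvalsTo.sub (PolyEvalsTo.add (PolyEvalsTo.sub ?_ ?_) ?_) ?_
  · exact (PolyEvalsTo.C (e1.div hp np)).mul (hX.pow 3)
  · exact (PolyEvalsTo.C (e3.mul (hs.div hp2 np2))).mul (hX.pow 2)
  · exact (PolyEvalsTo.C (((((((hsq h₁).add (hsq h₂)).add (hsq h₃)).add ((e3.mul h₁).mul h₂)).add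
      ((e3.mul h₂).mul h₃)).add ((e3.mul h₁).mul h₃)).div hp2 np2)).mul hX
  · exact PolyEvalsTo.C (((e1.div e4 (by norm_num)).mul hs).mul
      (((e1.div h₁ n₁).add (e1.div h₂ n₂)).add (e1.div h₃ n₃)))

end

section


/-! ### Pairings and primitive vectors -/

section pair

variable {M : Type*} [AddCommGroup M] (δ ε : Lattice3) (x : Fin 3 → M)

theorem pair_eq : pair δ x = δ 0 • x 0 + δ 1 • x 1 + δ 2 • x 2 := by
  rw [pair, Fin.sum_univ_three]

theorem pair_add : pair (δ + ε) x = pair δ x + pair ε x := by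
  simp only [pair_eq, Pi.add_apply, add_smul]; abel

theorem pair_neg : pair (-δ) x = -pair δ x := by
  simp only [pair_eq, Pi.neg_apply, neg_smul]; abel

theorem pair_zsmul (k : ℤ) : pair (k • δ) x = k • pair δ x := by
  simp only [pair_eq, Pi.smul_apply, smul_eq_mul, smul_add, smul_smul]

@[simp]
theorem pair_zero : pair (0 : Lattice3) x = 0 := by
  simp [pair_eq]

end pair

theorem pair_complex (δ : Lattice3) (x : Fin 3 → ℂ) :
    pair δ x = δ 0 * x 0 + δ 1 * x 1 + δ 2 * x 2 := by
  simp [pair_eq]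

theorem pair_int (δ a : Lattice3) : pair δ a = δ 0 * a 0 + δ 1 * a 1 + δ 2 * a 2 := by
  simp [pair_eq]

theorem pair_real (δ : Lattice3) (v : Fin 3 → ℝ) :
    pair δ v = δ 0 * v 0 + δ 1 * v 1 + δ 2 * v 2 := by
  simp [pair_eq]

theorem det_of_three {R : Type*} [CommRing R] (a b c : Fin 3 → R) : (Matrix.of ![a, b, c]).det =
    a 0 * b 1 * c 2 - a 0 * b 2 * c 1 - a 1 * b 0 * c 2 + a 1 * b 2 * c 0 + a 2 * b 0 * c 1
      - a 2 * b 1 * c 0 := by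
  rw [Matrix.det_fin_three]; simp

theorem det_rotate (a b c : Lattice3) :
    (Matrix.of ![b, c, a]).det = (Matrix.of ![a, b, c]).det := by
  rw [det_of_three, det_of_three]; ring

theorem det_swap (a b c : Lattice3) :
    (Matrix.of ![b, a, c]).det = -(Matrix.of ![a, b, c]).det := by
  rw [det_of_three, det_of_three]; ring

/-- Bézout: primitivity says that the greatest common divisor of the entries is a unit. -/
theorem IsPrim.exists_sum_eq_one {v : Lattice3} (hv : IsPrim v) :
    ∃ u : Lattice3, ∑ i, v i * u i = 1 := by
  obtain ⟨g, hg⟩ := Finset.gcd_eq_sum_mul Finset.univ v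
  have hdvd : ∀ i, Finset.univ.gcd v ∣ v i := fun i => Finset.gcd_dvd (Finset.mem_univ i)
  choose u hu using hdvd
  rcases hv (Finset.univ.gcd v) u (funext hu) with h | h
  · exact ⟨g, by rw [← hg, h]⟩
  · refine ⟨-g, ?_⟩
    rw [h] at hg
    simp only [Pi.neg_apply, mul_neg, Finset.sum_neg_distrib, ← hg, neg_neg]

theorem isPrim_of_sum_eq_one {v u : Lattice3} (h : ∑ i, v i * u i = 1) : IsPrim v := by
  intro l w hw
  refine Int.isUnit_iff.mp (isUnit_of_dvd_one ?_)
  rw [← h]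
  refine Finset.dvd_sum fun i _ => Dvd.dvd.mul_right ?_ _
  exact ⟨w i, by rw [hw]; rfl⟩

theorem IsPrim.neg {v : Lattice3} (hv : IsPrim v) : IsPrim (-v) := by
  obtain ⟨u, hu⟩ := hv.exists_sum_eq_one
  exact isPrim_of_sum_eq_one (u := -u) (by simpa using hu)

theorem IsPrim.ne_zero {v : Lattice3} (hv : IsPrim v) : v ≠ 0 := by
  obtain ⟨u, hu⟩ := hv.exists_sum_eq_one
  rintro rfl
  simp at hu

theorem IsPrim.dvd_of_smul_eq {u v : Lattice3} (hu : IsPrim u) {p q : ℤ} (h : p • u = q • v) :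
    q ∣ p := by
  obtain ⟨g, hg⟩ := hu.exists_sum_eq_one
  refine ⟨∑ i, v i * g i, ?_⟩
  have h1 : ∑ i, (p • u) i * g i = p := by
    simp only [Pi.smul_apply, smul_eq_mul, mul_assoc, ← Finset.mul_sum, hg, mul_one]
  rw [h] at h1
  rw [← h1]
  simp only [Pi.smul_apply, smul_eq_mul, mul_assoc, ← Finset.mul_sum]

theorem IsPrim.eq_of_smul_eq {u v : Lattice3} (hu : IsPrim u) (hv : IsPrim v) {p q : ℤ} (hp : 0 < p)
    (hq : 0 < q) (h : p • u = q • v) : u = v := by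
  have hpq : p = q := Int.dvd_antisymm hp.le hq.le (hv.dvd_of_smul_eq h.symm) (hu.dvd_of_smul_eq h)
  subst hpq
  exact smul_right_injective _ hp.ne' h

theorem modulus_smul_dirVec (a b : Lattice3) : modulus a b • dirVec a b = crossProduct a b :=
  funext fun i => Int.mul_ediv_cancel' (Finset.gcd_dvd (Finset.mem_univ i))

theorem eq_dirVec {a b u : Lattice3} (hab : LinearIndependent ℤ ![a, b]) (hu : IsPrim u) {p q : ℤ}
    (hp : 0 < p) (hq : 0 < q) (h : p • u = q • crossProduct a b) : u = dirVec a b := by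
  rw [← modulus_smul_dirVec, smul_smul] at h
  exact hu.eq_of_smul_eq (isPrim_dirVec hab) hp (mul_pos hq (modulus_pos hab)) h

theorem linearIndependent_pair_symm {a b : Lattice3} (h : LinearIndependent ℤ ![a, b]) :
    LinearIndependent ℤ ![b, a] :=
  LinearIndependent.pair_symm_iff.mp h

theorem dirVec_swap {a b : Lattice3} (hab : LinearIndependent ℤ ![a, b]) :
    dirVec b a = -dirVec a b := by
  refine ((isPrim_dirVec hab).neg.eq_of_smul_eq (isPrim_dirVec (linearIndependent_pair_symm hab))
    (modulus_pos hab) (modulus_pos (linearIndependent_pair_symm hab)) ?_).symm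
  rw [smul_neg, modulus_smul_dirVec, modulus_smul_dirVec, cross_anticomm]

theorem pair_dirVec_left {a b : Lattice3} (hab : LinearIndependent ℤ ![a, b]) :
    pair (dirVec a b) a = 0 := by
  have h := det_eq_modulus_mul_pair_dirVec a b a
  have h0 : (Matrix.of ![a, b, a]).det = 0 := by rw [det_of_three]; ring
  rw [h0] at h
  exact (mul_eq_zero.mp h.symm).resolve_left (modulus_pos hab).ne'

theorem pair_dirVec_right {a b : Lattice3} (hab : LinearIndependent ℤ ![a, b]) :
    pair (dirVec a b) b = 0 := by
  have h := det_eq_modulus_mul_pair_dirVec a b b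
  have h0 : (Matrix.of ![a, b, b]).det = 0 := by rw [det_of_three]; ring
  rw [h0] at h
  exact (mul_eq_zero.mp h.symm).resolve_left (modulus_pos hab).ne'

/-- The forms vanishing on `a` and `b` are the multiples of the direction vector. -/
theorem exists_eq_zsmul_dirVec {a b δ : Lattice3} (hab : LinearIndependent ℤ ![a, b])
    (ha : pair δ a = 0) (hb : pair δ b = 0) : ∃ k : ℤ, k • dirVec a b = δ := by
  obtain ⟨u, hu⟩ := (isPrim_dirVec hab).exists_sum_eq_one
  have hs := modulus_pos hab
  have hc : ∀ i, modulus a b * dirVec a b i = crossProduct a b i := fun i =>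
    congrFun (modulus_smul_dirVec a b) i
  have c0 := hc 0
  have c1 := hc 1
  have c2 := hc 2
  simp only [cross_apply, Matrix.cons_val] at c0 c1 c2
  rw [pair_int] at ha hb
  -- By δ × (a × b) = δ(b) a − δ(a) b = 0, δ is proportional to the direction vector γ. The Bézout
  -- coefficients u of γ then give the integral factor ∑ δᵢuᵢ.
  have h01 : δ 0 * dirVec a b 1 = δ 1 * dirVec a b 0 := by
    apply mul_left_cancel₀ hs.ne'
    linear_combination δ 0 * c1 - δ 1 * c0 + a 2 * hb - b 2 * ha
  have h02 : δ 0 * dirVec a b 2 = δ 2 * dirVec a b 0 := by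
    apply mul_left_cancel₀ hs.ne'
    linear_combination δ 0 * c2 - δ 2 * c0 - a 1 * hb + b 1 * ha
  have h12 : δ 1 * dirVec a b 2 = δ 2 * dirVec a b 1 := by
    apply mul_left_cancel₀ hs.ne'
    linear_combination δ 1 * c2 - δ 2 * c1 + a 0 * hb - b 0 * ha
  rw [Fin.sum_univ_three] at hu
  refine ⟨δ 0 * u 0 + δ 1 * u 1 + δ 2 * u 2, funext fun i => ?_⟩
  simp only [Pi.smul_apply, smul_eq_mul]
  fin_cases i
  · simp only [Fin.zero_eta]
    linear_combination δ 0 * hu - u 1 * h01 - u 2 * h02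
  · simp only [Fin.mk_one]
    linear_combination δ 1 * hu + u 0 * h01 - u 2 * h12
  · simp only [Fin.reduceFinMk]
    linear_combination δ 2 * hu + u 0 * h02 + u 1 * h12

/-! ### The domains `U a` -/

/-- The cross product of the imaginary and the real part of `x`. -/
def imCross (x : Fin 3 → ℂ) : Fin 3 → ℝ := crossProduct (fun i => (x i).im) (fun i => (x i).re)

theorem im_pair_mul_conj (δ ε : Lattice3) (x : Fin 3 → ℂ) :
    (pair δ x * (starRingEnd ℂ) (pair ε x)).im = pair (crossProduct δ ε) (imCross x) := by
  rw [pair_complex, pair_complex, pair_real]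
  simp [imCross, cross_apply]
  ring

/-- For a basis (α, β) of H(a), |a|² (α × β) = det(α, β, a) a, and the orientation tested on δ = a
makes the determinant positive. Hence Im(α(x) conj β(x)) = ⟨α × β, N(x)⟩ has the sign of ⟨a, N(x)⟩.
This positivity is all that is used about the domains. -/
theorem pair_imCross_pos {a : Lattice3} (ha : a ≠ 0) {x : Fin 3 → ℂ} (hx : x ∈ U a) :
    0 < pair a (imCross x) := by
  obtain ⟨α, β, hα, hβ, -, hor, him⟩ := hx
  have h3 : ∀ (δ : Fin 3 → ℚ) (y : Fin 3 → ℚ), pair δ y = δ 0 * y 0 + δ 1 * y 1 + δ 2 * y 2 :=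
    fun δ y => by rw [pair, Fin.sum_univ_three]; simp
  have hx3 : ∀ δ : Fin 3 → ℚ, pair δ x = ((δ 0 : ℝ) : ℂ) * x 0 + ((δ 1 : ℝ) : ℂ) * x 1
      + ((δ 2 : ℝ) : ℂ) * x 2 := fun δ => by
    rw [pair, Fin.sum_univ_three]; simp [Rat.smul_def]
  have hpos : (0 : ℚ) < a 0 * a 0 + a 1 * a 1 + a 2 * a 2 := by
    rcases Function.ne_iff.mp ha with ⟨i, hi⟩
    have hi' : (0 : ℚ) < a i * a i := mul_self_pos.mpr (by exact_mod_cast hi)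
    have n0 := mul_self_nonneg (a 0 : ℚ)
    have n1 := mul_self_nonneg (a 1 : ℚ)
    have n2 := mul_self_nonneg (a 2 : ℚ)
    have hle : (a i * a i : ℚ) ≤ a 0 * a 0 + a 1 * a 1 + a 2 * a 2 := by
      clear hi hi'
      fin_cases i <;> simp only [Fin.zero_eta, Fin.mk_one, Fin.reduceFinMk] <;> linarith
    exact hi'.trans_le hle
  have hdet := hor (fun i => (a i : ℚ)) (by rw [h3]; exact hpos)
  rw [det_of_three] at hdet
  rw [h3] at hα hβ
  rw [hx3, hx3] at him
  have hαr : (α 0 : ℝ) * a 0 + α 1 * a 1 + α 2 * a 2 = 0 := by exact_mod_cast hα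
  have hβr : (β 0 : ℝ) * a 0 + β 1 * a 1 + β 2 * a 2 = 0 := by exact_mod_cast hβ
  have hposr : (0 : ℝ) < a 0 * a 0 + a 1 * a 1 + a 2 * a 2 := by exact_mod_cast hpos
  have hdetr : (0 : ℝ) < α 0 * β 1 * a 2 - α 0 * β 2 * a 1 - α 1 * β 0 * a 2 + α 1 * β 2 * a 0
      + α 2 * β 0 * a 1 - α 2 * β 1 * a 0 := by exact_mod_cast hdet
  simp only [map_add, map_mul, Complex.conj_ofReal, Complex.mul_im, Complex.add_re, Complex.add_im,
    Complex.mul_re, Complex.ofReal_re, Complex.ofReal_im, Complex.conj_re, Complex.conj_im, zero_mul,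
    sub_zero, add_zero] at him
  have key := mul_pos hposr him
  rw [pair_real]
  simp only [imCross, cross_apply, Matrix.cons_val]
  by_contra! hneg
  have h4 := mul_nonpos_of_nonneg_of_nonpos hdetr.le hneg
  generalize (a 0 : ℝ) = a0 at *
  generalize (a 1 : ℝ) = a1 at *
  generalize (a 2 : ℝ) = a2 at *
  generalize (α 0 : ℝ) = l0 at *
  generalize (α 1 : ℝ) = l1 at *
  generalize (α 2 : ℝ) = l2 at *
  generalize (β 0 : ℝ) = m0 at *
  generalize (β 1 : ℝ) = m1 at *
  generalize (β 2 : ℝ) = m2 at *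
  have hc0 : (l2 * m0 - l0 * m2) * a2 = (l0 * m1 - l1 * m0) * a1 := by
    linear_combination m0 * hαr - l0 * hβr
  have hc1 : (l0 * m1 - l1 * m0) * a0 = (l1 * m2 - l2 * m1) * a2 := by
    linear_combination m1 * hαr - l1 * hβr
  have hc2 : (l1 * m2 - l2 * m1) * a1 = (l2 * m0 - l0 * m2) * a0 := by
    linear_combination m2 * hαr - l2 * hβr
  refine absurd key (not_lt.mpr (le_trans (le_of_eq ?_) h4))
  generalize (x 0).re = p0
  generalize (x 1).re = p1
  generalize (x 2).re = p2
  generalize (x 0).im = q0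
  generalize (x 1).im = q1
  generalize (x 2).im = q2
  have e0 : (a0 * a0 + a1 * a1 + a2 * a2) * (l1 * m2 - l2 * m1) = a0 * (l0 * m1 * a2 - l0 * m2 * a1
      - l1 * m0 * a2 + l1 * m2 * a0 + l2 * m0 * a1 - l2 * m1 * a0) := by
    linear_combination a1 * hc2 - a2 * hc1
  have e1 : (a0 * a0 + a1 * a1 + a2 * a2) * (l2 * m0 - l0 * m2) = a1 * (l0 * m1 * a2 - l0 * m2 * a1
      - l1 * m0 * a2 + l1 * m2 * a0 + l2 * m0 * a1 - l2 * m1 * a0) := by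
    linear_combination a2 * hc0 - a0 * hc2
  have e2 : (a0 * a0 + a1 * a1 + a2 * a2) * (l0 * m1 - l1 * m0) = a2 * (l0 * m1 * a2 - l0 * m2 * a1
      - l1 * m0 * a2 + l1 * m2 * a0 + l2 * m0 * a1 - l2 * m1 * a0) := by
    linear_combination a0 * hc1 - a1 * hc0
  linear_combination (q1 * p2 - q2 * p1) * e0 + (q2 * p0 - q0 * p2) * e1 + (q0 * p1 - q1 * p0) * e2

/-- The imaginary part of `δ(x) / γ(x)` is a combination of `δ(a)` and `δ(b)`. -/
theorem modulus_mul_im (a b δ : Lattice3) (x : Fin 3 → ℂ) :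
    (modulus a b : ℝ) * (pair δ x * (starRingEnd ℂ) (pair (dirVec a b) x)).im =
      pair δ b * pair a (imCross x) - pair δ a * pair b (imCross x) := by
  have hc : ∀ i, ((modulus a b : ℤ) : ℝ) * (dirVec a b i : ℝ) = (crossProduct a b i : ℤ) := fun i => by
    exact_mod_cast congrFun (modulus_smul_dirVec a b) i
  have c0 := hc 0
  have c1 := hc 1
  have c2 := hc 2
  simp only [cross_apply, Matrix.cons_val] at c0 c1 c2
  push_cast at c0 c1 c2
  rw [im_pair_mul_conj, pair_real, pair_real, pair_real, pair_int, pair_int]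
  simp only [cross_apply, Matrix.cons_val]
  push_cast
  generalize imCross x 0 = n0
  generalize imCross x 1 = n1
  generalize imCross x 2 = n2
  linear_combination (δ 1 * c2 - δ 2 * c1) * n0 + (δ 2 * c0 - δ 0 * c2) * n1
    + (δ 0 * c1 - δ 1 * c0) * n2

/-- If γ(x) = 0, then `modulus_mul_im` for the coordinate forms makes b proportional to a. -/
theorem pair_dirVec_ne_zero {a b : Lattice3} (hab : LinearIndependent ℤ ![a, b]) {x : Fin 3 → ℂ}
    (ha : 0 < pair a (imCross x)) : pair (dirVec a b) x ≠ 0 := by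
  intro h0
  have h : ∀ δ : Lattice3,
      ((pair δ b : ℤ) : ℝ) * pair a (imCross x) = ((pair δ a : ℤ) : ℝ) * pair b (imCross x) :=
    fun δ => by
    have := modulus_mul_im a b δ x
    rw [h0] at this
    simp only [map_zero, mul_zero, Complex.zero_im] at this
    linarith
  have hA := ha.ne'
  have hi : ∀ i, (b i : ℝ) * pair a (imCross x) = a i * pair b (imCross x) := fun i => by
    have := h (Pi.single i 1)
    rw [pair_int, pair_int] at this
    fin_cases i <;> simpa using this
  have hs := modulus_pos hab
  have hcr : ∀ i j, a i * b j - a j * b i = 0 := fun i j => by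
    have : ((a i * b j - a j * b i : ℤ) : ℝ) = 0 := by
      push_cast
      apply mul_right_cancel₀ hA
      linear_combination (a i : ℝ) * hi j - a j * hi i
    exact_mod_cast this
  have hz : crossProduct a b = 0 := by
    funext i
    rw [cross_apply]
    fin_cases i <;> simp [hcr]
  rw [← modulus_smul_dirVec] at hz
  exact (isPrim_dirVec hab).ne_zero ((smul_eq_zero.mp hz).resolve_left hs.ne')

end

section


/-! ### Products over classes of a cone -/

/-- The exponential `exp(-2πi (δ(x) - w) / γ(x))`. -/
def expTerm (γ : Lattice3) (w : ℂ) (x : Fin 3 → ℂ) (δ : Lattice3) : ℂ :=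
  Complex.exp (-2 * Real.pi * Complex.I * (pair δ x - w) / pair γ x)

/-- The product of `1 - g δ` over the classes modulo `H` of the elements `δ` of `C`. -/
def classProd (H : AddSubgroup Lattice3) (C : Set Lattice3) (g : Lattice3 → ℂ) : ℂ :=
  ∏' q : (QuotientAddGroup.mk '' C : Set (Lattice3 ⧸ H)), (1 - g (Quotient.out q.1))

/-- The numerator of `Γ_{a,b}`. -/
def numProd (a b : Lattice3) (w : ℂ) (x : Fin 3 → ℂ) : ℂ :=
  classProd (AddSubgroup.zmultiples (dirVec a b)) (conePM a b) (expTerm (dirVec a b) w x)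

theorem coneMP_eq (a b : Lattice3) : coneMP a b = conePM b a :=
  Set.ext fun _ => and_comm

theorem expTerm_neg (γ : Lattice3) (w : ℂ) (x : Fin 3 → ℂ) (δ : Lattice3) :
    expTerm (-γ) w x δ = Complex.exp (2 * Real.pi * Complex.I * (pair δ x - w) / pair γ x) := by
  rw [expTerm, pair_neg]
  congr 1
  rw [div_neg, ← neg_div]
  ring

theorem denFactor_eq {a b : Lattice3} (hab : LinearIndependent ℤ ![a, b]) (w : ℂ) (x : Fin 3 → ℂ)
    (q : classes (coneMP a b) (dirVec a b)) :
    denFactor a b w x q = 1 - expTerm (dirVec b a) w x (Quotient.out q.1) := by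
  rw [dirVec_swap hab, expTerm_neg, denFactor]

/-- Reversing the wedge negates the direction vector without changing the subgroup it generates, and
exchanges the two cones. -/
theorem tprod_denFactor {a b : Lattice3} (hab : LinearIndependent ℤ ![a, b]) (w : ℂ)
    (x : Fin 3 → ℂ) : ∏' q, denFactor a b w x q = numProd b a w x := by
  have h : ∏' q, denFactor a b w x q = classProd (AddSubgroup.zmultiples (dirVec a b))
      (coneMP a b) (expTerm (dirVec b a) w x) :=
    tprod_congr fun q => denFactor_eq hab w x q
  rw [h, numProd, coneMP_eq, dirVec_swap hab, AddSubgroup.zmultiples_neg]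

theorem wedgeGamma_eq {a b : Lattice3} (hab : LinearIndependent ℤ ![a, b]) (w : ℂ)
    (x : Fin 3 → ℂ) : wedgeGamma a b w x = numProd a b w x / numProd b a w x := by
  rw [wedgeGamma, if_pos hab, tprod_denFactor hab]
  rfl

theorem expTerm_add_zsmul {γ : Lattice3} {x : Fin 3 → ℂ} (hγ : pair γ x ≠ 0) (w : ℂ)
    (δ : Lattice3) (k : ℤ) : expTerm γ w x (δ + k • γ) = expTerm γ w x δ := by
  rw [expTerm, expTerm, pair_add, pair_zsmul, zsmul_eq_mul,
    show -2 * Real.pi * Complex.I * (pair δ x + k * pair γ x - w) / pair γ x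
      = -2 * Real.pi * Complex.I * (pair δ x - w) / pair γ x - k * (2 * Real.pi * Complex.I) by
        field_simp; ring]
  exact Complex.exp_periodic.sub_int_mul_eq k

theorem exists_out_eq (γ δ : Lattice3) : ∃ k : ℤ,
    Quotient.out (δ : Lattice3 ⧸ AddSubgroup.zmultiples γ) = δ + k • γ := by
  obtain ⟨h, hh⟩ := QuotientAddGroup.mk_out_eq_add (AddSubgroup.zmultiples γ) δ
  obtain ⟨k, hk⟩ := AddSubgroup.mem_zmultiples_iff.mp h.2
  exact ⟨k, by rw [hk]; exact hh⟩

theorem expTerm_out {γ : Lattice3} {x : Fin 3 → ℂ} (hγ : pair γ x ≠ 0) (w : ℂ) (δ : Lattice3) :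
    expTerm γ w x (Quotient.out (δ : Lattice3 ⧸ AddSubgroup.zmultiples γ)) = expTerm γ w x δ := by
  obtain ⟨k, hk⟩ := exists_out_eq γ δ
  rw [hk, expTerm_add_zsmul hγ]

theorem pair_add_zsmul_of_eq_zero {γ a : Lattice3} (h : pair γ a = 0) (δ : Lattice3) (k : ℤ) :
    pair (δ + k • γ) a = pair δ a := by
  rw [pair_add, pair_zsmul, h, smul_zero, add_zero]

/-- By `modulus_mul_im`, Im(δ(x)/γ(x)) is linear in δ(a) and δ(b), with the two signs that give
decay on the cone in both directions. -/
theorem norm_expTerm {a b : Lattice3} (hab : LinearIndependent ℤ ![a, b]) {x : Fin 3 → ℂ}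
    (ha : 0 < pair a (imCross x)) (hb : 0 < pair b (imCross x)) (w : ℂ) :
    ∃ K r s : ℝ, 0 ≤ r ∧ r < 1 ∧ 0 ≤ s ∧ s < 1 ∧ ∀ δ ∈ conePM a b,
      ‖expTerm (dirVec a b) w x δ‖ = K * (r ^ (pair δ a).toNat * s ^ (-pair δ b).toNat) := by
  have hγ := pair_dirVec_ne_zero hab ha
  have hs : (0 : ℝ) < modulus a b := by exact_mod_cast modulus_pos hab
  have hn := Complex.normSq_pos.mpr hγ
  have hpi := Real.pi_pos
  set n := Complex.normSq (pair (dirVec a b) x)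
  set A := 2 * Real.pi * (pair a (imCross x) / (modulus a b * n)) with hA
  set B := 2 * Real.pi * (pair b (imCross x) / (modulus a b * n)) with hB
  have hA0 : 0 < A := by positivity
  have hB0 : 0 < B := by positivity
  refine ⟨Real.exp (-(2 * Real.pi * (w / pair (dirVec a b) x).im)), Real.exp (-B), Real.exp (-A),
    (Real.exp_pos _).le, by rw [Real.exp_lt_one_iff]; linarith, (Real.exp_pos _).le,
    by rw [Real.exp_lt_one_iff]; linarith, fun δ hδ => ?_⟩
  have him : (pair δ x / pair (dirVec a b) x).im
      = (pair δ b * pair a (imCross x) - pair δ a * pair b (imCross x)) / (modulus a b * n) := by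
    rw [← modulus_mul_im, im_div_eq, mul_div_mul_left _ _ hs.ne']
  have h1 : (((pair δ a).toNat : ℕ) : ℝ) = ((pair δ a : ℤ) : ℝ) := by
    exact_mod_cast Int.toNat_of_nonneg hδ.1.le
  have h2 : (((-pair δ b).toNat : ℕ) : ℝ) = -((pair δ b : ℤ) : ℝ) := by
    exact_mod_cast Int.toNat_of_nonneg (neg_nonneg.mpr hδ.2)
  rw [expTerm, show -2 * Real.pi * Complex.I * (pair δ x - w) / pair (dirVec a b) x
    = 2 * Real.pi * Complex.I * (w / pair (dirVec a b) x - pair δ x / pair (dirVec a b) x) by ring,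
    norm_exp_two_pi_I_mul, ← Real.exp_nat_mul, ← Real.exp_nat_mul, ← Real.exp_add, ← Real.exp_add,
    h1, h2, Complex.sub_im, him, hA, hB]
  congr 1
  ring

theorem out_mem_conePM {a b : Lattice3} (hab : LinearIndependent ℤ ![a, b])
    (q : (QuotientAddGroup.mk '' conePM a b :
      Set (Lattice3 ⧸ AddSubgroup.zmultiples (dirVec a b)))) : Quotient.out q.1 ∈ conePM a b := by
  obtain ⟨q, δ, hδ, rfl⟩ := q
  obtain ⟨k, hk⟩ := exists_out_eq (dirVec a b) δ
  change Quotient.out (δ : Lattice3 ⧸ AddSubgroup.zmultiples (dirVec a b)) ∈ conePM a b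
  rw [hk]
  exact ⟨by rw [pair_add_zsmul_of_eq_zero (pair_dirVec_left hab)]; exact hδ.1,
    by rw [pair_add_zsmul_of_eq_zero (pair_dirVec_right hab)]; exact hδ.2⟩

/-- A class modulo γ is determined by the values δ(a) and δ(b), so the series is part of a double
geometric series. -/
theorem summable_norm_expTerm {a b : Lattice3} (hab : LinearIndependent ℤ ![a, b])
    {x : Fin 3 → ℂ} (ha : 0 < pair a (imCross x)) (hb : 0 < pair b (imCross x)) (w : ℂ) :
    Summable fun q : (QuotientAddGroup.mk '' conePM a b :
      Set (Lattice3 ⧸ AddSubgroup.zmultiples (dirVec a b))) =>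
        ‖-expTerm (dirVec a b) w x (Quotient.out q.1)‖ := by
  obtain ⟨K, r, s, hr0, hr1, hs0, hs1, h⟩ := norm_expTerm hab ha hb w
  have hinj : Function.Injective fun q : (QuotientAddGroup.mk '' conePM a b :
      Set (Lattice3 ⧸ AddSubgroup.zmultiples (dirVec a b))) =>
        ((pair (Quotient.out q.1) a).toNat, (-pair (Quotient.out q.1) b).toNat) := by
    intro q q' hqq
    have hq := out_mem_conePM hab q
    have hq' := out_mem_conePM hab q'
    obtain ⟨h1, h2⟩ := Prod.ext_iff.mp hqq
    simp only at h1 h2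
    have h1' : pair (Quotient.out q.1) a = pair (Quotient.out q'.1) a := by
      have := hq.1; have := hq'.1; omega
    have h2' : pair (Quotient.out q.1) b = pair (Quotient.out q'.1) b := by
      have := hq.2; have := hq'.2; omega
    obtain ⟨k, hk⟩ := exists_eq_zsmul_dirVec (δ := -Quotient.out q.1 + Quotient.out q'.1) hab
      (by rw [pair_add, pair_neg, h1']; ring) (by rw [pair_add, pair_neg, h2']; ring)
    apply Subtype.ext
    rw [← QuotientAddGroup.out_eq' q.1, ← QuotientAddGroup.out_eq' q'.1, QuotientAddGroup.eq]
    exact AddSubgroup.mem_zmultiples_iff.mpr ⟨k, hk⟩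
  have hsum := ((summable_mul_pow_mul_pow hr0 hr1 hs0 hs1).mul_left K).comp_injective hinj
  refine hsum.congr fun q => ?_
  rw [norm_neg, h _ (out_mem_conePM hab q)]
  rfl

theorem multipliable_numFactor {a b : Lattice3} (hab : LinearIndependent ℤ ![a, b])
    {x : Fin 3 → ℂ} (ha : 0 < pair a (imCross x)) (hb : 0 < pair b (imCross x)) (w : ℂ) :
    Multipliable (numFactor a b w x) := by
  have h := multipliable_one_add_of_summable (summable_norm_expTerm hab ha hb w)
  simp only [← sub_eq_add_neg] at h
  exact h

theorem multipliable_denFactor {a b : Lattice3} (hab : LinearIndependent ℤ ![a, b])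
    {x : Fin 3 → ℂ} (ha : 0 < pair a (imCross x)) (hb : 0 < pair b (imCross x)) (w : ℂ) :
    Multipliable (denFactor a b w x) := by
  have h := multipliable_numFactor (linearIndependent_pair_symm hab) hb ha w
  have h2 : Multipliable fun q : (QuotientAddGroup.mk '' conePM b a :
      Set (Lattice3 ⧸ AddSubgroup.zmultiples (dirVec b a))) =>
        1 - expTerm (dirVec b a) w x (Quotient.out q.1) := h
  -- The subgroups generated by γ and −γ are equal but not definitionally so; a variable subgroup
  -- transports the statement between the two quotients.
  have h3 : ∀ H : AddSubgroup Lattice3, H = AddSubgroup.zmultiples (dirVec b a) →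
      Multipliable fun q : (QuotientAddGroup.mk '' coneMP a b : Set (Lattice3 ⧸ H)) =>
        1 - expTerm (dirVec b a) w x (Quotient.out q.1) := by
    rintro H rfl
    rw [coneMP_eq]
    exact h2
  refine (h3 (AddSubgroup.zmultiples (dirVec a b)) ?_).congr fun q => ?_
  · rw [dirVec_swap hab, AddSubgroup.zmultiples_neg]
  · exact (denFactor_eq hab w x q).symm

/-- An absolutely convergent product vanishes only with one of its factors. A vanishing factor means
w ∈ δ(x) + ℤγ(x), and the cone is invariant under γ. -/
theorem numProd_ne_zero {a b : Lattice3} (hab : LinearIndependent ℤ ![a, b]) {x : Fin 3 → ℂ}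
    (ha : 0 < pair a (imCross x)) (hb : 0 < pair b (imCross x)) {w : ℂ}
    (hw : ∀ δ ∈ conePM a b, w ≠ pair δ x) : numProd a b w x ≠ 0 := by
  have hγ := pair_dirVec_ne_zero hab ha
  have h := tprod_one_add_ne_zero_of_summable (f := fun q : (QuotientAddGroup.mk '' conePM a b :
      Set (Lattice3 ⧸ AddSubgroup.zmultiples (dirVec a b))) =>
        -expTerm (dirVec a b) w x (Quotient.out q.1)) (fun q h0 => ?_)
    (summable_norm_expTerm hab ha hb w)
  · simp only [← sub_eq_add_neg] at h
    exact h
  · have hq := out_mem_conePM hab q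
    rw [← sub_eq_add_neg, sub_eq_zero, expTerm, eq_comm, Complex.exp_eq_one_iff] at h0
    obtain ⟨k, hk⟩ := h0
    have hpi := Complex.two_pi_I_ne_zero
    rw [div_eq_iff hγ] at hk
    have hk' : w = pair (Quotient.out q.1) x + k * pair (dirVec a b) x := by
      apply mul_left_cancel₀ hpi
      linear_combination hk
    refine hw (Quotient.out q.1 + k • dirVec a b) ⟨?_, ?_⟩ ?_
    · rw [pair_add_zsmul_of_eq_zero (pair_dirVec_left hab)]; exact hq.1
    · rw [pair_add_zsmul_of_eq_zero (pair_dirVec_right hab)]; exact hq.2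
    · rw [hk', pair_add, pair_zsmul, zsmul_eq_mul]

theorem NotPole.numProd_ne_zero {a b : Lattice3} (hab : LinearIndependent ℤ ![a, b])
    {x : Fin 3 → ℂ} (ha : 0 < pair a (imCross x)) (hb : 0 < pair b (imCross x)) {w : ℂ}
    (hw : NotPole a b w x) : numProd b a w x ≠ 0 :=
  EllGamma.numProd_ne_zero (linearIndependent_pair_symm hab) hb ha (by
    rw [← coneMP_eq]; exact hw)

/-! ### Coplanar wedges -/

theorem classProd_union {H : AddSubgroup Lattice3} {C D : Set Lattice3} {g : Lattice3 → ℂ}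
    (hCD : ∀ δ ∈ C, ∀ ε ∈ D, -δ + ε ∉ H)
    (hC : Multipliable fun q : (QuotientAddGroup.mk '' C : Set (Lattice3 ⧸ H)) =>
      1 - g (Quotient.out q.1))
    (hD : Multipliable fun q : (QuotientAddGroup.mk '' D : Set (Lattice3 ⧸ H)) =>
      1 - g (Quotient.out q.1)) :
    classProd H (C ∪ D) g = classProd H C g * classProd H D g := by
  have hdisj : Disjoint (QuotientAddGroup.mk '' C : Set (Lattice3 ⧸ H))
      (QuotientAddGroup.mk '' D) := by
    rw [Set.disjoint_left]
    rintro _ ⟨δ, hδ, rfl⟩ ⟨ε, hε, h⟩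
    exact hCD δ hδ ε hε (QuotientAddGroup.eq.mp h.symm)
  rw [classProd, Set.image_union]
  exact Multipliable.tprod_union_disjoint (f := fun q : Lattice3 ⧸ H => 1 - g (Quotient.out q))
    hdisj hC hD

/-- As b is a positive combination of a and c, the three wedges share their direction vector, and
the sign of δ(b) splits the cone of (a, c) into those of (a, b) and (b, c). -/
theorem numProd_mul_of_between {a b c : Lattice3} (hab : LinearIndependent ℤ ![a, b])
    (hbc : LinearIndependent ℤ ![b, c]) (hac : LinearIndependent ℤ ![a, c]) {x : Fin 3 → ℂ}
    (ha : 0 < pair a (imCross x)) (hb : 0 < pair b (imCross x)) (hc : 0 < pair c (imCross x))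
    {r m n : ℤ} (hr : 0 < r) (hm : 0 < m) (hn : 0 < n) (h : r • b = m • a + n • c) (w : ℂ) :
    numProd a c w x = numProd a b w x * numProd b c w x := by
  have hcomp : ∀ i, r * b i = m * a i + n * c i := fun i => congrFun h i
  have e0 := hcomp 0
  have e1 := hcomp 1
  have e2 := hcomp 2
  have hd1 : dirVec a b = dirVec a c := by
    refine eq_dirVec hac (isPrim_dirVec hab) (mul_pos hr (modulus_pos hab)) hn ?_
    rw [mul_smul, modulus_smul_dirVec]
    funext i
    rw [cross_apply, cross_apply]
    fin_cases i <;> simp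
    · linear_combination a 1 * e2 - a 2 * e1
    · linear_combination a 2 * e0 - a 0 * e2
    · linear_combination a 0 * e1 - a 1 * e0
  have hd2 : dirVec b c = dirVec a c := by
    refine eq_dirVec hac (isPrim_dirVec hbc) (mul_pos hr (modulus_pos hbc)) hm ?_
    rw [mul_smul, modulus_smul_dirVec]
    funext i
    rw [cross_apply, cross_apply]
    fin_cases i <;> simp
    · linear_combination c 2 * e1 - c 1 * e2
    · linear_combination c 0 * e2 - c 2 * e0
    · linear_combination c 1 * e0 - c 0 * e1
  have hpair : ∀ δ : Lattice3, r * pair δ b = m * pair δ a + n * pair δ c := fun δ => by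
    rw [pair_int, pair_int, pair_int]
    linear_combination δ 0 * e0 + δ 1 * e1 + δ 2 * e2
  have hset : conePM a c = conePM a b ∪ conePM b c := by
    ext δ
    have hp := hpair δ
    simp only [conePM, Set.mem_union, Set.mem_ofPred_eq]
    constructor
    · rintro ⟨h1, h2⟩
      rcases le_or_gt (pair δ b) 0 with h3 | h3
      · exact Or.inl ⟨h1, h3⟩
      · exact Or.inr ⟨h3, h2⟩
    · rintro (⟨h1, h2⟩ | ⟨h1, h2⟩)
      · refine ⟨h1, ?_⟩
        by_contra! h3
        nlinarith
      · refine ⟨?_, h2⟩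
        by_contra! h3
        nlinarith
  have h1 := multipliable_numFactor hab ha hb w
  have h2 := multipliable_numFactor hbc hb hc w
  have hm1 : Multipliable fun q : (QuotientAddGroup.mk '' conePM a b :
      Set (Lattice3 ⧸ AddSubgroup.zmultiples (dirVec a b))) =>
        1 - expTerm (dirVec a b) w x (Quotient.out q.1) := h1
  have hm2 : Multipliable fun q : (QuotientAddGroup.mk '' conePM b c :
      Set (Lattice3 ⧸ AddSubgroup.zmultiples (dirVec b c))) =>
        1 - expTerm (dirVec b c) w x (Quotient.out q.1) := h2
  rw [numProd, numProd, numProd, hset]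
  rw [hd1] at hm1 ⊢
  rw [hd2] at hm2 ⊢
  refine classProd_union (fun δ hδ ε hε hmem => ?_) hm1 hm2
  obtain ⟨k, hk⟩ := AddSubgroup.mem_zmultiples_iff.mp hmem
  have h3 : pair (-δ + ε) b = 0 := by
    rw [← hk, pair_zsmul, ← hd1, pair_dirVec_right hab, smul_zero]
  rw [pair_add, pair_neg] at h3
  have h4 := hδ.2
  have h5 := hε.1
  omega

/-- The product of the three gamma functions of coplanar wedges is trivial. -/
theorem wedgeGamma_mul_of_between {a b c : Lattice3} (hab : LinearIndependent ℤ ![a, b])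
    (hbc : LinearIndependent ℤ ![b, c]) (hca : LinearIndependent ℤ ![c, a]) {x : Fin 3 → ℂ}
    (ha : 0 < pair a (imCross x)) (hb : 0 < pair b (imCross x)) (hc : 0 < pair c (imCross x))
    {r m n : ℤ} (hr : 0 < r) (hm : 0 < m) (hn : 0 < n) (h : r • b = m • a + n • c) {w : ℂ}
    (h1 : NotPole a b w x) (h2 : NotPole b c w x) (h3 : NotPole c a w x) :
    wedgeGamma a b w x * wedgeGamma b c w x * wedgeGamma c a w x = 1 := by
  have n1 := h1.numProd_ne_zero hab ha hb
  have n2 := h2.numProd_ne_zero hbc hb hc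
  have n3 := h3.numProd_ne_zero hca hc ha
  have hac := linearIndependent_pair_symm hca
  have e1 := numProd_mul_of_between hab hbc hac ha hb hc hr hm hn h w
  have e2 := numProd_mul_of_between (linearIndependent_pair_symm hbc)
    (linearIndependent_pair_symm hab) hca hc hb ha hr hn hm (by rw [h, add_comm]) w
  rw [wedgeGamma_eq hab, wedgeGamma_eq hbc, wedgeGamma_eq hca, e2]
  rw [e1] at n3 ⊢
  have n4 := left_ne_zero_of_mul n3
  have n5 := right_ne_zero_of_mul n3
  field_simp

theorem wedgeGamma_mul_swap {a b : Lattice3} {x : Fin 3 → ℂ} (ha : 0 < pair a (imCross x))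
    (hb : 0 < pair b (imCross x)) {w : ℂ} (h1 : NotPole a b w x) (h2 : NotPole b a w x) :
    wedgeGamma a b w x * wedgeGamma b a w x = 1 := by
  by_cases hab : LinearIndependent ℤ ![a, b]
  · have hba := linearIndependent_pair_symm hab
    have n1 := h1.numProd_ne_zero hab ha hb
    have n2 := h2.numProd_ne_zero hba hb ha
    rw [wedgeGamma_eq hab, wedgeGamma_eq hba]
    field_simp
  · have hba : ¬ LinearIndependent ℤ ![b, a] := fun h => hab (linearIndependent_pair_symm h)
    rw [wedgeGamma, wedgeGamma, if_neg hab, if_neg hba, one_mul]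

theorem wedgeGamma_self (a : Lattice3) (w : ℂ) (x : Fin 3 → ℂ) : wedgeGamma a a w x = 1 := by
  rw [wedgeGamma, if_neg]
  intro h
  have := (LinearIndependent.pair_iff.mp h) 1 (-1) (by simp)
  exact one_ne_zero this.1

theorem pair_imCross_linear {m n : ℤ} {a b : Lattice3} (v : Fin 3 → ℝ) :
    pair (m • a + n • b) v = m * pair a v + n * pair b v := by
  rw [pair_add, pair_zsmul, pair_zsmul, zsmul_eq_mul, zsmul_eq_mul]

/-- Proportional primitive vectors agree up to sign, and positivity on N(x) excludes b = −a. -/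
theorem eq_of_not_linearIndependent {a b : Lattice3} (hpa : IsPrim a) (hpb : IsPrim b)
    {x : Fin 3 → ℂ} (ha : 0 < pair a (imCross x)) (hb : 0 < pair b (imCross x))
    (hab : ¬ LinearIndependent ℤ ![a, b]) : a = b := by
  rw [LinearIndependent.pair_iff] at hab
  push Not at hab
  obtain ⟨s, t, h, hst⟩ := hab
  have hN : (s : ℝ) * pair a (imCross x) + t * pair b (imCross x) = 0 := by
    rw [← pair_imCross_linear, h, pair_zero]
  have hs : s ≠ 0 := by
    rintro rfl
    have ht := hst rfl
    simp only [Int.cast_zero, zero_mul, zero_add, mul_eq_zero, hb.ne', or_false] at hN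
    exact ht (by exact_mod_cast hN)
  rcases lt_or_gt_of_ne hs with hneg | hpos
  · have ht : 0 < t := by
      by_contra! ht
      have h1 : (s : ℝ) < 0 := by exact_mod_cast hneg
      have h2 : (t : ℝ) ≤ 0 := by exact_mod_cast ht
      nlinarith
    refine hpa.eq_of_smul_eq hpb (neg_pos.mpr hneg) ht ?_
    rw [neg_smul, neg_eq_iff_add_eq_zero]
    exact h
  · have ht : t < 0 := by
      by_contra! ht
      have h1 : (0 : ℝ) < s := by exact_mod_cast hpos
      have h2 : (0 : ℝ) ≤ t := by exact_mod_cast ht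
      nlinarith
    refine hpa.eq_of_smul_eq hpb hpos (neg_pos.mpr ht) ?_
    rw [neg_smul, eq_neg_iff_add_eq_zero]
    exact h

/-- The product of the gamma functions of three linearly dependent vectors is trivial. -/
theorem wedgeGamma_mul_of_dependent {a b c : Lattice3} (hpa : IsPrim a) (hpb : IsPrim b)
    (hpc : IsPrim c) {x : Fin 3 → ℂ} (ha : 0 < pair a (imCross x)) (hb : 0 < pair b (imCross x))
    (hc : 0 < pair c (imCross x)) (habc : ¬ LinearIndependent ℤ ![a, b, c]) {w : ℂ}
    (h1 : NotPole a b w x) (h2 : NotPole b c w x) (h3 : NotPole c a w x) :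
    wedgeGamma a b w x * wedgeGamma b c w x * wedgeGamma c a w x = 1 := by
  by_cases hab : LinearIndependent ℤ ![a, b]
  swap
  · obtain rfl := eq_of_not_linearIndependent hpa hpb ha hb hab
    rw [wedgeGamma_self, one_mul, wedgeGamma_mul_swap ha hc h2 h3]
  by_cases hbc : LinearIndependent ℤ ![b, c]
  swap
  · obtain rfl := eq_of_not_linearIndependent hpb hpc hb hc hbc
    rw [wedgeGamma_self, mul_one, wedgeGamma_mul_swap ha hb h1 h3]
  by_cases hca : LinearIndependent ℤ ![c, a]
  swap
  · obtain rfl := eq_of_not_linearIndependent hpc hpa hc ha hca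
    rw [wedgeGamma_self, mul_one, wedgeGamma_mul_swap hc hb h1 h2]
  rw [Fintype.not_linearIndependent_iff] at habc
  obtain ⟨g, hg, i, hi⟩ := habc
  rw [Fin.sum_univ_three] at hg
  simp only [Matrix.cons_val] at hg
  -- Two of three signs agree, and the relation may be negated. Pairwise independence then makes all
  -- coefficients nonzero, and pairing with N(x) forces the third to be negative: its vector lies
  -- between the other two.
  wlog hsign : (0 ≤ g 0 ∧ 0 ≤ g 1) ∨ (0 ≤ g 1 ∧ 0 ≤ g 2) ∨ (0 ≤ g 2 ∧ 0 ≤ g 0) generalizing g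
  · refine this (-g) ?_ (neg_ne_zero.mpr hi) ?_
    · simp only [Pi.neg_apply, neg_smul, ← neg_add, hg, neg_zero]
    · simp only [Pi.neg_apply]
      omega
  have hN : (g 0 : ℝ) * pair a (imCross x) + g 1 * pair b (imCross x)
      + g 2 * pair c (imCross x) = 0 := by
    have := congrArg (fun v => pair v (imCross x)) hg
    simp only [pair_add, pair_zsmul, pair_zero] at this
    simpa only [zsmul_eq_mul] using this
  have hz0 : g 0 = 0 → g 1 = 0 ∧ g 2 = 0 := fun h0 => by
    rw [h0, zero_smul, zero_add] at hg
    exact LinearIndependent.pair_iff.mp hbc _ _ hg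
  have hz1 : g 1 = 0 → g 2 = 0 ∧ g 0 = 0 := fun h0 => by
    rw [h0, zero_smul, add_zero, add_comm] at hg
    exact LinearIndependent.pair_iff.mp hca _ _ hg
  have hz2 : g 2 = 0 → g 0 = 0 ∧ g 1 = 0 := fun h0 => by
    rw [h0, zero_smul, add_zero] at hg
    exact LinearIndependent.pair_iff.mp hab _ _ hg
  have hne : g 0 ≠ 0 ∧ g 1 ≠ 0 ∧ g 2 ≠ 0 := by
    have : ¬ (g 0 = 0 ∧ g 1 = 0 ∧ g 2 = 0) := by
      rintro ⟨e0, e1, e2⟩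
      fin_cases i
      · exact hi e0
      · exact hi e1
      · exact hi e2
    tauto
  obtain ⟨k0, k1, k2⟩ := hne
  have hnn : ∀ p q s : ℤ, ∀ A B C : ℝ, 0 < p → 0 < q → 0 < A → 0 < B → 0 < C →
      (p : ℝ) * A + q * B + s * C = 0 → s < 0 := by
    intro p q s A B C hp hq hA hB hC h
    by_contra! hs
    have h1 : (0 : ℝ) < p := by exact_mod_cast hp
    have h2 : (0 : ℝ) < q := by exact_mod_cast hq
    have h3 : (0 : ℝ) ≤ s := by exact_mod_cast hs
    have := mul_pos h1 hA
    have := mul_pos h2 hB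
    have := mul_nonneg h3 hC.le
    linarith
  rcases hsign with ⟨s0, s1⟩ | ⟨s1, s2⟩ | ⟨s2, s0⟩
  · have hlt := hnn (g 0) (g 1) (g 2) _ _ _ (by omega) (by omega) ha hb hc hN
    have key := wedgeGamma_mul_of_between hbc hca hab hb hc ha (r := -g 2) (m := g 1) (n := g 0)
      (by omega) (by omega) (by omega)
      (by rw [neg_smul, eq_comm, ← add_eq_zero_iff_eq_neg, ← hg]; abel) h2 h3 h1
    rw [← key]; ring
  · have hlt := hnn (g 1) (g 2) (g 0) _ _ _ (by omega) (by omega) hb hc ha (by linarith)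
    have key := wedgeGamma_mul_of_between hca hab hbc hc ha hb (r := -g 0) (m := g 2) (n := g 1)
      (by omega) (by omega) (by omega)
      (by rw [neg_smul, eq_comm, ← add_eq_zero_iff_eq_neg, ← hg]; abel) h3 h1 h2
    rw [← key]; ring
  · have hlt := hnn (g 2) (g 0) (g 1) _ _ _ (by omega) (by omega) hc ha hb (by linarith)
    exact wedgeGamma_mul_of_between hab hbc hca ha hb hc (r := -g 1) (m := g 0) (n := g 2)
      (by omega) (by omega) (by omega)
      (by rw [neg_smul, eq_comm, ← add_eq_zero_iff_eq_neg, ← hg]; abel) h1 h2 h3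

end

section


/-! ### Lattice points of a parallelepiped -/

theorem eq_zero_of_mul_eq_sub {s t e k : ℤ} (hs : 0 ≤ s ∧ s < |e|) (ht : 0 ≤ t ∧ t < |e|)
    (h : k * e = s - t) : k = 0 := by
  by_contra hk
  have h1 : 1 ≤ |k| := Int.one_le_abs hk
  have h2 : |k| * |e| = |s - t| := by rw [← abs_mul, h]
  have h3 : |s - t| < |e| := abs_lt.mpr ⟨by omega, by omega⟩
  nlinarith [abs_nonneg e]

/-- The lattice points `δ` with `0 ≤ δ(a) < |α(a)|`, `0 ≤ δ(b) < |β(b)|`, `0 ≤ δ(c) < |γ(c)|`. -/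
def fundDomain (a b c α β γ : Lattice3) : Set Lattice3 :=
  {δ | (0 ≤ pair δ a ∧ pair δ a < |pair α a|) ∧ (0 ≤ pair δ b ∧ pair δ b < |pair β b|) ∧
    (0 ≤ pair δ c ∧ pair δ c < |pair γ c|)}

/-- The family `(α, β, γ)` is dual to the family `(a, b, c)` up to scaling. -/
structure IsDualFamily (a b c α β γ : Lattice3) : Prop where
  aa : pair α a ≠ 0
  ab : pair α b = 0
  ac : pair α c = 0
  ba : pair β a = 0
  bb : pair β b ≠ 0
  bc : pair β c = 0
  ca : pair γ a = 0
  cb : pair γ b = 0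
  cc : pair γ c ≠ 0

namespace IsDualFamily

variable {a b c α β γ : Lattice3}

theorem pair_comb (h : IsDualFamily a b c α β γ) (δ : Lattice3) (i j k : ℤ) :
    pair (-δ + i • α + j • β + k • γ) a = -pair δ a + i * pair α a ∧
    pair (-δ + i • α + j • β + k • γ) b = -pair δ b + j * pair β b ∧
    pair (-δ + i • α + j • β + k • γ) c = -pair δ c + k * pair γ c := by
  simp only [pair_add, pair_neg, pair_zsmul, smul_eq_mul, h.ab, h.ac, h.ba, h.bc, h.ca, h.cb]
  simp

/-- Because the family is dual, division with remainder can be done separately for the values at a,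
b and c. The remainder enters as −ε so that ε(x) is added to w in the exponentials. -/
theorem exists_mem_fundDomain (h : IsDualFamily a b c α β γ) (δ : Lattice3) :
    ∃ ε ∈ fundDomain a b c α β γ, ∃ i j k : ℤ, δ = -ε + i • α + j • β + k • γ := by
  refine ⟨-δ + (-(-pair δ a / pair α a)) • α + (-(-pair δ b / pair β b)) • β
    + (-(-pair δ c / pair γ c)) • γ, ?_, -(-pair δ a / pair α a), -(-pair δ b / pair β b),
    -(-pair δ c / pair γ c), by abel⟩
  obtain ⟨h1, h2, h3⟩ := h.pair_comb δ (-(-pair δ a / pair α a)) (-(-pair δ b / pair β b))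
    (-(-pair δ c / pair γ c))
  have key : ∀ s e : ℤ, e ≠ 0 → 0 ≤ -s + -(-s / e) * e ∧ -s + -(-s / e) * e < |e| := by
    intro s e he
    have h4 : -s + -(-s / e) * e = -s % e := by rw [Int.emod_def]; ring
    rw [h4]
    exact ⟨Int.emod_nonneg _ he, Int.emod_lt_abs _ he⟩
  simp only [fundDomain, Set.mem_ofPred_eq]
  rw [h1, h2, h3]
  exact ⟨key _ _ h.aa, key _ _ h.bb, key _ _ h.cc⟩

theorem eq_of_comb_eq (h : IsDualFamily a b c α β γ) {δ ε : Lattice3}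
    (hδ : δ ∈ fundDomain a b c α β γ) (hε : ε ∈ fundDomain a b c α β γ) {i j k i' j' k' : ℤ}
    (he : -δ + i • α + j • β + k • γ = -ε + i' • α + j' • β + k' • γ) :
    δ = ε ∧ i = i' ∧ j = j' := by
  obtain ⟨h1, h2, h3⟩ := h.pair_comb δ i j k
  obtain ⟨h4, h5, h6⟩ := h.pair_comb ε i' j' k'
  rw [he] at h1 h2 h3
  have e1 := sub_eq_zero.mp (eq_zero_of_mul_eq_sub (k := i - i') hδ.1 hε.1 (by linarith))
  have e2 := sub_eq_zero.mp (eq_zero_of_mul_eq_sub (k := j - j') hδ.2.1 hε.2.1 (by linarith))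
  have e3 := sub_eq_zero.mp (eq_zero_of_mul_eq_sub (k := k - k') hδ.2.2 hε.2.2 (by linarith))
  rw [e1, e2, e3] at he
  exact ⟨by simpa using he, e1, e2⟩

/-- Cramer's rule: for a nonzero determinant a form is determined by its values at a, b, c. -/
theorem det_smul (a b c δ : Lattice3) : (Matrix.of ![a, b, c]).det • δ =
    pair δ a • crossProduct b c + pair δ b • crossProduct c a + pair δ c • crossProduct a b := by
  rw [det_of_three]
  funext i
  simp only [pair_int, cross_apply]
  fin_cases i <;> simp <;> ring

theorem finite_fundDomain (habc : (Matrix.of ![a, b, c]).det ≠ 0) :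
    (fundDomain a b c α β γ).Finite := by
  refine Set.Finite.of_finite_image (f := fun δ => (pair δ a, pair δ b, pair δ c)) ?_ ?_
  · refine ((Set.finite_Ico 0 |pair α a|).prod ((Set.finite_Ico 0 |pair β b|).prod
      (Set.finite_Ico 0 |pair γ c|))).subset ?_
    rintro _ ⟨δ, hδ, rfl⟩
    exact ⟨hδ.1, hδ.2.1, hδ.2.2⟩
  · intro δ _ ε _ he
    simp only [Prod.mk.injEq] at he
    refine smul_right_injective Lattice3 habc ?_
    simp only [det_smul, he]

/-- The classes modulo `γ` of the elements of `C_{+-}(a, b)`. -/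
def classEquiv (h : IsDualFamily a b c α β γ) (hα : 0 < pair α a) (hβ : 0 < pair β b) :
    fundDomain a b c α β γ × (ℕ × ℕ) ≃
      (QuotientAddGroup.mk '' conePM a b : Set (Lattice3 ⧸ AddSubgroup.zmultiples γ)) :=
  -- For ε in the domain and δ = −ε + iα + jβ, 0 ≤ ε(a) < α(a) gives δ(a) > 0 exactly when i ≥ 1,
  -- and 0 ≤ ε(b) < β(b) gives δ(b) ≤ 0 exactly when j ≤ 0. Hence i = m + 1 and j = −n.
  Equiv.ofBijective (fun p => ⟨((-p.1.1 + ((p.2.1 + 1 : ℕ) : ℤ) • α + (-(p.2.2 : ℤ)) • β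
      + (0 : ℤ) • γ : Lattice3) : Lattice3 ⧸ AddSubgroup.zmultiples γ), _, by
      obtain ⟨h1, h2, -⟩ := h.pair_comb p.1.1 ((p.2.1 + 1 : ℕ) : ℤ) (-(p.2.2 : ℤ)) 0
      have h3 := p.1.2.1
      have h4 := p.1.2.2.1
      rw [abs_of_pos hα] at h3
      refine ⟨?_, ?_⟩
      · rw [h1]; push_cast; nlinarith
      · rw [h2]; nlinarith, rfl⟩) (by
    constructor
    · rintro ⟨⟨δ, hδ⟩, m, n⟩ ⟨⟨ε, hε⟩, m', n'⟩ he
      obtain ⟨k, hk⟩ := AddSubgroup.mem_zmultiples_iff.mp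
        (QuotientAddGroup.eq.mp (Subtype.ext_iff.mp he))
      simp only at hk
      have hk' : -δ + ((m + 1 : ℕ) : ℤ) • α + (-(n : ℤ)) • β + k • γ
          = -ε + ((m' + 1 : ℕ) : ℤ) • α + (-(n' : ℤ)) • β + (0 : ℤ) • γ := by
        rw [hk, zero_smul]; abel
      obtain ⟨rfl, h1, h2⟩ := h.eq_of_comb_eq hδ hε hk'
      obtain rfl : m = m' := by omega
      obtain rfl : n = n' := by omega
      rfl
    · rintro ⟨_, δ, hδ, rfl⟩
      obtain ⟨ε, hε, i, j, k, rfl⟩ := h.exists_mem_fundDomain δ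
      obtain ⟨h1, h2, -⟩ := h.pair_comb ε i j k
      have h3 := hδ.1
      have h4 := hδ.2
      have h5 := hε.1
      have h6 := hε.2.1
      rw [abs_of_pos hα] at h5
      rw [abs_of_pos hβ] at h6
      rw [h1] at h3
      rw [h2] at h4
      have hi : 0 < i := by by_contra! hi; nlinarith
      have hj : j ≤ 0 := by by_contra! hj; nlinarith
      refine ⟨(⟨ε, hε⟩, (i - 1).toNat, (-j).toNat), Subtype.ext ?_⟩
      have e1 : (((i - 1).toNat + 1 : ℕ) : ℤ) = i := by omega
      have e2 : -(((-j).toNat : ℕ) : ℤ) = j := by omega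
      simp only [e1, e2]
      rw [QuotientAddGroup.eq]
      exact AddSubgroup.mem_zmultiples_iff.mpr ⟨k, by rw [zero_smul]; abel⟩)

theorem expTerm_classEquiv (h : IsDualFamily a b c α β γ) (hα : 0 < pair α a) (hβ : 0 < pair β b)
    {x : Fin 3 → ℂ} (hγ : pair γ x ≠ 0) (w : ℂ) (p : fundDomain a b c α β γ × (ℕ × ℕ)) :
    expTerm γ w x (Quotient.out (h.classEquiv hα hβ p).1) =
      Complex.exp (2 * Real.pi * Complex.I * (w + pair p.1.1 x - (p.2.1 + 1) * pair α x
        + p.2.2 * pair β x) / pair γ x) := by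
  refine (expTerm_out hγ w _).trans ?_
  rw [expTerm]
  simp only [pair_add, pair_neg, pair_zsmul, zero_smul, add_zero]
  simp only [zsmul_eq_mul]
  congr 2
  push_cast
  ring

/-- The numerator of `Γ_{a,b}` is a product of double infinite products. -/
theorem numProd_eq_prod (h : IsDualFamily a b c α β (dirVec a b))
    (hab : LinearIndependent ℤ ![a, b]) [Fintype (fundDomain a b c α β (dirVec a b))]
    (hα : 0 < pair α a) (hβ : 0 < pair β b) {x : Fin 3 → ℂ}
    (ha : 0 < pair a (imCross x)) (hb : 0 < pair b (imCross x)) (w : ℂ) :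
    numProd a b w x = ∏ δ : fundDomain a b c α β (dirVec a b),
      gammaProd (pair α x) (pair β x) (pair (dirVec a b) x) (w + pair δ.1 x) := by
  have hγ := pair_dirVec_ne_zero hab ha
  have hs := (summable_norm_expTerm hab ha hb w).comp_injective (h.classEquiv hα hβ).injective
  have hs' : Summable fun p : fundDomain a b c α β (dirVec a b) × (ℕ × ℕ) =>
      ‖-Complex.exp (2 * Real.pi * Complex.I * (w + pair p.1.1 x - (p.2.1 + 1) * pair α x
        + p.2.2 * pair β x) / pair (dirVec a b) x)‖ := by
    refine hs.congr fun p => ?_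
    rw [← h.expTerm_classEquiv hα hβ hγ w p]
    rfl
  have hm := multipliable_one_add_of_summable hs'
  have hf := fun δ => multipliable_one_add_of_summable (hs'.prod_factor δ)
  -- Absolute convergence permits splitting off the finite factor of the index set.
  have ht := hm.tprod_prod' hf
  rw [tprod_fintype (β := fundDomain a b c α β (dirVec a b))] at ht
  rw [numProd, classProd, ← (h.classEquiv hα hβ).tprod_eq]
  simp only [h.expTerm_classEquiv hα hβ hγ w]
  simp only [← sub_eq_add_neg] at ht
  exact ht

end IsDualFamily

end

section


/-! ### Families with nonvanishing determinant -/

theorem linearIndependent_of_det_ne_zero {a b c : Lattice3} (h : (Matrix.of ![a, b, c]).det ≠ 0) :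
    LinearIndependent ℤ ![a, b, c] :=
  Matrix.linearIndependent_rows_of_det_ne_zero h

theorem not_linearIndependent_of_det_eq_zero {a b c : Lattice3}
    (h : (Matrix.of ![a, b, c]).det = 0) : ¬ LinearIndependent ℤ ![a, b, c] := by
  obtain ⟨v, hv, h0⟩ := Matrix.exists_vecMul_eq_zero_iff.mpr h
  rw [Fintype.not_linearIndependent_iff]
  obtain ⟨i, hi⟩ := Function.ne_iff.mp hv
  refine ⟨v, ?_, i, hi⟩
  rw [Matrix.vecMul_eq_sum] at h0
  exact h0

theorem linearIndependent_pair_of_det_ne_zero {a b c : Lattice3}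
    (h : (Matrix.of ![a, b, c]).det ≠ 0) : LinearIndependent ℤ ![a, b] := by
  rw [LinearIndependent.pair_iff]
  intro s t hst
  have h1 := Fintype.linearIndependent_iff.mp (linearIndependent_of_det_ne_zero h) ![s, t, 0] (by
    rw [Fin.sum_univ_three]
    simpa using hst)
  exact ⟨h1 0, h1 1⟩

theorem isDualFamily_dirVec {a b c : Lattice3} (h : (Matrix.of ![a, b, c]).det ≠ 0) :
    IsDualFamily a b c (dirVec b c) (dirVec c a) (dirVec a b) := by
  have hab := linearIndependent_pair_of_det_ne_zero h
  have h1 : (Matrix.of ![b, c, a]).det ≠ 0 := by rwa [det_rotate]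
  have hbc := linearIndependent_pair_of_det_ne_zero h1
  have h2 : (Matrix.of ![c, a, b]).det ≠ 0 := by rwa [det_rotate]
  have hca := linearIndependent_pair_of_det_ne_zero h2
  refine ⟨?_, pair_dirVec_left hbc, pair_dirVec_right hbc, pair_dirVec_right hca, ?_,
    pair_dirVec_left hca, pair_dirVec_left hab, pair_dirVec_right hab, ?_⟩
  · rw [det_eq_modulus_mul_pair_dirVec] at h1
    exact right_ne_zero_of_mul h1
  · rw [det_eq_modulus_mul_pair_dirVec] at h2
    exact right_ne_zero_of_mul h2
  · rw [det_eq_modulus_mul_pair_dirVec] at h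
    exact right_ne_zero_of_mul h

theorem pair_dirVec_pos {a b c : Lattice3} (h : 0 < (Matrix.of ![a, b, c]).det) :
    0 < pair (dirVec a b) c := by
  have hs := modulus_pos (linearIndependent_pair_of_det_ne_zero h.ne')
  rw [det_eq_modulus_mul_pair_dirVec] at h
  exact pos_of_mul_pos_right h hs.le

namespace IsDualFamily

variable {a b c α β γ : Lattice3}

theorem rotate (h : IsDualFamily a b c α β γ) : IsDualFamily b c a β γ α :=
  ⟨h.bb, h.bc, h.ba, h.cb, h.cc, h.ca, h.ab, h.ac, h.aa⟩

theorem swap (h : IsDualFamily a b c α β γ) : IsDualFamily b a c β α (-γ) :=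
  ⟨h.bb, h.ba, h.bc, h.ab, h.aa, h.ac, by rw [pair_neg, h.cb, neg_zero],
    by rw [pair_neg, h.ca, neg_zero], by rw [pair_neg]; exact neg_ne_zero.mpr h.cc⟩

theorem det_mul_det (h : IsDualFamily a b c α β γ) :
    (Matrix.of ![α, β, γ]).det * (Matrix.of ![a, b, c]).det =
      pair α a * pair β b * pair γ c := by
  have h1 : (Matrix.of ![α, β, γ]).det * (Matrix.of ![a, b, c]).det = (Matrix.of
      ![![pair α a, pair α b, pair α c], ![pair β a, pair β b, pair β c],
        ![pair γ a, pair γ b, pair γ c]]).det := by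
    rw [← Matrix.det_transpose (Matrix.of ![a, b, c]), ← Matrix.det_mul]
    congr 1
    ext i j
    rw [Matrix.mul_apply, Fin.sum_univ_three]
    fin_cases i <;> fin_cases j <;> simp [pair_int]
  rw [h1, det_of_three, h.ab, h.ac, h.ba, h.bc, h.ca, h.cb]
  simp

/-- The points represent the classes modulo the sublattice spanned by α, β, γ, each exactly once, so
their number is its index. -/
theorem natCard_fundDomain (h : IsDualFamily a b c α β γ) :
    Nat.card (fundDomain a b c α β γ) = (Matrix.of ![α, β, γ]).det.natAbs := by
  have hdet : (Matrix.of ![α, β, γ]).det ≠ 0 := by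
    have h1 : (Matrix.of ![α, β, γ]).det * (Matrix.of ![a, b, c]).det ≠ 0 := by
      rw [h.det_mul_det]
      exact mul_ne_zero (mul_ne_zero h.aa h.bb) h.cc
    exact left_ne_zero_of_mul h1
  have hLI := linearIndependent_of_det_ne_zero hdet
  have hcard := Submodule.natAbs_det_basis_change (Pi.basisFun ℤ (Fin 3))
    (Submodule.span ℤ (Set.range ![α, β, γ])) (Module.Basis.span hLI)
  have hcoe : ((↑) ∘ (Module.Basis.span hLI) : Fin 3 → Lattice3) = ![α, β, γ] := by
    funext i
    exact congrArg Subtype.val (Module.Basis.span_apply hLI i)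
  rw [hcoe, Pi.basisFun_det_apply] at hcard
  refine Eq.trans ?_ hcard.symm
  refine Nat.card_congr (Equiv.ofBijective (fun δ => Submodule.Quotient.mk δ.1) ⟨?_, ?_⟩)
  · rintro ⟨δ, hδ⟩ ⟨ε, hε⟩ he
    obtain ⟨f, hf⟩ := (Submodule.mem_span_range_iff_exists_fun ℤ).mp
      ((Submodule.Quotient.eq _).mp he)
    rw [Fin.sum_univ_three] at hf
    simp only [Matrix.cons_val] at hf
    refine Subtype.ext (h.eq_of_comb_eq (i := f 0) (j := f 1) (k := f 2) (i' := 0) (j' := 0)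
      (k' := 0) hδ hε ?_).1
    rw [zero_smul, zero_smul, zero_smul, add_assoc, add_assoc, ← add_assoc (f 0 • α), hf]
    abel
  · intro q
    obtain ⟨δ, rfl⟩ := Submodule.Quotient.mk_surjective _ q
    obtain ⟨ε, hε, i, j, k, he⟩ := h.exists_mem_fundDomain (-δ)
    refine ⟨⟨ε, hε⟩, (Submodule.Quotient.eq _).mpr ?_⟩
    refine (Submodule.mem_span_range_iff_exists_fun ℤ).mpr ⟨![i, j, k], ?_⟩
    rw [Fin.sum_univ_three]
    simp only [Matrix.cons_val]
    rw [sub_eq_add_neg, he]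
    abel

end IsDualFamily

theorem fundDomain_rotate (a b c α β γ : Lattice3) :
    fundDomain b c a β γ α = fundDomain a b c α β γ := by
  ext δ
  simp only [fundDomain, Set.mem_ofPred_eq]
  tauto

/-- Thanks to the absolute values, the same points serve the reversed wedge, whose direction vector
is −γ; so numerators and denominators are indexed by one set. -/
theorem fundDomain_swap (a b c α β γ : Lattice3) :
    fundDomain b a c β α (-γ) = fundDomain a b c α β γ := by
  ext δ
  simp only [fundDomain, Set.mem_ofPred_eq, pair_neg, abs_neg]
  tauto

theorem parallelepiped_eq {a b c : Lattice3} (h : 0 < (Matrix.of ![a, b, c]).det) :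
    parallelepiped a b c = fundDomain a b c (dirVec b c) (dirVec c a) (dirVec a b) := by
  have h1 : 0 < (Matrix.of ![b, c, a]).det := by rwa [det_rotate]
  have h2 : 0 < (Matrix.of ![c, a, b]).det := by rwa [det_rotate]
  rw [parallelepiped, fundDomain, abs_of_pos (pair_dirVec_pos h), abs_of_pos (pair_dirVec_pos h1),
    abs_of_pos (pair_dirVec_pos h2)]

theorem finite_parallelepiped {a b c : Lattice3} (h : 0 < (Matrix.of ![a, b, c]).det) :
    (parallelepiped a b c).Finite := by
  rw [parallelepiped_eq h]
  exact IsDualFamily.finite_fundDomain h.ne'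

theorem parallelepiped_rotate (a b c : Lattice3) :
    parallelepiped b c a = parallelepiped a b c := by
  ext δ
  simp only [parallelepiped, Set.mem_ofPred_eq]
  tauto

theorem natCard_parallelepiped {a b c : Lattice3} (h : 0 < (Matrix.of ![a, b, c]).det) :
    (Nat.card (parallelepiped a b c) : ℤ) =
      (Matrix.of ![dirVec b c, dirVec c a, dirVec a b]).det := by
  have h1 : 0 < (Matrix.of ![b, c, a]).det := by rwa [det_rotate]
  have h2 : 0 < (Matrix.of ![c, a, b]).det := by rwa [det_rotate]
  have hd := isDualFamily_dirVec h.ne'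
  rw [parallelepiped_eq h, hd.natCard_fundDomain, Int.natCast_natAbs, abs_of_pos]
  have h3 := hd.det_mul_det
  have h4 : 0 < pair (dirVec b c) a * pair (dirVec c a) b * pair (dirVec a b) c :=
    mul_pos (mul_pos (pair_dirVec_pos h1) (pair_dirVec_pos h2)) (pair_dirVec_pos h)
  rw [← h3] at h4
  exact pos_of_mul_pos_left h4 h.le

/-! ### The three-term relation for the products -/

theorem IsDualFamily.numProd_eq_finset_prod {a b c α β : Lattice3}
    (h : IsDualFamily a b c α β (dirVec a b)) (hab : LinearIndependent ℤ ![a, b])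
    {s : Finset Lattice3} (hs : (s : Set Lattice3) = fundDomain a b c α β (dirVec a b))
    (hα : 0 < pair α a) (hβ : 0 < pair β b) {x : Fin 3 → ℂ}
    (ha : 0 < pair a (imCross x)) (hb : 0 < pair b (imCross x)) (w : ℂ) :
    numProd a b w x =
      ∏ δ ∈ s, gammaProd (pair α x) (pair β x) (pair (dirVec a b) x) (w + pair δ x) := by
  have hmem : ∀ δ, δ ∈ s ↔ δ ∈ fundDomain a b c α β (dirVec a b) := fun δ => by
    rw [← hs, Finset.mem_coe]
  have := Fintype.subtype s hmem
  rw [Finset.prod_subtype s hmem]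
  exact h.numProd_eq_prod hab hα hβ ha hb w

theorem IsDualFamily.numProd_swap_eq_finset_prod {a b c α β : Lattice3}
    (h : IsDualFamily a b c α β (dirVec a b)) (hab : LinearIndependent ℤ ![a, b])
    {s : Finset Lattice3} (hs : (s : Set Lattice3) = fundDomain a b c α β (dirVec a b))
    (hα : 0 < pair α a) (hβ : 0 < pair β b) {x : Fin 3 → ℂ}
    (ha : 0 < pair a (imCross x)) (hb : 0 < pair b (imCross x)) (w : ℂ) :
    numProd b a w x =
      ∏ δ ∈ s, gammaProd (pair β x) (pair α x) (-pair (dirVec a b) x) (w + pair δ x) := by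
  have h1 := h.swap
  rw [← fundDomain_swap] at hs
  rw [← dirVec_swap hab] at h1 hs
  rw [h1.numProd_eq_finset_prod (linearIndependent_pair_symm hab) hs hβ hα hb ha w,
    dirVec_swap hab, pair_neg]

/-- Applied to the three rotations of (a, b, c), this places the periods α(x), β(x), γ(x) in the
cyclic position that `gammaProd_three_term` requires. -/
theorem im_mul_conj_dirVec_pos {a b c β : Lattice3} (h : IsDualFamily a b c α β (dirVec a b))
    (hab : LinearIndependent ℤ ![a, b]) (hβ : 0 < pair β b) {x : Fin 3 → ℂ}
    (ha : 0 < pair a (imCross x)) :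
    0 < (pair β x * (starRingEnd ℂ) (pair (dirVec a b) x)).im := by
  have h1 := modulus_mul_im a b β x
  rw [h.ba, Int.cast_zero, zero_mul, sub_zero] at h1
  have h2 : (0 : ℝ) < modulus a b := by exact_mod_cast modulus_pos hab
  have h3 : (0 : ℝ) < pair β b := by exact_mod_cast hβ
  have h4 := mul_pos h3 ha
  rw [← h1] at h4
  exact pos_of_mul_pos_right h4 h2.le

/-- All six products run over the same finite set, so the identity holds for each δ separately, by
the relation for three periods at w + δ(x). -/
theorem numProd_three_term {a b c : Lattice3} (h : 0 < (Matrix.of ![a, b, c]).det)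
    {s : Finset Lattice3} (hs : (s : Set Lattice3) = parallelepiped a b c) {x : Fin 3 → ℂ}
    (ha : 0 < pair a (imCross x)) (hb : 0 < pair b (imCross x)) (hc : 0 < pair c (imCross x))
    (w : ℂ) : numProd a b w x * numProd b c w x * numProd c a w x =
      numProd b a w x * numProd c b w x * numProd a c w x *
        Complex.exp (-(Real.pi * Complex.I / 3) * ∑ δ ∈ s, (P₃ (pair (dirVec b c) x)
          (pair (dirVec c a) x) (pair (dirVec a b) x)).eval (w + pair δ x)) := by
  have h1 : 0 < (Matrix.of ![b, c, a]).det := by rwa [det_rotate]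
  have h2 : 0 < (Matrix.of ![c, a, b]).det := by rwa [det_rotate]
  have hab := linearIndependent_pair_of_det_ne_zero h.ne'
  have hbc := linearIndependent_pair_of_det_ne_zero h1.ne'
  have hca := linearIndependent_pair_of_det_ne_zero h2.ne'
  have p1 := pair_dirVec_pos h
  have p2 := pair_dirVec_pos h1
  have p3 := pair_dirVec_pos h2
  have hd := isDualFamily_dirVec h.ne'
  have hd1 := hd.rotate
  have hd2 := hd1.rotate
  rw [parallelepiped_eq h] at hs
  have hs1 := hs.trans (fundDomain_rotate a b c _ _ _).symm
  have hs2 := hs1.trans (fundDomain_rotate b c a _ _ _).symm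
  rw [hd.numProd_eq_finset_prod hab hs p2 p3 ha hb, hd1.numProd_eq_finset_prod hbc hs1 p3 p1 hb hc,
    hd2.numProd_eq_finset_prod hca hs2 p1 p2 hc ha,
    hd.numProd_swap_eq_finset_prod hab hs p2 p3 ha hb,
    hd1.numProd_swap_eq_finset_prod hbc hs1 p3 p1 hb hc,
    hd2.numProd_swap_eq_finset_prod hca hs2 p1 p2 hc ha, Finset.mul_sum, Complex.exp_sum]
  simp only [← Finset.prod_mul_distrib]
  refine Finset.prod_congr rfl fun δ _ => ?_
  have key := gammaProd_three_term (y := ![pair (dirVec b c) x, pair (dirVec c a) x,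
    pair (dirVec a b) x]) (fun j => ?_) (w + pair δ x)
  · simp only [Fin.prod_univ_three] at key
    simp only [Fin.isValue, zero_add, Fin.reduceAdd, Matrix.cons_val] at key
    linear_combination key
  · fin_cases j
    · exact im_mul_conj_dirVec_pos hd2 hca p2 hc
    · exact im_mul_conj_dirVec_pos hd hab p3 ha
    · exact im_mul_conj_dirVec_pos hd1 hbc p1 hb

end

section


/-! ### The polynomials of the three-term relation -/

/-- The sum of `P₃` over the lattice points of the parallelepiped of `(a, b, c)`. -/
def latticeSum (a b c : Lattice3) : RatFun[X] :=
  ∑ᶠ δ ∈ parallelepiped a b c, (P₃ (pair (dirVec b c) coord) (pair (dirVec c a) coord)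
    (pair (dirVec a b) coord)).comp (Polynomial.X + Polynomial.C (pair δ coord))

theorem P₃_rotate {F : Type*} [Field F] (x y z : F) : P₃ y z x = P₃ x y z := by
  rw [P₃, P₃, show y * z * x = x * y * z by ring, show y + z + x = x + y + z by ring,
    show 2 * y * z * x = 2 * x * y * z by ring,
    show y ^ 2 + z ^ 2 + x ^ 2 + 3 * y * z + 3 * z * x + 3 * y * x
      = x ^ 2 + y ^ 2 + z ^ 2 + 3 * x * y + 3 * y * z + 3 * x * z by ring,
    show 1 / y + 1 / z + 1 / x = 1 / x + 1 / y + 1 / z by ring]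

theorem latticeSum_rotate (a b c : Lattice3) : latticeSum b c a = latticeSum a b c := by
  rw [latticeSum, latticeSum, parallelepiped_rotate, P₃_rotate]

theorem latticeSum_eq_sum {a b c : Lattice3} (h : 0 < (Matrix.of ![a, b, c]).det) :
    latticeSum a b c = ∑ δ ∈ (finite_parallelepiped h).toFinset,
      (P₃ (pair (dirVec b c) coord) (pair (dirVec c a) coord)
        (pair (dirVec a b) coord)).comp (Polynomial.X + Polynomial.C (pair δ coord)) :=
  finsum_mem_eq_finite_toFinset_sum _ _

theorem P₃_comp_eq {F : Type*} [Field F] (x y z d : F) : ∃ R : F[X], R.degree ≤ 2 ∧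
    (P₃ x y z).comp (Polynomial.X + Polynomial.C d) =
      Polynomial.C (1 / (x * y * z)) * Polynomial.X ^ 3 + R := by
  simp only [P₃]
  generalize 1 / (x * y * z) = A
  generalize 3 * ((x + y + z) / (2 * x * y * z)) = B
  generalize (x ^ 2 + y ^ 2 + z ^ 2 + 3 * x * y + 3 * y * z + 3 * x * z) / (2 * x * y * z) = D
  generalize 1 / 4 * (x + y + z) * (1 / x + 1 / y + 1 / z) = E
  refine ⟨Polynomial.C (3 * A * d - B) * Polynomial.X ^ 2
    + Polynomial.C (3 * A * d ^ 2 - 2 * B * d + D) * Polynomial.X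
    + Polynomial.C (A * d ^ 3 - B * d ^ 2 + D * d - E), Polynomial.degree_quadratic_le, ?_⟩
  simp only [Polynomial.sub_comp, Polynomial.add_comp, Polynomial.mul_comp, Polynomial.C_comp,
    Polynomial.pow_comp, Polynomial.X_comp, map_sub, map_add, map_mul, map_pow, map_ofNat]
  ring

/-- A translation in w keeps the leading coefficient 1/(αβγ) of each summand, and there are det(α,
β, γ) summands. -/
theorem latticeSum_eq {a b c : Lattice3} (h : 0 < (Matrix.of ![a, b, c]).det) :
    ∃ R : RatFun[X], R.degree ≤ 2 ∧ latticeSum a b c =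
      Polynomial.C (((Matrix.of ![dirVec b c, dirVec c a, dirVec a b]).det : RatFun) /
        (pair (dirVec b c) coord * pair (dirVec c a) coord * pair (dirVec a b) coord)) *
          Polynomial.X ^ 3 + R := by
  choose R hR hR' using fun δ : Lattice3 => P₃_comp_eq (pair (dirVec b c) coord)
    (pair (dirVec c a) coord) (pair (dirVec a b) coord) (pair δ coord)
  refine ⟨∑ δ ∈ (finite_parallelepiped h).toFinset, R δ,
    (Polynomial.degree_sum_le _ _).trans (Finset.sup_le fun δ _ => hR δ), ?_⟩
  rw [latticeSum_eq_sum h]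
  simp only [hR', Finset.sum_add_distrib, Finset.sum_const]
  congr 1
  have hc := natCard_parallelepiped h
  rw [Nat.card_coe_set_eq, Set.ncard_eq_toFinset_card _ (finite_parallelepiped h)] at hc
  rw [← hc, nsmul_eq_mul, ← mul_assoc, Int.cast_natCast, ← Polynomial.C_eq_natCast,
    ← Polynomial.C_mul, mul_one_div]

theorem natDegree_latticeSum_le {a b c : Lattice3} (h : 0 < (Matrix.of ![a, b, c]).det) :
    (latticeSum a b c).natDegree ≤ 3 := by
  obtain ⟨R, hR, he⟩ := latticeSum_eq h
  rw [he, Polynomial.natDegree_le_iff_degree_le]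
  refine (Polynomial.degree_add_le _ _).trans (max_le (Polynomial.degree_C_mul_X_pow_le 3 _) ?_)
  exact hR.trans (by norm_num)

theorem exists_polyEvalsTo_latticeSum {a b c : Lattice3} (h : 0 < (Matrix.of ![a, b, c]).det)
    {x : Fin 3 → ℂ} (ha : 0 < pair a (imCross x)) (hb : 0 < pair b (imCross x))
    (hc : 0 < pair c (imCross x)) : ∃ q : ℂ[X], PolyEvalsTo x (latticeSum a b c) q ∧
      ∀ w, numProd a b w x * numProd b c w x * numProd c a w x =
        numProd b a w x * numProd c b w x * numProd a c w x *
          Complex.exp (-(Real.pi * Complex.I / 3) * q.eval w) := by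
  have h1 : 0 < (Matrix.of ![b, c, a]).det := by rwa [det_rotate]
  have h2 : 0 < (Matrix.of ![c, a, b]).det := by rwa [det_rotate]
  have n1 := pair_dirVec_ne_zero (linearIndependent_pair_of_det_ne_zero h.ne') ha
  have n2 := pair_dirVec_ne_zero (linearIndependent_pair_of_det_ne_zero h1.ne') hb
  have n3 := pair_dirVec_ne_zero (linearIndependent_pair_of_det_ne_zero h2.ne') hc
  refine ⟨∑ δ ∈ (finite_parallelepiped h).toFinset, (P₃ (pair (dirVec b c) x)
    (pair (dirVec c a) x) (pair (dirVec a b) x)).comp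
      (Polynomial.X + Polynomial.C (pair δ x)), ?_, fun w => ?_⟩
  · rw [latticeSum_eq_sum h]
    exact PolyEvalsTo.sum _ fun δ _ => polyEvalsTo_P₃_comp (evalsTo_pair_coord x _)
      (evalsTo_pair_coord x _) (evalsTo_pair_coord x _) (evalsTo_pair_coord x _) n2 n3 n1
  · rw [numProd_three_term h (finite_parallelepiped h).coe_toFinset ha hb hc w,
      Polynomial.eval_finsetSum]
    simp only [Polynomial.eval_comp, Polynomial.eval_add, Polynomial.eval_X, Polynomial.eval_C]

/-- The polynomial `P_{a,b,c}`. -/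
def cocyclePoly (a b c : Lattice3) : RatFun[X] :=
  if 0 < (Matrix.of ![a, b, c]).det then latticeSum a b c
  else if (Matrix.of ![a, b, c]).det < 0 then -latticeSum b a c
  else 0

theorem cocyclePoly_of_pos {a b c : Lattice3} (h : 0 < (Matrix.of ![a, b, c]).det) :
    cocyclePoly a b c = latticeSum a b c :=
  if_pos h

theorem cocyclePoly_of_neg {a b c : Lattice3} (h : (Matrix.of ![a, b, c]).det < 0) :
    cocyclePoly a b c = -latticeSum b a c := by
  rw [cocyclePoly, if_neg h.not_gt, if_pos h]

theorem cocyclePoly_of_eq_zero {a b c : Lattice3} (h : (Matrix.of ![a, b, c]).det = 0) :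
    cocyclePoly a b c = 0 := by
  rw [cocyclePoly, h, if_neg (lt_irrefl 0), if_neg (lt_irrefl 0)]

theorem natDegree_cocyclePoly_le (a b c : Lattice3) : (cocyclePoly a b c).natDegree ≤ 3 := by
  rcases lt_trichotomy (Matrix.of ![a, b, c]).det 0 with h | h | h
  · rw [cocyclePoly_of_neg h, Polynomial.natDegree_neg]
    exact natDegree_latticeSum_le (by rw [det_swap]; omega)
  · rw [cocyclePoly_of_eq_zero h, Polynomial.natDegree_zero]
    omega
  · rw [cocyclePoly_of_pos h]
    exact natDegree_latticeSum_le h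

/-- The three-term relation. -/
theorem wedgeGamma_three_term {a b c : Lattice3} (hpa : IsPrim a) (hpb : IsPrim b) (hpc : IsPrim c)
    {x : Fin 3 → ℂ} (ha : 0 < pair a (imCross x)) (hb : 0 < pair b (imCross x))
    (hc : 0 < pair c (imCross x)) : ∃ q : ℂ[X], PolyEvalsTo x (cocyclePoly a b c) q ∧
      ∀ w, NotPole a b w x → NotPole b c w x → NotPole c a w x →
        wedgeGamma a b w x * wedgeGamma b c w x * wedgeGamma c a w x =
          Complex.exp (-(Real.pi * Complex.I / 3) * q.eval w) := by
  by_cases h0 : (Matrix.of ![a, b, c]).det = 0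
  · refine ⟨0, ?_, fun w h1 h2 h3 => ?_⟩
    · rw [cocyclePoly_of_eq_zero h0]
      intro k
      simpa using evalsTo_ratCast x 0
    · rw [wedgeGamma_mul_of_dependent hpa hpb hpc ha hb hc (not_linearIndependent_of_det_eq_zero h0)
        h1 h2 h3, Polynomial.eval_zero, mul_zero, Complex.exp_zero]
  have hab := linearIndependent_pair_of_det_ne_zero h0
  have hbc : LinearIndependent ℤ ![b, c] :=
    linearIndependent_pair_of_det_ne_zero (c := a) (by rwa [det_rotate])
  have hca : LinearIndependent ℤ ![c, a] :=
    linearIndependent_pair_of_det_ne_zero (c := b) (by rwa [det_rotate, det_rotate])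
  -- The relation cleared of denominators holds for every w; the assumption on poles is needed only
  -- to divide.
  suffices hq : ∃ q : ℂ[X], PolyEvalsTo x (cocyclePoly a b c) q ∧
      ∀ w, numProd a b w x * numProd b c w x * numProd c a w x =
        numProd b a w x * numProd c b w x * numProd a c w x *
          Complex.exp (-(Real.pi * Complex.I / 3) * q.eval w) by
    obtain ⟨q, hq, hw⟩ := hq
    refine ⟨q, hq, fun w h1 h2 h3 => ?_⟩
    have n1 := h1.numProd_ne_zero hab ha hb
    have n2 := h2.numProd_ne_zero hbc hb hc
    have n3 := h3.numProd_ne_zero hca hc ha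
    rw [wedgeGamma_eq hab, wedgeGamma_eq hbc, wedgeGamma_eq hca, div_mul_div_comm,
      div_mul_div_comm, hw, mul_div_cancel_left₀ _ (mul_ne_zero (mul_ne_zero n1 n2) n3)]
  rcases lt_or_gt_of_ne h0 with h | h
  · obtain ⟨q, hq, hw⟩ := exists_polyEvalsTo_latticeSum (a := b) (b := a) (c := c)
      (by rw [det_swap]; omega) hb ha hc
    refine ⟨-q, ?_, fun w => ?_⟩
    · rw [cocyclePoly_of_neg h]
      exact hq.neg
    -- Exchanging a and b exchanges the two sides of the relation between numerators, so the
    -- exponential is inverted.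
    · have h1 := hw w
      rw [Polynomial.eval_neg, mul_neg, Complex.exp_neg, eq_mul_inv_iff_mul_eq₀ (Complex.exp_ne_zero _)]
      linear_combination -h1
  · rw [cocyclePoly_of_pos h]
    exact exists_polyEvalsTo_latticeSum h ha hb hc

/-! ### Symmetry -/

theorem cocyclePoly_swap (a b c : Lattice3) : cocyclePoly b a c = -cocyclePoly a b c := by
  have hs := det_swap a b c
  rcases lt_trichotomy (Matrix.of ![a, b, c]).det 0 with h | h | h
  · rw [cocyclePoly_of_neg h, cocyclePoly_of_pos (by omega), neg_neg]
  · rw [cocyclePoly_of_eq_zero h, cocyclePoly_of_eq_zero (by omega), neg_zero]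
  · rw [cocyclePoly_of_pos h, cocyclePoly_of_neg (by omega)]

theorem cocyclePoly_rotate (a b c : Lattice3) : cocyclePoly b c a = cocyclePoly a b c := by
  have hs := det_rotate a b c
  rcases lt_trichotomy (Matrix.of ![a, b, c]).det 0 with h | h | h
  · rw [cocyclePoly_of_neg h, cocyclePoly_of_neg (by omega), latticeSum_rotate a c b,
      latticeSum_rotate b a c]
  · rw [cocyclePoly_of_eq_zero h, cocyclePoly_of_eq_zero (by omega)]
  · rw [cocyclePoly_of_pos h, cocyclePoly_of_pos (by omega), latticeSum_rotate]

theorem cocyclePoly_comp_swap (v : Fin 3 → Lattice3) {i j : Fin 3} (hij : i ≠ j) :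
    cocyclePoly (v (Equiv.swap i j 0)) (v (Equiv.swap i j 1)) (v (Equiv.swap i j 2)) =
      -cocyclePoly (v 0) (v 1) (v 2) := by
  have h01 := cocyclePoly_swap (v 0) (v 1) (v 2)
  have h12 : cocyclePoly (v 0) (v 2) (v 1) = -cocyclePoly (v 0) (v 1) (v 2) := by
    rw [← cocyclePoly_rotate, cocyclePoly_swap, cocyclePoly_rotate]
  have h02 : cocyclePoly (v 2) (v 1) (v 0) = -cocyclePoly (v 0) (v 1) (v 2) := by
    rw [cocyclePoly_swap, cocyclePoly_rotate]
  have e1 : Equiv.swap (0 : Fin 3) 1 2 = 2 := by decide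
  have e2 : Equiv.swap (1 : Fin 3) 2 0 = 0 := by decide
  have e3 : Equiv.swap (0 : Fin 3) 2 1 = 1 := by decide
  fin_cases i <;> fin_cases j <;> first | exact absurd rfl hij | skip
  · simpa [e1] using h01
  · simpa [e3] using h02
  · simpa [Equiv.swap_comm (1 : Fin 3) 0, e1] using h01
  · simpa [e2] using h12
  · simpa [Equiv.swap_comm (2 : Fin 3) 0, e3] using h02
  · simpa [Equiv.swap_comm (2 : Fin 3) 1, e2] using h12

theorem cocyclePoly_comp_perm (v : Fin 3 → Lattice3) (σ : Equiv.Perm (Fin 3)) :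
    cocyclePoly (v 0) (v 1) (v 2) = ((Equiv.Perm.sign σ : ℤ) : RatFun[X]) *
      cocyclePoly (v (σ 0)) (v (σ 1)) (v (σ 2)) := by
  induction σ using Equiv.Perm.swap_induction_on generalizing v with
  | one => simp
  | swap_mul f i j hij ih =>
    rw [Equiv.Perm.sign_mul, Equiv.Perm.sign_swap hij, ← neg_eq_iff_eq_neg.mpr
      (cocyclePoly_comp_swap v hij)]
    have h := ih (v ∘ Equiv.swap i j)
    simp only [Function.comp_apply] at h
    rw [h]
    simp only [Equiv.Perm.mul_apply]
    push_cast
    ring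

end

section


/-! ### Equivariance -/

section equivariance

variable (g : Matrix.SpecialLinearGroup (Fin 3) ℤ) {a b c : Lattice3}

/-- The action of `g` on the dual lattice. -/
def dualAct (δ : Lattice3) : Lattice3 := δ ᵥ* (g⁻¹).1

theorem coe_inv_mul : (g⁻¹).1 * g.1 = 1 := by
  have h := congrArg Subtype.val (inv_mul_cancel g)
  simpa only [Matrix.SpecialLinearGroup.coe_mul, Matrix.SpecialLinearGroup.coe_one] using h

theorem coe_mul_inv : g.1 * (g⁻¹).1 = 1 := by
  have h := congrArg Subtype.val (mul_inv_cancel g)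
  simpa only [Matrix.SpecialLinearGroup.coe_mul, Matrix.SpecialLinearGroup.coe_one] using h

theorem pair_eq_dotProduct (δ x : Lattice3) : pair δ x = δ ⬝ᵥ x := rfl

theorem pair_dualAct_mulVec (δ x : Lattice3) : pair (dualAct g δ) (g.1 *ᵥ x) = pair δ x := by
  rw [pair_eq_dotProduct, dualAct, Matrix.dotProduct_mulVec, Matrix.vecMul_vecMul, coe_inv_mul,
    Matrix.vecMul_one, pair_eq_dotProduct]

theorem dualAct_injective : Function.Injective (dualAct g) := fun δ ε h => by
  have h1 := congrArg (fun u => u ᵥ* g.1) h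
  simpa only [dualAct, Matrix.vecMul_vecMul, coe_inv_mul, Matrix.vecMul_one] using h1

theorem dualAct_surjective : Function.Surjective (dualAct g) := fun δ =>
  ⟨δ ᵥ* g.1, by rw [dualAct, Matrix.vecMul_vecMul, coe_mul_inv, Matrix.vecMul_one]⟩

theorem isPrim_dualAct {δ : Lattice3} (h : IsPrim δ) : IsPrim (dualAct g δ) := by
  obtain ⟨u, hu⟩ := h.exists_sum_eq_one
  exact isPrim_of_sum_eq_one (u := g.1 *ᵥ u) ((pair_dualAct_mulVec g δ u).trans hu)

theorem det_mulVec (a b c : Lattice3) : (Matrix.of ![g.1 *ᵥ a, g.1 *ᵥ b, g.1 *ᵥ c]).det =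
    (Matrix.of ![a, b, c]).det := by
  have h : Matrix.of ![g.1 *ᵥ a, g.1 *ᵥ b, g.1 *ᵥ c] = Matrix.of ![a, b, c] * g.1ᵀ := by
    ext i j
    rw [Matrix.mul_apply]
    fin_cases i <;> simp [Matrix.mulVec, dotProduct, mul_comm]
  rw [h, Matrix.det_mul, Matrix.det_transpose, g.2, mul_one]

theorem cross_mulVec (a b : Lattice3) :
    crossProduct (g.1 *ᵥ a) (g.1 *ᵥ b) = dualAct g (crossProduct a b) := by
  have key : ∀ x y z : Lattice3, pair (crossProduct x y) z = (Matrix.of ![x, y, z]).det := by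
    intro x y z
    rw [det_of_three, pair_int]
    simp only [cross_apply, Matrix.cons_val]
    ring
  have h : ∀ z, pair (crossProduct (g.1 *ᵥ a) (g.1 *ᵥ b)) (g.1 *ᵥ z) =
      pair (dualAct g (crossProduct a b)) (g.1 *ᵥ z) := fun z => by
    rw [key, det_mulVec, pair_dualAct_mulVec, key]
  refine dotProduct_eq _ _ fun z => ?_
  have h1 := h ((g⁻¹).1 *ᵥ z)
  rwa [Matrix.mulVec_mulVec, coe_mul_inv, Matrix.one_mulVec] at h1

theorem dirVec_mulVec (hab : LinearIndependent ℤ ![a, b])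
    (hg : LinearIndependent ℤ ![g.1 *ᵥ a, g.1 *ᵥ b]) :
    dirVec (g.1 *ᵥ a) (g.1 *ᵥ b) = dualAct g (dirVec a b) := by
  refine (eq_dirVec hg (isPrim_dualAct g (isPrim_dirVec hab)) (modulus_pos hab) one_pos ?_).symm
  rw [one_smul, cross_mulVec, ← modulus_smul_dirVec a b, dualAct, dualAct, Matrix.smul_vecMul]

theorem ratSubst_coord (h : Matrix.SpecialLinearGroup (Fin 3) ℤ) (i : Fin 3) :
    ratSubst h (coord i) = pair (fun j => h.1 i j) coord := by
  rw [ratSubst, coord, IsFractionRing.ringEquivOfRingEquiv_algebraMap]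
  change algebraMap _ _ (polySubst h (MvPolynomial.X i)) = _
  rw [polySubst, MvPolynomial.aeval_X, pair, pair, map_sum]
  exact Finset.sum_congr rfl fun j _ => map_zsmul _ _ _

/-- Substituting g⁻¹x in δ(x) is the action of g on the form δ, so equivariance of the polynomials
reduces to that of the lattice data. -/
theorem ratSubst_pair_coord (δ : Lattice3) :
    ratSubst g⁻¹ (pair δ coord) = pair (dualAct g δ) coord := by
  rw [pair, map_sum]
  simp only [map_zsmul, ratSubst_coord]
  simp only [pair_eq, dualAct, Matrix.vecMul, dotProduct, Fin.sum_univ_three, zsmul_eq_mul]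
  push_cast
  ring

theorem map_P₃ {F K : Type*} [Field F] [Field K] (φ : F →+* K) (x y z : F) :
    (P₃ x y z).map φ = P₃ (φ x) (φ y) (φ z) := by
  simp [P₃, map_ofNat φ 2, map_ofNat φ 3, map_ofNat φ 4]

/-- The action of g preserves determinants and pairings, hence carries direction vectors and the
parallelepiped to those of the transformed triple; the sum is reindexed along this bijection. -/
theorem latticeSum_mulVec (h : 0 < (Matrix.of ![a, b, c]).det) :
    latticeSum (g.1 *ᵥ a) (g.1 *ᵥ b) (g.1 *ᵥ c) =
      (latticeSum a b c).map (ratSubst g⁻¹).toRingHom := by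
  have hg : 0 < (Matrix.of ![g.1 *ᵥ a, g.1 *ᵥ b, g.1 *ᵥ c]).det := by rwa [det_mulVec]
  have h1 : 0 < (Matrix.of ![b, c, a]).det := by rwa [det_rotate]
  have h2 : 0 < (Matrix.of ![c, a, b]).det := by rwa [det_rotate]
  have h1g : 0 < (Matrix.of ![g.1 *ᵥ b, g.1 *ᵥ c, g.1 *ᵥ a]).det := by rwa [det_mulVec]
  have h2g : 0 < (Matrix.of ![g.1 *ᵥ c, g.1 *ᵥ a, g.1 *ᵥ b]).det := by rwa [det_mulVec]
  have d1 := dirVec_mulVec g (linearIndependent_pair_of_det_ne_zero h.ne')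
    (linearIndependent_pair_of_det_ne_zero hg.ne')
  have d2 := dirVec_mulVec g (linearIndependent_pair_of_det_ne_zero h1.ne')
    (linearIndependent_pair_of_det_ne_zero h1g.ne')
  have d3 := dirVec_mulVec g (linearIndependent_pair_of_det_ne_zero h2.ne')
    (linearIndependent_pair_of_det_ne_zero h2g.ne')
  have hp : parallelepiped (g.1 *ᵥ a) (g.1 *ᵥ b) (g.1 *ᵥ c) =
      dualAct g '' parallelepiped a b c := by
    ext δ
    obtain ⟨ε, rfl⟩ := dualAct_surjective g δ
    rw [(dualAct_injective g).mem_set_image]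
    simp only [parallelepiped, Set.mem_ofPred_eq, d1, d2, d3, pair_dualAct_mulVec]
  rw [latticeSum, hp, finsum_mem_image (dualAct_injective g).injOn, d1, d2, d3,
    latticeSum_eq_sum h, Polynomial.map_sum,
    finsum_mem_eq_finite_toFinset_sum _ (finite_parallelepiped h)]
  refine Finset.sum_congr rfl fun δ _ => ?_
  have hr : ∀ ε, (ratSubst g⁻¹).toRingHom (pair ε coord) = pair (dualAct g ε) coord :=
    ratSubst_pair_coord g
  rw [Polynomial.map_comp, map_P₃, Polynomial.map_add, Polynomial.map_X, Polynomial.map_C, hr, hr,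
    hr, hr]

theorem cocyclePoly_mulVec (a b c : Lattice3) :
    cocyclePoly (g.1 *ᵥ a) (g.1 *ᵥ b) (g.1 *ᵥ c) =
      (cocyclePoly a b c).map (ratSubst g⁻¹).toRingHom := by
  have hg := det_mulVec g a b c
  rcases lt_trichotomy (Matrix.of ![a, b, c]).det 0 with h | h | h
  · rw [cocyclePoly_of_neg h, cocyclePoly_of_neg (by omega),
      latticeSum_mulVec g (by rw [det_swap]; omega), Polynomial.map_neg]
  · rw [cocyclePoly_of_eq_zero h, cocyclePoly_of_eq_zero (by omega), Polynomial.map_zero]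
  · rw [cocyclePoly_of_pos h, cocyclePoly_of_pos (by omega), latticeSum_mulVec g h]

end equivariance

end

end EllGamma

end

/-! ### Assembly of the theorem. -/

open EllGamma in
theorem mainTheorem3 :
    -- the products that define `Γ_{a,b}` converge on the domain
    (∀ a b : Lattice3, IsPrim a → IsPrim b → LinearIndependent ℤ ![a, b] →
      ∀ x ∈ U a ∩ U b, ∀ w : ℂ,
        Multipliable (numFactor a b w x) ∧ Multipliable (denFactor a b w x)) ∧
    -- `P₃ = B_{3,3}`
    (∀ y : Fin 3 → RatFun, (∀ i, y i ≠ 0) → P₃ (y 0) (y 1) (y 2) = multiBernoulli 3 3 y) ∧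
    ∃ P : (Fin 3 → Lattice3) → Polynomial RatFun,
      -- the three-term relation
      (∀ a b c : Lattice3, IsPrim a → IsPrim b → IsPrim c →
        (P ![a, b, c]).natDegree ≤ 3 ∧
        ∀ x ∈ U a ∩ U b ∩ U c,
          (∀ k, RegularAt ((P ![a, b, c]).coeff k) x) ∧
          ∀ w : ℂ, NotPole a b w x → NotPole b c w x → NotPole c a w x →
            wedgeGamma a b w x * wedgeGamma b c w x * wedgeGamma c a w x =
              Complex.exp (-(Real.pi * Complex.I / 3) * polyEval (P ![a, b, c]) w x)) ∧
      -- (i)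
      (∀ a b c : Lattice3, IsPrim a → IsPrim b → IsPrim c →
        ¬ LinearIndependent ℤ ![a, b, c] → P ![a, b, c] = 0) ∧
      -- (ii)
      (∀ a b c : Lattice3, IsPrim a → IsPrim b → IsPrim c → 0 < (Matrix.of ![a, b, c]).det →
        ∀ α β γ : Lattice3, α = dirVec b c → β = dirVec c a → γ = dirVec a b →
          (parallelepiped a b c).Finite ∧
          P ![a, b, c] = ∑ᶠ δ ∈ parallelepiped a b c,
            (P₃ (pair α coord) (pair β coord) (pair γ coord)).comp
              (Polynomial.X + Polynomial.C (pair δ coord)) ∧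
          ∃ R : Polynomial RatFun, R.degree ≤ 2 ∧
            P ![a, b, c] =
              Polynomial.C (((Matrix.of ![α, β, γ]).det : RatFun) /
                (pair α coord * pair β coord * pair γ coord)) * Polynomial.X ^ 3 + R) ∧
      -- (iii)
      (∀ v : Fin 3 → Lattice3, (∀ i, IsPrim (v i)) → ∀ σ : Equiv.Perm (Fin 3),
        P v = ((Equiv.Perm.sign σ : ℤ) : Polynomial RatFun) * P (v ∘ σ)) ∧
      -- equivariance
      (∀ v : Fin 3 → Lattice3, (∀ i, IsPrim (v i)) →
        ∀ g : Matrix.SpecialLinearGroup (Fin 3) ℤ,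
          P (fun i => g.1 *ᵥ v i) = (P v).map (ratSubst g⁻¹).toRingHom) := by
  have hU : ∀ {a : Lattice3} {x : Fin 3 → ℂ}, IsPrim a → x ∈ U a → 0 < pair a (imCross x) :=
    fun ha hx => pair_imCross_pos ha.ne_zero hx
  refine ⟨fun a b ha hb hab x hx w => ⟨multipliable_numFactor hab (hU ha hx.1) (hU hb hx.2) w,
    multipliable_denFactor hab (hU ha hx.1) (hU hb hx.2) w⟩, P₃_eq_multiBernoulli,
    fun v => cocyclePoly (v 0) (v 1) (v 2), ?_, ?_, ?_, ?_, ?_⟩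
  · refine fun a b c ha hb hc => ⟨natDegree_cocyclePoly_le a b c, fun x hx => ?_⟩
    obtain ⟨q, hq, hw⟩ := wedgeGamma_three_term ha hb hc (hU ha hx.1.1) (hU hb hx.1.2) (hU hc hx.2)
    refine ⟨fun k => (hq k).1, fun w h1 h2 h3 => ?_⟩
    have he := hq.polyEval_eq w
    rw [hw w h1 h2 h3, ← he]
    rfl
  · intro a b c _ _ _ h
    refine cocyclePoly_of_eq_zero ?_
    by_contra h0
    exact h (linearIndependent_of_det_ne_zero h0)
  · rintro a b c _ _ _ h _ _ _ rfl rfl rfl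
    refine ⟨finite_parallelepiped h, cocyclePoly_of_pos h, ?_⟩
    obtain ⟨R, hR, he⟩ := latticeSum_eq h
    exact ⟨R, hR, (cocyclePoly_of_pos h).trans he⟩
  · exact fun v _ σ => cocyclePoly_comp_perm v σ
  · exact fun v _ g => cocyclePoly_mulVec g (v 0) (v 1) (v 2)
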